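/- Let $n,m\in\mathbb N$, $d=n+m$, and let $\mathbb S_+^k$ denote the set of symmetric positive semidefinite real $k\times k$ matrices. Let $(\mathcal A_t,N_t)$, $t=1,2,\dots$, be i.i.d. pairs of random matrices on a probability space, with $\mathcal A_t\in\mathbb R^{n\times d}$ and $N_t\in\mathbb S_+^d$ almost surely, and let $(\mathcal A,N)$ denote an independent copy of $(\mathcal A_1,N_1)$. Put $\mathcal F_t=\sigma\{\mathcal A_s,N_s: s=1,\dots,t\}$, with $\mathcal F_0$ trivial. *LQ problem.* For $x\in\mathbb R^n$ and an $(\mathcal F_t)$-adapted $\mathbb R^m$-valued process $u=(u_t)_{t\ge 0}$ (an admissible control), let $x_0=x$, $x_{t+1}=\mathcal A_{t+1}\begin{bmatrix}x_t\\u_t\end{bmatrix}$, and $$J(x,u)=\sum_{t=0}^\infty [x_t^\top,u_t^\top]\,N_{t+1}\begin{bmatrix}x_t\\u_t\end{bmatrix}\in[0,\infty],\qquad V(x)=\inf_{u\text{ admissible}}\mathbb E[J(x,u)].$$ The LQ problem is well-posed if $V(x)<\infty$ for all $x\in\mathbb R^n$; an admissible $u$ is optimal for $x$ if $\mathbb E[J(x,u)]=V(x)$.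 *Riccati equation.* For $P=\begin{bmatrix}P_{xx}&P_{xu}\\P_{ux}&P_{uu}\end{bmatrix}\in\mathbb S_+^d$ with $P_{xx}\in\mathbb R^{n\times n}$, let $\pi(P)=P_{xx}-P_{xu}P_{uu}^+P_{ux}$ and $\Gamma(P)=-P_{uu}^+P_{ux}$, where $^+$ is the Moore–Penrose pseudoinverse. A solution of the algebraic Riccati equation (ARE) is a matrix $K\in\mathbb S_+^n$ with $K=\pi(\mathbb E[N+\mathcal A^\top K\mathcal A])$. *Q-learning.* Let $Q_0\in\mathbb S_+^d$ be deterministic and $$Q_{t+1}=Q_t+\alpha_t\bigl(N_{t+1}+\mathcal A_{t+1}^\top\pi(Q_t)\mathcal A_{t+1}-Q_t\bigr),\quad t\ge0,$$ where $\alpha_t$ is $\mathcal F_t$-measurable with values in $[0,1]$, $\sum_t\alpha_t=\infty$ and $\sum_t\alpha_t^2<\infty$ almost surely. **Theorem.** Assume that $\mathbb E[\|N\|_2^2+\|\mathcal A^\top\mathcal A\|_2^2]<\infty$ (matrix $2$-norms) and that $\mathbb E[N]$ is positive definite. Then the following are equivalent: (a) the LQ problem is well-posed; (b) the ARE has a solution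 $K$; (c) the sequence $(Q_t)_{t\ge0}$ is bounded with positive probability; (d) $(Q_t)_{t\ge0}$ converges almost surely to a deterministic matrix $Q^\star\in\mathbb S_+^d$. If these hold, then, moreover: (1) $V(x)=x^\top Kx$ for all $x\in\mathbb R^n$; (2) the solution of the ARE is unique and given by $K=\pi(Q^\star)$; (3) for every $x\in\mathbb R^n$ the feedback control $u_t=\Gamma(Q^\star)x_t$ is admissible and optimal; (4) $Q^\star=\mathbb E[N+\mathcal A^\top\pi(Q^\star)\mathcal A]$. -/

import Mathlib

open MeasureTheory ProbabilityTheory Filter Topology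
open scoped Matrix ENNReal

namespace RandomLQ

section PseudoInverse

variable {ι κ : Type*} [Fintype ι] [Fintype κ]

/-- The four Penrose equations: `X` is a Moore-Penrose pseudoinverse of the real matrix `A`. -/
structure IsMoorePenrose (A : Matrix ι κ ℝ) (X : Matrix κ ι ℝ) : Prop where
  mul_mul_self : A * X * A = A
  mul_mul_inv : X * A * X = X
  symm_left : (A * X)ᵀ = A * X
  symm_right : (X * A)ᵀ = X * A

theorem IsMoorePenrose.unique {A : Matrix ι κ ℝ} {X Y : Matrix κ ι ℝ}
    (hX : IsMoorePenrose A X) (hY : IsMoorePenrose A Y) : X = Y := by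
  have h1 : A * X = A * Y := by
    calc A * X = (A * X)ᵀ := hX.symm_left.symm
      _ = ((A * Y) * (A * X))ᵀ := by
        rw [← Matrix.mul_assoc (A * Y) A X, hY.mul_mul_self]
      _ = (A * X) * (A * Y) := by rw [Matrix.transpose_mul, hX.symm_left, hY.symm_left]
      _ = A * Y := by rw [← Matrix.mul_assoc (A * X) A Y, hX.mul_mul_self]
  have h2 : X * A = Y * A := by
    calc X * A = (X * A)ᵀ := hX.symm_right.symm
      _ = ((X * A) * (Y * A))ᵀ := by
        rw [Matrix.mul_assoc X A (Y * A), ← Matrix.mul_assoc A Y A, hY.mul_mul_self]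
      _ = (Y * A) * (X * A) := by rw [Matrix.transpose_mul, hX.symm_right, hY.symm_right]
      _ = Y * A := by rw [Matrix.mul_assoc Y A (X * A), ← Matrix.mul_assoc A X A, hX.mul_mul_self]
  calc X = X * A * X := hX.mul_mul_inv.symm
    _ = Y * A * Y := by rw [h2, Matrix.mul_assoc, h1, ← Matrix.mul_assoc]
    _ = Y := hY.mul_mul_inv

theorem exists_isMoorePenrose_of_isHermitian [DecidableEq ι] {A : Matrix ι ι ℝ}
    (hA : A.IsHermitian) : ∃ X : Matrix ι ι ℝ, IsMoorePenrose A X ∧ Xᵀ = X := by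
  obtain ⟨U, D, hU, hAD⟩ : ∃ (U : Matrix ι ι ℝ) (D : ι → ℝ), Uᵀ * U = 1 ∧
      A = U * Matrix.diagonal D * Uᵀ := by
    refine ⟨hA.eigenvectorUnitary, hA.eigenvalues, ?_, ?_⟩
    · have := Unitary.coe_star_mul_self hA.eigenvectorUnitary
      simpa [Matrix.star_eq_conjTranspose] using this
    · have := hA.spectral_theorem
      simpa [Unitary.conjStarAlgAut_apply, Matrix.star_eq_conjTranspose, Function.comp_def] using this
  have key : ∀ D E : ι → ℝ, (U * Matrix.diagonal D * Uᵀ) * (U * Matrix.diagonal E * Uᵀ)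
      = U * Matrix.diagonal (fun i => D i * E i) * Uᵀ := by
    intro D E
    calc (U * Matrix.diagonal D * Uᵀ) * (U * Matrix.diagonal E * Uᵀ)
        = U * Matrix.diagonal D * (Uᵀ * U) * Matrix.diagonal E * Uᵀ := by
          simp only [Matrix.mul_assoc]
      _ = U * Matrix.diagonal (fun i => D i * E i) * Uᵀ := by
          rw [hU, Matrix.mul_one, Matrix.mul_assoc U, Matrix.diagonal_mul_diagonal]
  have keyT : ∀ D : ι → ℝ, (U * Matrix.diagonal D * Uᵀ)ᵀ = U * Matrix.diagonal D * Uᵀ := by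
    intro D
    simp [Matrix.transpose_mul, Matrix.mul_assoc]
  refine ⟨U * Matrix.diagonal (fun i => (D i)⁻¹) * Uᵀ, ⟨?_, ?_, ?_, ?_⟩, keyT _⟩
  · rw [hAD, key, key]
    simp only [mul_inv_mul_cancel]
  · rw [hAD, key, key]
    have : ∀ i, (D i)⁻¹ * D i * (D i)⁻¹ = (D i)⁻¹ := fun i => by
      simpa using mul_inv_mul_cancel (D i)⁻¹
    simp only [this]
  · rw [hAD, key, keyT]
  · rw [hAD, key, keyT]

theorem exists_isMoorePenrose [DecidableEq κ] (A : Matrix ι κ ℝ) :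
    ∃ X : Matrix κ ι ℝ, IsMoorePenrose A X := by
  have hG : (Aᵀ * A).IsHermitian := by
    simpa using Matrix.isHermitian_conjTranspose_mul_self A
  obtain ⟨G, hG, hGT⟩ := exists_isMoorePenrose_of_isHermitian hG
  have hA : A * (G * (Aᵀ * A)) = A := by
    have hz : A - A * (G * (Aᵀ * A)) = 0 := by
      rw [← Matrix.conjTranspose_mul_self_eq_zero]
      have h1 : (Aᵀ * A) * (G * (Aᵀ * A)) = Aᵀ * A := by
        rw [← Matrix.mul_assoc, hG.mul_mul_self]
      have h2 : Aᵀ * (A - A * (G * (Aᵀ * A))) = 0 := by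
        rw [Matrix.mul_sub, ← Matrix.mul_assoc, h1, sub_self]
      have h3 : (A - A * (G * (Aᵀ * A)))ᵀ = Aᵀ - G * (Aᵀ * A) * Aᵀ := by
        rw [Matrix.transpose_sub, Matrix.transpose_mul, hG.symm_right]
      simp only [Matrix.conjTranspose_eq_transpose_of_trivial]
      rw [h3, Matrix.sub_mul, h2, Matrix.mul_assoc, h2]
      simp
    exact (sub_eq_zero.mp hz).symm
  refine ⟨G * Aᵀ, ⟨?_, ?_, ?_, ?_⟩⟩
  · simpa only [Matrix.mul_assoc] using hA
  · have := congrArg (fun M => M * Aᵀ) hG.mul_mul_inv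
    simpa only [Matrix.mul_assoc] using this
  · rw [Matrix.transpose_mul, Matrix.transpose_mul, hGT, Matrix.transpose_transpose,
      Matrix.mul_assoc]
  · have := hG.symm_right
    simpa only [Matrix.mul_assoc] using this

/-- The Moore-Penrose pseudoinverse of a real matrix. -/
noncomputable def pinv [DecidableEq κ] (A : Matrix ι κ ℝ) : Matrix κ ι ℝ :=
  Classical.choose (exists_isMoorePenrose A)

theorem isMoorePenrose_pinv [DecidableEq κ] (A : Matrix ι κ ℝ) : IsMoorePenrose A (pinv A) :=
  Classical.choose_spec (exists_isMoorePenrose A)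

end PseudoInverse

/-- The spectral (operator) `2`-norm of a square real matrix. -/
noncomputable def norm2 {ι : Type*} [Fintype ι] [DecidableEq ι] (M : Matrix ι ι ℝ) : ℝ :=
  ‖Matrix.toEuclideanCLM (n := ι) (𝕜 := ℝ) M‖

/-- Entrywise expectation of a random matrix. -/
noncomputable def expect {Ω ι κ : Type*} [MeasurableSpace Ω] (μ : Measure Ω)
    (M : Ω → Matrix ι κ ℝ) : Matrix ι κ ℝ :=
  Matrix.of fun i j => ∫ ω, M ω i j ∂μ

/-- The product (= Borel) σ-algebra on matrices. -/
instance instMeasurableSpaceMatrix {ι κ : Type*} : MeasurableSpace (Matrix ι κ ℝ) :=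
  inferInstanceAs (MeasurableSpace (ι → κ → ℝ))

section Riccati

variable {n m : ℕ}

/-- `π(P) = P_xx - P_xu P_uu⁺ P_ux`, for the block partition of `P` along `n + m`. -/
noncomputable def piMap (P : Matrix (Fin n ⊕ Fin m) (Fin n ⊕ Fin m) ℝ) :
    Matrix (Fin n) (Fin n) ℝ :=
  P.toBlocks₁₁ - P.toBlocks₁₂ * pinv P.toBlocks₂₂ * P.toBlocks₂₁

/-- `Γ(P) = -P_uu⁺ P_ux`. -/
noncomputable def gammaMap (P : Matrix (Fin n ⊕ Fin m) (Fin n ⊕ Fin m) ℝ) :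
    Matrix (Fin m) (Fin n) ℝ :=
  -(pinv P.toBlocks₂₂ * P.toBlocks₂₁)

variable {Ω : Type*}

/-- `E[N + 𝒜ᵀ K 𝒜]`, where `(A₁, N₁)` is a random pair with the common law of the parameters. -/
noncomputable def meanQ [MeasurableSpace Ω] (μ : Measure Ω)
    (A₁ : Ω → Matrix (Fin n) (Fin n ⊕ Fin m) ℝ)
    (N₁ : Ω → Matrix (Fin n ⊕ Fin m) (Fin n ⊕ Fin m) ℝ)
    (K : Matrix (Fin n) (Fin n) ℝ) : Matrix (Fin n ⊕ Fin m) (Fin n ⊕ Fin m) ℝ :=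
  expect μ fun ω => N₁ ω + (A₁ ω)ᵀ * K * A₁ ω

/-- `K` is a (positive semidefinite) solution of the algebraic Riccati equation
`K = π(E[N + 𝒜ᵀ K 𝒜])`. As `π` acts on positive semidefinite matrices only and has positive
semidefinite values, `K` has to be positive semidefinite. -/
def SolvesARE [MeasurableSpace Ω] (μ : Measure Ω)
    (A₁ : Ω → Matrix (Fin n) (Fin n ⊕ Fin m) ℝ)
    (N₁ : Ω → Matrix (Fin n ⊕ Fin m) (Fin n ⊕ Fin m) ℝ)
    (K : Matrix (Fin n) (Fin n) ℝ) : Prop :=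
  K.PosSemidef ∧ K = piMap (meanQ μ A₁ N₁ K)

/-- `σ{𝒜_s, N_s : s = 1, …, t}`; the trivial σ-algebra for `t = 0`. -/
abbrev info (A : ℕ → Ω → Matrix (Fin n) (Fin n ⊕ Fin m) ℝ)
    (N : ℕ → Ω → Matrix (Fin n ⊕ Fin m) (Fin n ⊕ Fin m) ℝ) (t : ℕ) : MeasurableSpace Ω :=
  ⨆ s ∈ Set.Icc 1 t, MeasurableSpace.comap (fun ω => (A s ω, N s ω)) inferInstance

/-- The state process: `x_0 = x`, `x_{t+1} = 𝒜_{t+1} [x_t; u_t]`. -/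
def state (A : ℕ → Ω → Matrix (Fin n) (Fin n ⊕ Fin m) ℝ) (x : Fin n → ℝ)
    (u : ℕ → Ω → Fin m → ℝ) : ℕ → Ω → Fin n → ℝ
  | 0, _ => x
  | t + 1, ω => A (t + 1) ω *ᵥ Sum.elim (state A x u t ω) (u t ω)

/-- The stacked vector `[x_t; u_t]`. -/
def stateControl (A : ℕ → Ω → Matrix (Fin n) (Fin n ⊕ Fin m) ℝ) (x : Fin n → ℝ)
    (u : ℕ → Ω → Fin m → ℝ) (t : ℕ) (ω : Ω) : Fin n ⊕ Fin m → ℝ :=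
  Sum.elim (state A x u t ω) (u t ω)

/-- The cost `J(x,u) = ∑_t [x_t; u_t]ᵀ N_{t+1} [x_t; u_t]`, a sum of nonnegative terms (for
positive semidefinite `N_{t+1}`) with value in `[0,∞]`. -/
noncomputable def cost (A : ℕ → Ω → Matrix (Fin n) (Fin n ⊕ Fin m) ℝ)
    (N : ℕ → Ω → Matrix (Fin n ⊕ Fin m) (Fin n ⊕ Fin m) ℝ) (x : Fin n → ℝ)
    (u : ℕ → Ω → Fin m → ℝ) (ω : Ω) : ℝ≥0∞ :=
  ∑' t : ℕ, ENNReal.ofReal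
    (stateControl A x u t ω ⬝ᵥ (N (t + 1) ω *ᵥ stateControl A x u t ω))

/-- Admissible controls: all processes adapted to the information on the parameters. -/
def Admissible (A : ℕ → Ω → Matrix (Fin n) (Fin n ⊕ Fin m) ℝ)
    (N : ℕ → Ω → Matrix (Fin n ⊕ Fin m) (Fin n ⊕ Fin m) ℝ) (u : ℕ → Ω → Fin m → ℝ) : Prop :=
  ∀ t, Measurable[info A N t] (u t)

/-- `E[J(x,u)]`. -/
noncomputable def expectedCost [MeasurableSpace Ω] (μ : Measure Ω)
    (A : ℕ → Ω → Matrix (Fin n) (Fin n ⊕ Fin m) ℝ)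
    (N : ℕ → Ω → Matrix (Fin n ⊕ Fin m) (Fin n ⊕ Fin m) ℝ) (x : Fin n → ℝ)
    (u : ℕ → Ω → Fin m → ℝ) : ℝ≥0∞ :=
  ∫⁻ ω, cost A N x u ω ∂μ

/-- The value function `V(x) = inf_u E[J(x,u)]`. -/
noncomputable def value [MeasurableSpace Ω] (μ : Measure Ω)
    (A : ℕ → Ω → Matrix (Fin n) (Fin n ⊕ Fin m) ℝ)
    (N : ℕ → Ω → Matrix (Fin n ⊕ Fin m) (Fin n ⊕ Fin m) ℝ) (x : Fin n → ℝ) : ℝ≥0∞ :=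
  ⨅ (u : ℕ → Ω → Fin m → ℝ) (_ : Admissible A N u), expectedCost μ A N x u

/-- The LQ problem is well-posed: the value function is finite everywhere. -/
def WellPosed [MeasurableSpace Ω] (μ : Measure Ω)
    (A : ℕ → Ω → Matrix (Fin n) (Fin n ⊕ Fin m) ℝ)
    (N : ℕ → Ω → Matrix (Fin n ⊕ Fin m) (Fin n ⊕ Fin m) ℝ) : Prop :=
  ∀ x : Fin n → ℝ, value μ A N x < ∞

/-- `u` is an optimal control for the initial state `x`. -/
def IsOptimal [MeasurableSpace Ω] (μ : Measure Ω)
    (A : ℕ → Ω → Matrix (Fin n) (Fin n ⊕ Fin m) ℝ)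
    (N : ℕ → Ω → Matrix (Fin n ⊕ Fin m) (Fin n ⊕ Fin m) ℝ) (x : Fin n → ℝ)
    (u : ℕ → Ω → Fin m → ℝ) : Prop :=
  Admissible A N u ∧ expectedCost μ A N x u = value μ A N x

/-- The Q-learning iteration
`Q_{t+1} = Q_t + α_t (N_{t+1} + 𝒜_{t+1}ᵀ π(Q_t) 𝒜_{t+1} - Q_t)`. -/
noncomputable def qLearning (A : ℕ → Ω → Matrix (Fin n) (Fin n ⊕ Fin m) ℝ)
    (N : ℕ → Ω → Matrix (Fin n ⊕ Fin m) (Fin n ⊕ Fin m) ℝ) (α : ℕ → Ω → ℝ)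
    (Q₀ : Matrix (Fin n ⊕ Fin m) (Fin n ⊕ Fin m) ℝ) :
    ℕ → Ω → Matrix (Fin n ⊕ Fin m) (Fin n ⊕ Fin m) ℝ
  | 0, _ => Q₀
  | t + 1, ω => qLearning A N α Q₀ t ω + α t ω •
      (N (t + 1) ω + (A (t + 1) ω)ᵀ * piMap (qLearning A N α Q₀ t ω) * A (t + 1) ω
        - qLearning A N α Q₀ t ω)

end Riccati

end RandomLQ

/-! Everything is read off the Bellman operator `F P = E[N + 𝒜ᵀ π(P) 𝒜]` (`bellman`). Completing the
square shows that `π(P)` is the minimum of the form `P` over the control component. Hence `π` is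
monotone and positively homogeneous on positive semidefinite matrices, and `F = C + Φ` with `C =
E[N]` positive definite and `Φ` monotone and homogeneous. Solutions `K` of the Riccati equation
correspond to fixed points `Q` of `F` through `K = π(Q)` and `Q = E[N + 𝒜ᵀ K 𝒜]`.

Control. Finite-horizon dynamic programming puts `π(F^k 0)` below the value function, so
well-posedness bounds the increasing sequence `F^k 0`, whose limit is a fixed point
(`exists_fixedPoint_of_wellPosed`). Conversely, a solution `K` bounds every cost from below: since
`C` is positive definite, the terminal cost is at most a multiple of the stage cost, which tends to
zero when the total is finite. The feedback `Γ(Q)` attains the bound (`value_eq`). Thus `K` is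
determined by `V`.

Learning. On a path with bounded iterates the weighted noise series converges, and the iteration
becomes a deterministic averaging recursion with vanishing perturbation. Monotonicity lets it be
compared with scalar recursions. Such a path eventually lies above `c • F^k 0` for every `k` and
every `c < 1`, so one bounded path already bounds value iteration and yields a fixed point. If a
fixed point `Q'` exists, then `F ((1 + s) • Q') = (1 + s) • Q' - s • C`. As `C` dominates a positive
multiple of `Q'`, the interval around `Q'` that traps the path shrinks geometrically
(`IsApproximationPath.tendsto`).

Boundedness. Freezing the feedback `Γ(Q)` dominates `F` by an affine map with the same fixed point.
Its linear part has a truncated sum of traced powers as Lyapunov functional, and the squared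
positive part of that functional, suitably discounted, is a nonnegative supermartingale
(`ae_bounded_of_fixedPoint`). -/

namespace RandomLQ

/-! ### Quadratic forms, traces and the positive semidefinite order. -/

section QuadraticForm

variable {ι κ : Type*} [Fintype ι] [Fintype κ]

/-- The quadratic form `x ↦ xᵀ M x`. -/
def qf (M : Matrix ι ι ℝ) (x : ι → ℝ) : ℝ := x ⬝ᵥ (M *ᵥ x)

theorem qf_add (M M' : Matrix ι ι ℝ) (x : ι → ℝ) : qf (M + M') x = qf M x + qf M' x := by
  simp [qf, Matrix.add_mulVec, dotProduct_add]

theorem qf_sub (M M' : Matrix ι ι ℝ) (x : ι → ℝ) : qf (M - M') x = qf M x - qf M' x := by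
  simp [qf, Matrix.sub_mulVec, dotProduct_sub]

theorem qf_smul (c : ℝ) (M : Matrix ι ι ℝ) (x : ι → ℝ) : qf (c • M) x = c * qf M x := by
  simp [qf, Matrix.smul_mulVec]

@[simp] theorem qf_zero (x : ι → ℝ) : qf (0 : Matrix ι ι ℝ) x = 0 := by
  simp [qf]

theorem qf_eq_sum (M : Matrix ι ι ℝ) (x : ι → ℝ) :
    qf M x = ∑ i, ∑ j, x i * M i j * x j := by
  simp [qf, dotProduct, Matrix.mulVec, Finset.mul_sum, mul_assoc]

theorem qf_one [DecidableEq ι] (x : ι → ℝ) : qf (1 : Matrix ι ι ℝ) x = x ⬝ᵥ x := by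
  simp [qf]

theorem qf_conj (B : Matrix ι κ ℝ) (M : Matrix ι ι ℝ) (z : κ → ℝ) :
    qf (Bᵀ * M * B) z = qf M (B *ᵥ z) := by
  unfold qf
  rw [← Matrix.mulVec_mulVec, ← Matrix.mulVec_mulVec, Matrix.dotProduct_mulVec,
    Matrix.vecMul_transpose]

theorem dotProduct_self_nonneg' (x : ι → ℝ) : 0 ≤ x ⬝ᵥ x :=
  Finset.sum_nonneg fun i _ => mul_self_nonneg (x i)

theorem qf_nonneg {M : Matrix ι ι ℝ} (hM : M.PosSemidef) (x : ι → ℝ) : 0 ≤ qf M x := by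
  simpa [qf] using hM.dotProduct_mulVec_nonneg x

theorem posSemidef_of_qf {M : Matrix ι ι ℝ} (hM : Mᵀ = M) (h : ∀ x, 0 ≤ qf M x) :
    M.PosSemidef :=
  Matrix.PosSemidef.of_dotProduct_mulVec_nonneg (by simpa [Matrix.IsHermitian] using hM)
    (by simpa [qf] using h)

theorem transpose_eq {ι : Type*} {M : Matrix ι ι ℝ} (hM : M.PosSemidef) : Mᵀ = M := by
  simpa [Matrix.IsHermitian] using hM.isHermitian

theorem qf_single_add [DecidableEq ι] (M : Matrix ι ι ℝ) (a b : ℝ) (i j : ι) :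
    qf M (Pi.single i a + Pi.single j b) =
      a * a * M i i + a * b * M i j + b * a * M j i + b * b * M j j := by
  simp only [qf, Matrix.mulVec_add, add_dotProduct, dotProduct_add, single_dotProduct,
    Matrix.mulVec_single, Pi.smul_apply, Matrix.col_apply, op_smul_eq_smul, smul_eq_mul]
  ring

theorem qf_single [DecidableEq ι] (M : Matrix ι ι ℝ) (i : ι) :
    qf M (Pi.single i 1) = M i i := by
  simp [qf]

/-- Polarisation: it reduces equality and convergence of symmetric matrices to their quadratic forms
at fixed vectors. -/
theorem apply_eq_qf [DecidableEq ι] {M : Matrix ι ι ℝ} (hM : Mᵀ = M) (i j : ι) :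
    M i j = (qf M (Pi.single i 1 + Pi.single j 1) - qf M (Pi.single i 1)
      - qf M (Pi.single j 1)) / 2 := by
  have h : M j i = M i j := by conv_lhs => rw [← hM, Matrix.transpose_apply]
  rw [qf_single_add, qf_single, qf_single, h]
  ring

theorem ext_of_qf {M M' : Matrix ι ι ℝ} (hM : Mᵀ = M) (hM' : M'ᵀ = M')
    (h : ∀ x, qf M x = qf M' x) : M = M' := by
  classical
  ext i j
  rw [apply_eq_qf hM, apply_eq_qf hM', h, h, h]

theorem abs_apply_le_trace {K : Matrix ι ι ℝ} (hK : K.PosSemidef) (i j : ι) :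
    |K i j| ≤ K.trace := by
  classical
  have hd : ∀ i, K i i ≤ K.trace := fun i =>
    Finset.single_le_sum (f := fun i => K i i) (fun j _ => hK.diag_nonneg) (Finset.mem_univ i)
  have h1 := qf_nonneg hK (Pi.single i 1 + Pi.single j 1)
  have h2 := qf_nonneg hK (Pi.single i 1 + Pi.single j (-1))
  have h : K j i = K i j := by conv_lhs => rw [← transpose_eq hK, Matrix.transpose_apply]
  rw [qf_single_add, h] at h1 h2
  rw [abs_le]
  constructor <;> nlinarith [hd i, hd j]

theorem mulVec_dotProduct_self_le (B : Matrix ι κ ℝ) (x : κ → ℝ) :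
    (B *ᵥ x) ⬝ᵥ (B *ᵥ x) ≤ (Bᵀ * B).trace * (x ⬝ᵥ x) := by
  have h1 : (Bᵀ * B).trace = ∑ i, ∑ j, B i j ^ 2 := by
    rw [Finset.sum_comm]
    simp [Matrix.trace, Matrix.mul_apply, pow_two]
  rw [h1, Finset.sum_mul]
  refine Finset.sum_le_sum fun i _ => ?_
  have := Finset.sum_mul_sq_le_sq_mul_sq Finset.univ (fun j => B i j) x
  simpa [Matrix.mulVec, dotProduct, pow_two] using this

open scoped MatrixOrder in
theorem exists_eq_transpose_mul_self {K : Matrix ι ι ℝ} (hK : K.PosSemidef) :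
    ∃ B : Matrix ι ι ℝ, K = Bᵀ * B := by
  classical
  have h := CFC.sqrt_mul_sqrt_self K hK.nonneg
  refine ⟨CFC.sqrt K, ?_⟩
  rw [transpose_eq (Matrix.nonneg_iff_posSemidef.1 (CFC.sqrt_nonneg K)), h]

theorem qf_le_trace {K : Matrix ι ι ℝ} (hK : K.PosSemidef) (x : ι → ℝ) :
    qf K x ≤ K.trace * (x ⬝ᵥ x) := by
  classical
  obtain ⟨B, hB⟩ := exists_eq_transpose_mul_self hK
  have := qf_conj B 1 x
  rw [Matrix.mul_one, ← hB, qf_one] at this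
  rw [this, hB]
  exact mulVec_dotProduct_self_le B x

theorem trace_mono {M M' : Matrix ι ι ℝ} (h : ∀ x, qf M x ≤ qf M' x) : M.trace ≤ M'.trace := by
  classical
  refine Finset.sum_le_sum fun i _ => ?_
  have := h (Pi.single i 1)
  rwa [qf_single, qf_single] at this

theorem trace_conj_le [DecidableEq κ] {K : Matrix ι ι ℝ} (hK : K.PosSemidef) (B : Matrix ι κ ℝ) :
    (Bᵀ * K * B).trace ≤ K.trace * (Bᵀ * B).trace := by
  classical
  have h : ∀ x, qf (Bᵀ * K * B) x ≤ qf (K.trace • (Bᵀ * (1 : Matrix ι ι ℝ) * B)) x := by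
    intro x
    rw [qf_conj, qf_smul, qf_conj, qf_one]
    exact qf_le_trace hK _
  have := trace_mono h
  rwa [Matrix.trace_smul, Matrix.mul_one, smul_eq_mul] at this

/-- Write `P = Bᵀ B` with `B` invertible. Then `x = B⁻¹ (B x)`, and the squared Frobenius norm of
`B⁻¹` bounds `|x|²` by a multiple of `|B x|²`, which is the form at `x`. -/
theorem exists_mul_dotProduct_le_qf {P : Matrix ι ι ℝ} (hP : P.PosDef) :
    ∃ c > 0, ∀ x, c * (x ⬝ᵥ x) ≤ qf P x := by
  classical
  obtain ⟨B, hB⟩ := exists_eq_transpose_mul_self hP.posSemidef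
  have hu : IsUnit B.det := by
    have : IsUnit P.det := (Matrix.isUnit_iff_isUnit_det _).1 hP.isUnit
    rw [hB, Matrix.det_mul] at this
    exact isUnit_of_mul_isUnit_right this
  have hC := mulVec_dotProduct_self_le B⁻¹
  set τ := ((B⁻¹)ᵀ * B⁻¹).trace
  have hτ : 0 ≤ τ := by
    simp only [τ, Matrix.trace, Matrix.diag, Matrix.mul_apply, Matrix.transpose_apply]
    exact Finset.sum_nonneg fun i _ => Finset.sum_nonneg fun j _ => mul_self_nonneg _
  -- The added `1` keeps the constant positive when the index type is empty and `τ = 0`.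
  refine ⟨(1 + τ)⁻¹, by positivity, fun x => ?_⟩
  have h1 := qf_conj B 1 x
  rw [Matrix.mul_one, ← hB, qf_one] at h1
  have h2 := hC (B *ᵥ x)
  rw [Matrix.mulVec_mulVec, Matrix.nonsing_inv_mul _ hu, Matrix.one_mulVec, ← h1] at h2
  have h3 := qf_nonneg hP.posSemidef x
  rw [inv_mul_le_iff₀ (by positivity)]
  linarith

theorem posDef_of_le_qf {P P' : Matrix ι ι ℝ} (hP : P.PosDef) (hP' : P'ᵀ = P')
    (h : ∀ x, qf P x ≤ qf P' x) : P'.PosDef := by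
  refine Matrix.PosDef.of_dotProduct_mulVec_pos (by simpa [Matrix.IsHermitian] using hP') ?_
  intro x hx
  have := hP.dotProduct_mulVec_pos hx
  simp only [star_trivial] at *
  exact this.trans_le (h x)

theorem posSemidef_of_tendsto {M : ℕ → Matrix ι ι ℝ} {M' : Matrix ι ι ℝ}
    (hM : ∀ t, (M t).PosSemidef) (h : Tendsto M atTop (𝓝 M')) : M'.PosSemidef := by
  have hc : ∀ x, Continuous fun M : Matrix ι ι ℝ => qf M x := by
    intro x
    simp only [qf_eq_sum]
    fun_prop
  refine posSemidef_of_qf ?_ fun x => ?_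
  · ext i j
    rw [Matrix.transpose_apply]
    have h1 := tendsto_pi_nhds.1 (tendsto_pi_nhds.1 h i) j
    have h2 := tendsto_pi_nhds.1 (tendsto_pi_nhds.1 h j) i
    refine tendsto_nhds_unique (h2.congr fun t => ?_) h1
    conv_lhs => rw [← transpose_eq (hM t), Matrix.transpose_apply]
  · exact ge_of_tendsto (((hc x).tendsto _).comp h) (Eventually.of_forall fun t => qf_nonneg (hM t) x)

end QuadraticForm

/-! ### The generalised Schur complement as a partial minimum. -/

section SchurComplement

variable {n m : ℕ}

theorem pinv_transpose_of_symm {κ : Type*} [Fintype κ] [DecidableEq κ] {D : Matrix κ κ ℝ}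
    (hD : Dᵀ = D) : (pinv D)ᵀ = pinv D := by
  have h := isMoorePenrose_pinv D
  refine IsMoorePenrose.unique (A := D) ⟨?_, ?_, ?_, ?_⟩ h
  · have := congrArg Matrix.transpose h.mul_mul_self
    simpa [Matrix.transpose_mul, hD, Matrix.mul_assoc] using this
  · have := congrArg Matrix.transpose h.mul_mul_inv
    simpa [Matrix.transpose_mul, hD, Matrix.mul_assoc] using this
  · have := h.symm_right
    rw [Matrix.transpose_mul, hD] at this
    rw [this, ← this, Matrix.transpose_mul, Matrix.transpose_transpose, hD, this]
  · have := h.symm_left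
    rw [Matrix.transpose_mul, hD] at this
    rw [this, ← this, Matrix.transpose_mul, Matrix.transpose_transpose, hD, this]

theorem qf_sumElim (P : Matrix (Fin n ⊕ Fin m) (Fin n ⊕ Fin m) ℝ) (x : Fin n → ℝ)
    (u : Fin m → ℝ) :
    qf P (Sum.elim x u) = qf P.toBlocks₁₁ x + x ⬝ᵥ (P.toBlocks₁₂ *ᵥ u)
      + u ⬝ᵥ (P.toBlocks₂₁ *ᵥ x) + qf P.toBlocks₂₂ u := by
  conv_lhs => rw [← Matrix.fromBlocks_toBlocks P]
  simp only [qf, Matrix.fromBlocks_mulVec, Sum.elim_comp_inl, Sum.elim_comp_inr,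
    sumElim_dotProduct_sumElim, dotProduct_add]
  ring

theorem toBlocks₁₂_transpose {P : Matrix (Fin n ⊕ Fin m) (Fin n ⊕ Fin m) ℝ} (hP : Pᵀ = P) :
    P.toBlocks₁₂ᵀ = P.toBlocks₂₁ := by
  ext i j
  exact congrFun (congrFun hP _) _

theorem toBlocks₂₂_transpose {P : Matrix (Fin n ⊕ Fin m) (Fin n ⊕ Fin m) ℝ} (hP : Pᵀ = P) :
    P.toBlocks₂₂ᵀ = P.toBlocks₂₂ := by
  ext i j
  exact congrFun (congrFun hP _) _

theorem toBlocks₁₁_transpose {P : Matrix (Fin n ⊕ Fin m) (Fin n ⊕ Fin m) ℝ} (hP : Pᵀ = P) :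
    P.toBlocks₁₁ᵀ = P.toBlocks₁₁ := by
  ext i j
  exact congrFun (congrFun hP _) _

/-- The kernel of the lower right block of a positive semidefinite matrix is annihilated by the
upper right block. -/
theorem toBlocks₁₂_mul_pinv_mul {P : Matrix (Fin n ⊕ Fin m) (Fin n ⊕ Fin m) ℝ}
    (hP : P.PosSemidef) :
    P.toBlocks₁₂ * pinv P.toBlocks₂₂ * P.toBlocks₂₂ = P.toBlocks₁₂ := by
  set b := P.toBlocks₁₂
  set D := P.toBlocks₂₂
  have hker : ∀ v : Fin m → ℝ, D *ᵥ v = 0 → b *ᵥ v = 0 := by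
    intro v hv
    -- Along `s ↦ [x; s v]` the form is affine in `s`, since `D v = 0`. Being nonnegative on the
    -- whole line, it must have slope zero.
    have key : ∀ (x : Fin n → ℝ) (s : ℝ), 0 ≤ qf P.toBlocks₁₁ x + 2 * s * (x ⬝ᵥ (b *ᵥ v)) := by
      intro x s
      have h := qf_nonneg hP (Sum.elim x (s • v))
      rw [qf_sumElim, ← toBlocks₁₂_transpose (transpose_eq hP)] at h
      have h1 : qf P.toBlocks₂₂ (s • v) = 0 := by
        simp only [qf, Matrix.mulVec_smul]
        rw [show P.toBlocks₂₂ *ᵥ v = 0 from hv]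
        simp
      have h2 : (s • v) ⬝ᵥ (P.toBlocks₁₂ᵀ *ᵥ x) = s * (x ⬝ᵥ (b *ᵥ v)) := by
        rw [smul_dotProduct, Matrix.mulVec_transpose, dotProduct_comm, ← Matrix.dotProduct_mulVec,
          smul_eq_mul]
      rw [h1, h2, Matrix.mulVec_smul, dotProduct_smul, smul_eq_mul] at h
      linarith
    have h0 : (b *ᵥ v) ⬝ᵥ (b *ᵥ v) = 0 := by
      by_contra hne
      -- This value of `s` would make the affine function equal to `-1`.
      have h := key (b *ᵥ v) (-(qf P.toBlocks₁₁ (b *ᵥ v) + 1) / (2 * ((b *ᵥ v) ⬝ᵥ (b *ᵥ v))))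
      have h3 : 2 * (-(qf P.toBlocks₁₁ (b *ᵥ v) + 1) / (2 * ((b *ᵥ v) ⬝ᵥ (b *ᵥ v)))) *
          ((b *ᵥ v) ⬝ᵥ (b *ᵥ v)) = -(qf P.toBlocks₁₁ (b *ᵥ v) + 1) := by
        field_simp
      linarith
    exact dotProduct_self_eq_zero.1 h0
  refine Matrix.mulVec_injective (funext fun w => ?_)
  have hD : D *ᵥ ((pinv D * D) *ᵥ w - w) = 0 := by
    rw [Matrix.mulVec_sub, Matrix.mulVec_mulVec, ← Matrix.mul_assoc,
      (isMoorePenrose_pinv D).mul_mul_self, sub_self]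
  have := hker _ hD
  rw [Matrix.mulVec_sub, Matrix.mulVec_mulVec, ← Matrix.mul_assoc] at this
  exact sub_eq_zero.1 this

theorem piMap_transpose {P : Matrix (Fin n ⊕ Fin m) (Fin n ⊕ Fin m) ℝ} (hP : Pᵀ = P) :
    (piMap P)ᵀ = piMap P := by
  unfold piMap
  rw [← toBlocks₁₂_transpose hP]
  simp only [Matrix.transpose_sub, Matrix.transpose_mul, toBlocks₁₁_transpose hP,
    pinv_transpose_of_symm (toBlocks₂₂_transpose hP), Matrix.transpose_transpose, Matrix.mul_assoc]

/-- Completion of the square. -/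
theorem qf_sumElim_eq {P : Matrix (Fin n ⊕ Fin m) (Fin n ⊕ Fin m) ℝ} (hP : P.PosSemidef)
    (x : Fin n → ℝ) (u : Fin m → ℝ) :
    qf P (Sum.elim x u) = qf (piMap P) x + qf P.toBlocks₂₂ (u - gammaMap P *ᵥ x) := by
  have hs := transpose_eq hP
  have hb := toBlocks₁₂_mul_pinv_mul hP
  have hbT := toBlocks₁₂_transpose hs
  have hDT := toBlocks₂₂_transpose hs
  have hpT := pinv_transpose_of_symm hDT
  rw [qf_sumElim]
  set b := P.toBlocks₁₂
  set D := P.toBlocks₂₂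
  rw [← hbT]
  have hb' : D * (pinv D * bᵀ) = bᵀ := by
    have := congrArg Matrix.transpose hb
    rwa [Matrix.transpose_mul, Matrix.transpose_mul, hpT, hDT] at this
  have e1 : D *ᵥ (gammaMap P *ᵥ x) = -(bᵀ *ᵥ x) := by
    rw [Matrix.mulVec_mulVec]
    change (D * -(pinv D * P.toBlocks₂₁)) *ᵥ x = _
    rw [← hbT, Matrix.mul_neg, hb', Matrix.neg_mulVec]
  have e2 : ∀ v : Fin m → ℝ, v ⬝ᵥ (bᵀ *ᵥ x) = x ⬝ᵥ (b *ᵥ v) := by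
    intro v
    rw [Matrix.mulVec_transpose, dotProduct_comm, ← Matrix.dotProduct_mulVec]
  have e3 : (gammaMap P *ᵥ x) ⬝ᵥ (D *ᵥ u) = -(x ⬝ᵥ (b *ᵥ u)) := by
    rw [Matrix.dotProduct_mulVec, ← Matrix.mulVec_transpose, hDT, e1, neg_dotProduct,
      dotProduct_comm, e2]
  have e4 : qf (piMap P) x = qf P.toBlocks₁₁ x + (x ⬝ᵥ (b *ᵥ (gammaMap P *ᵥ x))) := by
    unfold qf piMap gammaMap
    rw [Matrix.sub_mulVec, dotProduct_sub, sub_eq_add_neg, Matrix.neg_mulVec, Matrix.mulVec_neg,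
      dotProduct_neg, Matrix.mulVec_mulVec, Matrix.mul_assoc]
  have e5 : qf D (u - gammaMap P *ᵥ x) = qf D u + 2 * (x ⬝ᵥ (b *ᵥ u))
      - (x ⬝ᵥ (b *ᵥ (gammaMap P *ᵥ x))) := by
    unfold qf
    rw [Matrix.mulVec_sub, e1, sub_neg_eq_add, dotProduct_add, sub_dotProduct, sub_dotProduct,
      e3, e2, e2]
    ring
  rw [e4, e5, e2]
  ring

theorem qf_toBlocks₂₂_nonneg {P : Matrix (Fin n ⊕ Fin m) (Fin n ⊕ Fin m) ℝ} (hP : P.PosSemidef)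
    (u : Fin m → ℝ) : 0 ≤ qf P.toBlocks₂₂ u := by
  have := qf_nonneg hP (Sum.elim 0 u)
  rw [qf_sumElim] at this
  simpa [qf] using this

/-- With `qf_piMap_eq` this says that `π(P)` is the minimum of the form over the control, attained
at `Γ(P) x`. The order properties of `piMap` below all come from this description. -/
theorem qf_piMap_le {P : Matrix (Fin n ⊕ Fin m) (Fin n ⊕ Fin m) ℝ} (hP : P.PosSemidef)
    (x : Fin n → ℝ) (u : Fin m → ℝ) : qf (piMap P) x ≤ qf P (Sum.elim x u) := by
  rw [qf_sumElim_eq hP]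
  linarith [qf_toBlocks₂₂_nonneg hP (u - gammaMap P *ᵥ x)]

theorem qf_piMap_eq {P : Matrix (Fin n ⊕ Fin m) (Fin n ⊕ Fin m) ℝ} (hP : P.PosSemidef)
    (x : Fin n → ℝ) : qf (piMap P) x = qf P (Sum.elim x (gammaMap P *ᵥ x)) := by
  rw [qf_sumElim_eq hP, sub_self]
  simp [qf]

theorem piMap_posSemidef {P : Matrix (Fin n ⊕ Fin m) (Fin n ⊕ Fin m) ℝ} (hP : P.PosSemidef) :
    (piMap P).PosSemidef :=
  posSemidef_of_qf (piMap_transpose (transpose_eq hP)) fun x => by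
    rw [qf_piMap_eq hP]; exact qf_nonneg hP _

theorem piMap_mono {P P' : Matrix (Fin n ⊕ Fin m) (Fin n ⊕ Fin m) ℝ} (hP : P.PosSemidef)
    (hP' : P'.PosSemidef) (h : ∀ z, qf P z ≤ qf P' z) (x : Fin n → ℝ) :
    qf (piMap P) x ≤ qf (piMap P') x := by
  rw [qf_piMap_eq hP']
  exact (qf_piMap_le hP x _).trans (h _)

/-- Each of the two minima is tested with the minimiser of the other, so the pseudoinverse of `c •
P` is never computed and `c = 0` needs no separate case. -/
theorem qf_piMap_smul {P : Matrix (Fin n ⊕ Fin m) (Fin n ⊕ Fin m) ℝ} (hP : P.PosSemidef)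
    {c : ℝ} (hc : 0 ≤ c) (x : Fin n → ℝ) : qf (piMap (c • P)) x = c * qf (piMap P) x := by
  have hcP : (c • P).PosSemidef := hP.smul hc
  apply le_antisymm
  · rw [qf_piMap_eq hP, ← qf_smul]
    exact qf_piMap_le hcP _ _
  · rw [qf_piMap_eq hcP, qf_smul]
    exact mul_le_mul_of_nonneg_left (qf_piMap_le hP _ _) hc

theorem piMap_zero : piMap (0 : Matrix (Fin n ⊕ Fin m) (Fin n ⊕ Fin m) ℝ) = 0 := by
  refine ext_of_qf (piMap_transpose Matrix.transpose_zero) Matrix.transpose_zero fun x => ?_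
  have := qf_piMap_smul (Matrix.PosSemidef.zero (n := Fin n ⊕ Fin m) (R := ℝ)) (le_refl 0) x
  simpa using this

theorem trace_piMap_le {P : Matrix (Fin n ⊕ Fin m) (Fin n ⊕ Fin m) ℝ} (hP : P.PosSemidef) :
    (piMap P).trace ≤ P.trace := by
  have h1 : (piMap P).trace ≤ P.toBlocks₁₁.trace := by
    refine trace_mono fun x => ?_
    have := qf_piMap_le hP x 0
    rw [qf_sumElim] at this
    simpa [qf] using this
  refine h1.trans ?_
  simp only [Matrix.trace, Fintype.sum_sum_type, Matrix.diag]
  have : 0 ≤ ∑ i : Fin m, P (Sum.inr i) (Sum.inr i) :=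
    Finset.sum_nonneg fun i _ => hP.diag_nonneg
  have h2 : ∑ i : Fin n, P.toBlocks₁₁ i i = ∑ i : Fin n, P (Sum.inl i) (Sum.inl i) := rfl
  linarith

end SchurComplement

/-! ### Measurability of matrix operations. -/

section Measurability

variable {S : Type*} {mS : MeasurableSpace S}

theorem measurable_matrix_iff {ι κ : Type*} {f : S → Matrix ι κ ℝ} :
    Measurable f ↔ ∀ i j, Measurable fun s => f s i j := by
  constructor
  · intro h i j
    exact measurable_pi_iff.1 (measurable_pi_iff.1 h i) j
  · intro h
    exact measurable_pi_lambda _ fun i => measurable_pi_lambda _ fun j => h i j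

theorem measurable_matrix_mul {ι κ τ : Type*} [Fintype κ] {f : S → Matrix ι κ ℝ}
    {g : S → Matrix κ τ ℝ} (hf : Measurable f) (hg : Measurable g) :
    Measurable fun s => f s * g s := by
  rw [measurable_matrix_iff] at *
  intro i j
  simp only [Matrix.mul_apply]
  exact Finset.measurable_sum _ fun k _ => (hf i k).mul (hg k j)

theorem measurable_matrix_transpose {ι κ : Type*} {f : S → Matrix ι κ ℝ} (hf : Measurable f) :
    Measurable fun s => (f s)ᵀ := by
  rw [measurable_matrix_iff] at *
  exact fun i j => hf j i

theorem measurable_matrix_add {ι κ : Type*} {f g : S → Matrix ι κ ℝ} (hf : Measurable f)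
    (hg : Measurable g) : Measurable fun s => f s + g s := by
  rw [measurable_matrix_iff] at *
  exact fun i j => (hf i j).add (hg i j)

theorem measurable_matrix_sub {ι κ : Type*} {f g : S → Matrix ι κ ℝ} (hf : Measurable f)
    (hg : Measurable g) : Measurable fun s => f s - g s := by
  rw [measurable_matrix_iff] at *
  exact fun i j => (hf i j).sub (hg i j)

theorem measurable_matrix_smul {ι κ : Type*} {f : S → ℝ} {g : S → Matrix ι κ ℝ}
    (hf : Measurable f) (hg : Measurable g) : Measurable fun s => f s • g s := by
  rw [measurable_matrix_iff] at *
  exact fun i j => hf.mul (hg i j)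

theorem measurable_mulVec {ι κ : Type*} [Fintype κ] {f : S → Matrix ι κ ℝ} {g : S → κ → ℝ}
    (hf : Measurable f) (hg : Measurable g) : Measurable fun s => f s *ᵥ g s := by
  rw [measurable_matrix_iff] at hf
  refine measurable_pi_lambda _ fun i => ?_
  exact Finset.measurable_sum _ fun k _ => (hf i k).mul (measurable_pi_iff.1 hg k)

theorem measurable_qf {ι : Type*} [Fintype ι] {f : S → Matrix ι ι ℝ} {g : S → ι → ℝ}
    (hf : Measurable f) (hg : Measurable g) : Measurable fun s => qf (f s) (g s) :=
  Finset.measurable_sum _ fun k _ =>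
    (measurable_pi_iff.1 hg k).mul (measurable_pi_iff.1 (measurable_mulVec hf hg) k)

theorem measurable_sumElim {ι κ : Type*} {f : S → ι → ℝ} {g : S → κ → ℝ}
    (hf : Measurable f) (hg : Measurable g) : Measurable fun s => Sum.elim (f s) (g s) :=
  measurable_pi_lambda _ fun i => by
    cases i with
    | inl i => exact measurable_pi_iff.1 hf i
    | inr i => exact measurable_pi_iff.1 hg i

theorem measurable_trace {ι : Type*} [Fintype ι] {f : S → Matrix ι ι ℝ} (hf : Measurable f) :
    Measurable fun s => (f s).trace := by
  rw [measurable_matrix_iff] at hf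
  exact Finset.measurable_sum _ fun k _ => hf k k

theorem measurable_det {ι : Type*} [Fintype ι] [DecidableEq ι] {f : S → Matrix ι ι ℝ}
    (hf : Measurable f) : Measurable fun s => (f s).det := by
  rw [measurable_matrix_iff] at hf
  simp only [Matrix.det_apply']
  exact Finset.measurable_sum _ fun σ _ =>
    measurable_const.mul (Finset.measurable_prod _ fun i _ => hf _ _)

theorem measurable_inv {ι : Type*} [Fintype ι] [DecidableEq ι] {f : S → Matrix ι ι ℝ}
    (hf : Measurable f) : Measurable fun s => (f s)⁻¹ := by
  simp only [Matrix.inv_def, Ring.inverse_eq_inv']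
  refine measurable_matrix_smul (measurable_det hf).inv ?_
  rw [measurable_matrix_iff] at *
  intro i j
  simp only [Matrix.adjugate_apply]
  refine measurable_det ?_
  rw [measurable_matrix_iff]
  intro k l
  by_cases h : k = j
  · subst h
    simp
  · simpa [Matrix.updateRow_ne h] using hf k l

end Measurability

/-! ### Measurability of the pseudoinverse by Tikhonov regularisation. -/

section PseudoInverse

variable {ι κ : Type*} [Fintype ι] [Fintype κ] [DecidableEq κ]

theorem posDef_transpose_mul_self_add (A : Matrix ι κ ℝ) {ε : ℝ} (hε : 0 < ε) :
    (Aᵀ * A + ε • (1 : Matrix κ κ ℝ)).PosDef := by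
  have h1 : (Aᵀ * A).PosSemidef := by
    simpa using Matrix.posSemidef_conjTranspose_mul_self A
  exact Matrix.PosDef.posSemidef_add h1 (Matrix.PosDef.one.smul hε)

/-- The regularised Gram matrix has an inverse of norm at most `ε⁻¹`. -/
theorem abs_smul_inv_mulVec_le (A : Matrix ι κ ℝ) {ε : ℝ} (hε : 0 < ε) (v : κ → ℝ) (i : κ) :
    |ε * ((Aᵀ * A + ε • (1 : Matrix κ κ ℝ))⁻¹ *ᵥ v) i| ≤ √(v ⬝ᵥ v) := by
  set G := Aᵀ * A + ε • (1 : Matrix κ κ ℝ) with hG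
  set w := G⁻¹ *ᵥ v with hw
  have hGw : G *ᵥ w = v := by
    rw [hw, Matrix.mulVec_mulVec, Matrix.mul_nonsing_inv _
      ((Matrix.isUnit_iff_isUnit_det _).1 (posDef_transpose_mul_self_add A hε).isUnit),
      Matrix.one_mulVec]
  have h1 : ε * (w ⬝ᵥ w) ≤ w ⬝ᵥ v := by
    have h2 : w ⬝ᵥ v = qf (Aᵀ * A) w + ε * (w ⬝ᵥ w) := by
      rw [← qf_one, ← qf_smul, ← qf_add, ← hG, qf, hGw]
    have h3 := qf_nonneg (M := Aᵀ * A)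
      (by simpa using Matrix.posSemidef_conjTranspose_mul_self A) w
    linarith
  have h4 : (w ⬝ᵥ v) ^ 2 ≤ (w ⬝ᵥ w) * (v ⬝ᵥ v) := by
    have := Finset.sum_mul_sq_le_sq_mul_sq Finset.univ w v
    simpa [dotProduct, pow_two] using this
  have hww := dotProduct_self_nonneg' w
  have h5 : ε ^ 2 * (w ⬝ᵥ w) ≤ v ⬝ᵥ v := by
    rcases hww.eq_or_lt with h | h
    · rw [← h, mul_zero]; exact dotProduct_self_nonneg' v
    · have h6 : (ε * (w ⬝ᵥ w)) ^ 2 ≤ (w ⬝ᵥ v) ^ 2 := by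
        apply pow_le_pow_left₀ _ h1
        positivity
      refine le_of_mul_le_mul_left ?_ h
      nlinarith
  refine Real.abs_le_sqrt (le_trans ?_ h5)
  rw [mul_pow]
  refine mul_le_mul_of_nonneg_left ?_ (by positivity)
  rw [pow_two]
  exact Finset.single_le_sum (f := fun i => w i * w i) (fun j _ => mul_self_nonneg _)
    (Finset.mem_univ i)

/-- Places the columns of `pinv A` in the range of `Aᵀ A`, which allows a second expansion step in
`regularised_mul_transpose_eq`. -/
theorem pinv_eq_gram_mul (A : Matrix ι κ ℝ) :
    pinv A = Aᵀ * A * (pinv A * (pinv A)ᵀ * pinv A) := by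
  have h := isMoorePenrose_pinv A
  set X := pinv A
  have h1 : Xᵀ = A * X * Xᵀ := by
    have := congrArg Matrix.transpose h.mul_mul_inv
    rw [Matrix.mul_assoc, Matrix.transpose_mul, h.symm_left] at this
    exact this.symm
  have h2 : X = Aᵀ * Xᵀ * X := by
    conv_lhs => rw [← h.mul_mul_inv, ← h.symm_right, Matrix.transpose_mul]
  conv_lhs => rw [h2, h1]
  simp only [Matrix.mul_assoc]

/-- With `G` the regularised Gram matrix, `Aᵀ = G X - ε X` and `X = G Y - ε Y` are substituted in
turn. One substitution would leave `ε G⁻¹ X`, which the bound `‖ε G⁻¹‖ ≤ 1` only shows to be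
bounded. The second gains another factor `ε`. -/
theorem regularised_mul_transpose_eq (A : Matrix ι κ ℝ) {ε : ℝ} (hε : 0 < ε) :
    (Aᵀ * A + ε • (1 : Matrix κ κ ℝ))⁻¹ * Aᵀ = pinv A - ε • (pinv A * (pinv A)ᵀ * pinv A)
      + ε • (ε • ((Aᵀ * A + ε • (1 : Matrix κ κ ℝ))⁻¹ * (pinv A * (pinv A)ᵀ * pinv A))) := by
  have h := isMoorePenrose_pinv A
  have hX := pinv_eq_gram_mul A
  have hu : IsUnit (Aᵀ * A + ε • (1 : Matrix κ κ ℝ)).det :=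
    (Matrix.isUnit_iff_isUnit_det _).1 (posDef_transpose_mul_self_add A hε).isUnit
  set X := pinv A
  set Y := X * Xᵀ * X
  set G := Aᵀ * A + ε • (1 : Matrix κ κ ℝ) with hG
  have hA : Aᵀ = Aᵀ * A * X := by
    conv_lhs => rw [← h.mul_mul_self, Matrix.transpose_mul, h.symm_left, ← Matrix.mul_assoc]
  have hGX : Aᵀ = G * X - ε • X := by
    rw [hG, Matrix.add_mul, ← hA, Matrix.smul_mul, Matrix.one_mul, add_sub_cancel_right]
  have hGY : X = G * Y - ε • Y := by
    rw [hG, Matrix.add_mul, ← hX, Matrix.smul_mul, Matrix.one_mul, add_sub_cancel_right]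
  calc G⁻¹ * Aᵀ = G⁻¹ * (G * X - ε • X) := by rw [← hGX]
    _ = X - ε • (G⁻¹ * X) := by
      rw [Matrix.mul_sub, Matrix.nonsing_inv_mul_cancel_left _ _ hu, Matrix.mul_smul]
    _ = X - ε • (G⁻¹ * (G * Y - ε • Y)) := by rw [← hGY]
    _ = X - ε • (Y - ε • (G⁻¹ * Y)) := by
      rw [Matrix.mul_sub, Matrix.nonsing_inv_mul_cancel_left _ _ hu, Matrix.mul_smul]
    _ = _ := by rw [smul_sub]; abel

theorem tendsto_regularised_pinv (A : Matrix ι κ ℝ) (i : κ) (j : ι) :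
    Tendsto (fun k : ℕ => ((Aᵀ * A + (1 / ((k : ℝ) + 1)) • (1 : Matrix κ κ ℝ))⁻¹ * Aᵀ) i j) atTop
      (𝓝 (pinv A i j)) := by
  have hpos : ∀ k : ℕ, 0 < 1 / ((k : ℝ) + 1) := fun k => by positivity
  have h0 : Tendsto (fun k : ℕ => 1 / ((k : ℝ) + 1)) atTop (𝓝 0) :=
    tendsto_one_div_add_atTop_nhds_zero_nat
  set Y := pinv A * (pinv A)ᵀ * pinv A
  have h1 : ∀ k : ℕ, |((Aᵀ * A + (1 / ((k : ℝ) + 1)) • (1 : Matrix κ κ ℝ))⁻¹ * Aᵀ) i j - pinv A i j|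
      ≤ 1 / ((k : ℝ) + 1) * (|Y i j| + √(Y.col j ⬝ᵥ Y.col j)) := by
    intro k
    have hb := abs_smul_inv_mulVec_le A (hpos k) (Y.col j) i
    rw [regularised_mul_transpose_eq A (hpos k)]
    set ε := 1 / ((k : ℝ) + 1)
    set w := ε * ((Aᵀ * A + ε • (1 : Matrix κ κ ℝ))⁻¹ *ᵥ Y.col j) i
    have : (pinv A - ε • Y + ε • (ε • ((Aᵀ * A + ε • (1 : Matrix κ κ ℝ))⁻¹ * Y))) i j - pinv A i j
        = ε * (-(Y i j) + w) := by
      simp only [Matrix.add_apply, Matrix.sub_apply, Matrix.smul_apply, smul_eq_mul, w,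
        Matrix.mul_apply, Matrix.mulVec, dotProduct, Matrix.col_apply]
      ring
    rw [this, abs_mul, abs_of_pos (hpos k)]
    refine mul_le_mul_of_nonneg_left ((abs_add_le _ _).trans ?_) (hpos k).le
    rw [abs_neg]
    linarith
  rw [tendsto_iff_dist_tendsto_zero]
  refine squeeze_zero (fun _ => dist_nonneg) h1 ?_
  simpa using h0.mul_const (|Y i j| + √(Y.col j ⬝ᵥ Y.col j))

/-- The pseudoinverse is discontinuous where the rank drops, but it is a pointwise limit of
regularised inverses, whose entries are measurable. -/
theorem measurable_pinv {S : Type*} {mS : MeasurableSpace S} {f : S → Matrix ι κ ℝ}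
    (hf : Measurable f) : Measurable fun s => pinv (f s) := by
  rw [measurable_matrix_iff]
  intro i j
  refine measurable_of_tendsto_metrizable
    (f := fun (k : ℕ) s => (((f s)ᵀ * f s + (1 / ((k : ℝ) + 1)) • (1 : Matrix κ κ ℝ))⁻¹
      * (f s)ᵀ) i j) (fun k => ?_)
    (tendsto_pi_nhds.2 fun s => tendsto_regularised_pinv (f s) i j)
  have hT := measurable_matrix_transpose hf
  exact measurable_matrix_iff.1 (measurable_matrix_mul (measurable_inv
    (measurable_matrix_add (measurable_matrix_mul hT hf) measurable_const)) hT) i j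

end PseudoInverse

theorem measurable_piMap {n m : ℕ} {S : Type*} {mS : MeasurableSpace S}
    {f : S → Matrix (Fin n ⊕ Fin m) (Fin n ⊕ Fin m) ℝ} (hf : Measurable f) :
    Measurable fun s => piMap (f s) := by
  have h := measurable_matrix_iff.1 hf
  unfold piMap
  refine measurable_matrix_sub (measurable_matrix_iff.2 fun i j => h _ _)
    (measurable_matrix_mul (measurable_matrix_mul (measurable_matrix_iff.2 fun i j => h _ _)
      (measurable_pinv (measurable_matrix_iff.2 fun i j => h _ _)))
      (measurable_matrix_iff.2 fun i j => h _ _))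

/-! ### The scalar averaging recursion. -/

section ScalarRecursion

/-- Each step multiplies the excess over `e` by at most `1 - α t ≤ exp (-α t)`, and `∑ α = ∞` drives
the product to zero. The absolute value in the majorant keeps it nonnegative, so that the factor may
be enlarged. -/
theorem eventually_le_of_averaging {α c : ℕ → ℝ} {e δ : ℝ} {T : ℕ} (hδ : 0 < δ)
    (hα : ∀ t, α t ∈ Set.Icc (0 : ℝ) 1)
    (hsum : Tendsto (fun T => ∑ t ∈ Finset.range T, α t) atTop atTop)
    (hc : ∀ t ≥ T, c (t + 1) ≤ (1 - α t) * c t + α t * e) :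
    ∀ᶠ t in atTop, c t ≤ e + δ := by
  set S : ℕ → ℝ := fun T => ∑ t ∈ Finset.range T, α t
  have hmax : ∀ t ≥ T, c t - e ≤ |c T - e| * Real.exp (S T - S t) := by
    intro t ht
    induction t, ht using Nat.le_induction with
    | base => simp [le_abs_self]
    | succ t ht ih =>
      have h1 : c (t + 1) - e ≤ (1 - α t) * (c t - e) := by linarith [hc t ht]
      have h2 : (1 - α t) * (c t - e) ≤ (1 - α t) * (|c T - e| * Real.exp (S T - S t)) :=
        mul_le_mul_of_nonneg_left ih (by linarith [(hα t).2])
      have h3 : 1 - α t ≤ Real.exp (-α t) := by linarith [Real.add_one_le_exp (-α t)]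
      have h4 : Real.exp (S T - S (t + 1)) = Real.exp (-α t) * Real.exp (S T - S t) := by
        rw [← Real.exp_add]
        congr 1
        simp only [S, Finset.sum_range_succ]
        ring
      have h5 : (1 - α t) * (|c T - e| * Real.exp (S T - S t)) ≤
          Real.exp (-α t) * (|c T - e| * Real.exp (S T - S t)) :=
        mul_le_mul_of_nonneg_right h3 (by positivity)
      rw [h4]
      linarith
  have hlim : Tendsto (fun t => |c T - e| * Real.exp (S T - S t)) atTop (𝓝 0) := by
    have : Tendsto (fun t => S T - S t) atTop atBot := by
      simpa [sub_eq_add_neg] using tendsto_atBot_add_const_left _ (S T) (tendsto_neg_atTop_atBot.comp hsum)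
    simpa using (Real.tendsto_exp_atBot.comp this).const_mul |c T - e|
  filter_upwards [hlim.eventually (gt_mem_nhds hδ), eventually_ge_atTop T] with t h1 h2
  linarith [hmax t h2]

end ScalarRecursion

/-! ### Comparison of matrix averaging recursions in the positive semidefinite order. -/

section Comparison

variable {ι : Type*} [Fintype ι]

theorem abs_qf_le_sum (M : Matrix ι ι ℝ) (x : ι → ℝ) :
    |qf M x| ≤ (∑ i, ∑ j, |M i j|) * (x ⬝ᵥ x) := by
  have hx : ∀ i, x i * x i ≤ x ⬝ᵥ x := fun i =>
    Finset.single_le_sum (f := fun i => x i * x i) (fun j _ => mul_self_nonneg _)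
      (Finset.mem_univ i)
  rw [qf_eq_sum, Finset.sum_mul]
  refine (Finset.abs_sum_le_sum_abs _ _).trans (Finset.sum_le_sum fun i _ => ?_)
  rw [Finset.sum_mul]
  refine (Finset.abs_sum_le_sum_abs _ _).trans (Finset.sum_le_sum fun j _ => ?_)
  have h1 : |x i * M i j * x j| = |M i j| * |x i * x j| := by
    rw [abs_mul, abs_mul, abs_mul]; ring
  rw [h1]
  refine mul_le_mul_of_nonneg_left ?_ (abs_nonneg _)
  rw [abs_le]
  constructor <;> nlinarith [hx i, hx j, sq_nonneg (x i + x j), sq_nonneg (x i - x j)]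

theorem exists_abs_qf_le {P : Matrix ι ι ℝ} (hP : P.PosDef) :
    ∃ κ > 0, ∀ (M : Matrix ι ι ℝ) (x : ι → ℝ),
      |qf M x| ≤ κ * (∑ i, ∑ j, |M i j|) * qf P x := by
  obtain ⟨c, hc, h⟩ := exists_mul_dotProduct_le_qf hP
  refine ⟨c⁻¹, by positivity, fun M x => (abs_qf_le_sum M x).trans ?_⟩
  have hs : 0 ≤ ∑ i, ∑ j, |M i j| :=
    Finset.sum_nonneg fun i _ => Finset.sum_nonneg fun j _ => abs_nonneg _
  have : x ⬝ᵥ x ≤ c⁻¹ * qf P x := by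
    rw [le_inv_mul_iff₀ hc]; exact h x
  calc (∑ i, ∑ j, |M i j|) * (x ⬝ᵥ x) ≤ (∑ i, ∑ j, |M i j|) * (c⁻¹ * qf P x) :=
        mul_le_mul_of_nonneg_left this hs
    _ = _ := by ring

theorem exists_qf_le_mul {P : Matrix ι ι ℝ} (hP : P.PosDef) (M : Matrix ι ι ℝ) :
    ∃ c, 0 ≤ c ∧ ∀ x, qf M x ≤ c * qf P x := by
  obtain ⟨κ, hκ, h⟩ := exists_abs_qf_le hP
  exact ⟨κ * ∑ i, ∑ j, |M i j|, by positivity, fun x => (le_abs_self _).trans (h M x)⟩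

theorem eventually_abs_qf_le {P : Matrix ι ι ℝ} (hP : P.PosDef) {E : ℕ → Matrix ι ι ℝ}
    (hE : Tendsto E atTop (𝓝 0)) {ε : ℝ} (hε : 0 < ε) :
    ∀ᶠ t in atTop, ∀ x, |qf (E t) x| ≤ ε * qf P x := by
  obtain ⟨κ, hκ, h⟩ := exists_abs_qf_le hP
  have hc : Continuous fun M : Matrix ι ι ℝ => κ * ∑ i, ∑ j, |M i j| := by fun_prop
  have hlim : Tendsto (fun t => κ * ∑ i, ∑ j, |E t i j|) atTop (𝓝 0) := by
    simpa [Function.comp_def] using (hc.tendsto 0).comp hE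
  filter_upwards [hlim.eventually (gt_mem_nhds hε)] with t ht x
  exact (h _ x).trans (mul_le_mul_of_nonneg_right ht.le (qf_nonneg hP.posSemidef x))

theorem tendsto_of_forall_abs_qf_le {P Q : Matrix ι ι ℝ} {M : ℕ → Matrix ι ι ℝ} (hQ : Qᵀ = Q)
    (hM : ∀ t, (M t)ᵀ = M t)
    (h : ∀ ε > 0, ∀ᶠ t in atTop, ∀ x, |qf (M t) x - qf Q x| ≤ ε * qf P x) :
    Tendsto M atTop (𝓝 Q) := by
  classical
  have hq : ∀ x, Tendsto (fun t => qf (M t) x) atTop (𝓝 (qf Q x)) := by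
    intro x
    rw [Metric.tendsto_nhds]
    intro ε hε
    have hp : 0 < |qf P x| + 1 := by positivity
    filter_upwards [h (ε / (|qf P x| + 1)) (by positivity)] with t ht
    refine (ht x).trans_lt ?_
    rw [div_mul_eq_mul_div, div_lt_iff₀ hp]
    exact mul_lt_mul_of_pos_left (by linarith [le_abs_self (qf P x)]) hε
  refine tendsto_pi_nhds.2 fun i => tendsto_pi_nhds.2 fun j => ?_
  rw [apply_eq_qf hQ]
  simp_rw [fun t => apply_eq_qf (hM t) i j]
  exact (((hq _).sub (hq _)).sub (hq _)).div_const 2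

/-- An averaging recursion with vanishing perturbation stays asymptotically below any upper bound
of its driving terms. -/
theorem eventually_qf_le_of_averaging {P U : Matrix ι ι ℝ} (hP : P.PosDef) {α : ℕ → ℝ}
    {R G E : ℕ → Matrix ι ι ℝ} (hα : ∀ t, α t ∈ Set.Icc (0 : ℝ) 1)
    (hsum : Tendsto (fun T => ∑ t ∈ Finset.range T, α t) atTop atTop)
    (hE : Tendsto E atTop (𝓝 0))
    (hR : ∀ t, R (t + 1) = (1 - α t) • R t + α t • (G t - E t))
    (hG : ∀ᶠ t in atTop, ∀ x, qf (G t) x ≤ qf U x) {ε : ℝ} (hε : 0 < ε) :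
    ∀ᶠ t in atTop, ∀ x, qf (R t + E t) x ≤ qf U x + ε * qf P x := by
  -- Three quarters of `ε` are spent: on the perturbation inside the recursion, on the transient of
  -- the scalar recursion, and on the return from `R` to `R + E`.
  have hE4 := eventually_abs_qf_le hP hE (show 0 < ε / 4 by positivity)
  obtain ⟨T, hT⟩ := eventually_atTop.1 (hG.and hE4)
  obtain ⟨c₀, -, hc₀⟩ := exists_qf_le_mul hP (R T - U)
  -- The scalar majorant is started at time `T`; truncated subtraction makes it constant before.
  let c : ℕ → ℝ := fun t => Nat.rec c₀ (fun k ck => (1 - α (T + k)) * ck + α (T + k) * (ε / 4)) (t - T)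
  have hcT : c T = c₀ := by simp [c]
  have hcs : ∀ t ≥ T, c (t + 1) = (1 - α t) * c t + α t * (ε / 4) := by
    intro t ht
    simp only [c]
    rw [Nat.succ_sub ht]
    simp only
    rw [Nat.add_sub_cancel' ht]
  have hD : ∀ t ≥ T, ∀ x, qf (R t) x - qf U x ≤ c t * qf P x := by
    intro t ht
    induction t, ht using Nat.le_induction with
    | base => intro x; rw [hcT, ← qf_sub]; exact hc₀ x
    | succ t ht ih =>
      intro x
      have h1 := (hT t ht).1 x
      have h2 := (abs_le.1 ((hT t ht).2 x)).1
      rw [hR, hcs t ht, qf_add, qf_smul, qf_smul, qf_sub]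
      have h3 := mul_le_mul_of_nonneg_left (ih x) (by linarith [(hα t).2] : 0 ≤ 1 - α t)
      have h4 := mul_le_mul_of_nonneg_left
        (by linarith : qf (G t) x - qf (E t) x - qf U x ≤ ε / 4 * qf P x) (hα t).1
      linarith
  have hc := eventually_le_of_averaging (T := T) (show 0 < ε / 4 by positivity) hα hsum
    (fun t ht => (hcs t ht).le)
  filter_upwards [hc, eventually_ge_atTop T] with t h1 h2 x
  have h3 := (abs_le.1 ((hT t h2).2 x)).2
  have h4 := hD t h2 x
  have hP0 := qf_nonneg hP.posSemidef x
  rw [qf_add]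
  nlinarith

theorem qf_neg (M : Matrix ι ι ℝ) (x : ι → ℝ) : qf (-M) x = -qf M x := by
  rw [← neg_one_smul ℝ M, qf_smul]; ring

theorem eventually_le_qf_of_averaging {P U : Matrix ι ι ℝ} (hP : P.PosDef) {α : ℕ → ℝ}
    {R G E : ℕ → Matrix ι ι ℝ} (hα : ∀ t, α t ∈ Set.Icc (0 : ℝ) 1)
    (hsum : Tendsto (fun T => ∑ t ∈ Finset.range T, α t) atTop atTop)
    (hE : Tendsto E atTop (𝓝 0))
    (hR : ∀ t, R (t + 1) = (1 - α t) • R t + α t • (G t - E t))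
    (hG : ∀ᶠ t in atTop, ∀ x, qf U x ≤ qf (G t) x) {ε : ℝ} (hε : 0 < ε) :
    ∀ᶠ t in atTop, ∀ x, qf U x - ε * qf P x ≤ qf (R t + E t) x := by
  have h := eventually_qf_le_of_averaging (R := fun t => -R t) (G := fun t => -G t)
    (E := fun t => -E t) (U := -U) hP hα hsum (by simpa using hE.neg)
    (fun t => by rw [hR]; module)
    (by filter_upwards [hG] with t ht x
        rw [qf_neg, qf_neg]; exact neg_le_neg (ht x)) hε
  filter_upwards [h] with t ht x
  have := ht x
  rw [← neg_add, qf_neg, qf_neg] at this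
  linarith

end Comparison

/-! ### Monotone, ray-affine operators: value iteration and stochastic approximation. -/

section MonotoneOperator

variable {ι : Type*} [Fintype ι]

/-- The order-theoretic properties of `P ↦ C + Φ(P)` with `Φ` monotone and positively homogeneous
on positive semidefinite matrices. -/
structure IsMonotoneRayAffine (F : Matrix ι ι ℝ → Matrix ι ι ℝ) (C : Matrix ι ι ℝ) : Prop where
  posDef : C.PosDef
  posSemidef : ∀ {P}, P.PosSemidef → (F P).PosSemidef
  mono : ∀ {P P'}, P.PosSemidef → P'.PosSemidef → (∀ x, qf P x ≤ qf P' x) →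
    ∀ x, qf (F P) x ≤ qf (F P') x
  le : ∀ {P}, P.PosSemidef → ∀ x, qf C x ≤ qf (F P) x
  ray : ∀ {P} {c : ℝ}, P.PosSemidef → 0 ≤ c → ∀ x,
    qf (F (c • P)) x = qf C x + c * (qf (F P) x - qf C x)

namespace IsMonotoneRayAffine

variable {F : Matrix ι ι ℝ → Matrix ι ι ℝ} {C : Matrix ι ι ℝ}

theorem apply_posDef (hF : IsMonotoneRayAffine F C) {P : Matrix ι ι ℝ} (hP : P.PosSemidef) :
    (F P).PosDef :=
  posDef_of_le_qf hF.posDef (transpose_eq (hF.posSemidef hP)) (hF.le hP)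

/-- On the ray, `F (c • P) = (1 - c) • C + c • F P` as forms, and the first term is nonnegative.
This subhomogeneity replaces continuity of `F` in the limit arguments. -/
theorem smul_le (hF : IsMonotoneRayAffine F C) {P : Matrix ι ι ℝ} (hP : P.PosSemidef) {c : ℝ}
    (hc : 0 ≤ c) (hc1 : c ≤ 1) (x : ι → ℝ) : c * qf (F P) x ≤ qf (F (c • P)) x := by
  rw [hF.ray hP hc]
  nlinarith [qf_nonneg hF.posDef.posSemidef x]

theorem iterate_posSemidef (hF : IsMonotoneRayAffine F C) (k : ℕ) :
    (F^[k] 0).PosSemidef := by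
  induction k with
  | zero => exact Matrix.PosSemidef.zero
  | succ k ih => rw [Function.iterate_succ_apply']; exact hF.posSemidef ih

theorem iterate_mono (hF : IsMonotoneRayAffine F C) (k : ℕ) (x : ι → ℝ) :
    qf (F^[k] 0) x ≤ qf (F^[k + 1] 0) x := by
  induction k generalizing x with
  | zero =>
    rw [Function.iterate_zero, id, qf_zero]
    exact qf_nonneg (hF.iterate_posSemidef 1) x
  | succ k ih =>
    rw [Function.iterate_succ_apply' _ k, Function.iterate_succ_apply' _ (k + 1)]
    exact hF.mono (hF.iterate_posSemidef k) (hF.iterate_posSemidef (k + 1)) ih x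

/-- If value iteration from zero is bounded, it converges to a fixed point. -/
theorem exists_fixedPoint (hF : IsMonotoneRayAffine F C) {c : ℝ}
    (hb : ∀ k, (F^[k] 0).trace ≤ c) : ∃ Q, Q.PosSemidef ∧ F Q = Q := by
  classical
  have hconv : ∀ x, ∃ l, Tendsto (fun k => qf (F^[k] 0) x) atTop (𝓝 l) := by
    intro x
    refine ⟨_, tendsto_atTop_ciSup (monotone_nat_of_le_succ fun k => hF.iterate_mono k x)
      ⟨c * (x ⬝ᵥ x), ?_⟩⟩
    rintro _ ⟨k, rfl⟩
    exact (qf_le_trace (hF.iterate_posSemidef k) x).trans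
      (mul_le_mul_of_nonneg_right (hb k) (dotProduct_self_nonneg' x))
  choose l hl using hconv
  set Q : Matrix ι ι ℝ := Matrix.of fun i j =>
    (l (Pi.single i 1 + Pi.single j 1) - l (Pi.single i 1) - l (Pi.single j 1)) / 2 with hQdef
  have hlim : Tendsto (fun k => F^[k] 0) atTop (𝓝 Q) := by
    refine tendsto_pi_nhds.2 fun i => tendsto_pi_nhds.2 fun j => ?_
    simp_rw [fun k => apply_eq_qf (transpose_eq (hF.iterate_posSemidef k)) i j]
    exact (((hl _).sub (hl _)).sub (hl _)).div_const 2
  have hQ : Q.PosSemidef := posSemidef_of_tendsto hF.iterate_posSemidef hlim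
  have hc : ∀ x, Continuous fun M : Matrix ι ι ℝ => qf M x := by
    intro x
    simp only [qf_eq_sum]
    fun_prop
  have hql : ∀ x, Tendsto (fun k => qf (F^[k] 0) x) atTop (𝓝 (qf Q x)) := fun x =>
    ((hc x).tendsto _).comp hlim
  have hle : ∀ k x, qf (F^[k] 0) x ≤ qf Q x := fun k x =>
    (monotone_nat_of_le_succ fun k => hF.iterate_mono k x).ge_of_tendsto (hql x) k
  have hQpd : Q.PosDef := by
    refine posDef_of_le_qf (hF.apply_posDef Matrix.PosSemidef.zero) (transpose_eq hQ) (hle 1)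
  refine ⟨Q, hQ, ext_of_qf (transpose_eq (hF.posSemidef hQ)) (transpose_eq hQ) fun x => ?_⟩
  apply le_antisymm
  -- No continuity of `F` is available. Since `Q` is positive definite, some iterate exceeds `(1 -
  -- ε) • Q`. Applying `F` and subhomogeneity gives the inequality up to the factor `1 - ε`.
  · have key : ∀ ε : ℝ, 0 < ε → ε ≤ 1 → (1 - ε) * qf (F Q) x ≤ qf Q x := by
      intro ε hε hε1
      have hE : Tendsto (fun k => F^[k] 0 - Q) atTop (𝓝 0) := by
        simpa using hlim.sub_const Q
      obtain ⟨k, hk⟩ := (eventually_abs_qf_le hQpd hE hε).exists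
      have h1 : ∀ x, qf ((1 - ε) • Q) x ≤ qf (F^[k] 0) x := by
        intro x
        have := (abs_le.1 (hk x)).1
        rw [qf_sub] at this
        rw [qf_smul]
        linarith
      have h2 := hF.mono (hQ.smul (by linarith : 0 ≤ 1 - ε)) (hF.iterate_posSemidef k) h1 x
      have h3 := hF.smul_le hQ (by linarith : 0 ≤ 1 - ε) (by linarith) x
      have h4 := hle (k + 1) x
      rw [Function.iterate_succ_apply'] at h4
      linarith
    have hlim : Tendsto (fun k : ℕ => (1 - 1 / ((k : ℝ) + 1)) * qf (F Q) x) atTop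
        (𝓝 ((1 - 0) * qf (F Q) x)) :=
      (tendsto_one_div_add_atTop_nhds_zero_nat.const_sub 1).mul_const _
    rw [sub_zero, one_mul] at hlim
    refine le_of_tendsto hlim (Eventually.of_forall fun k => key _ (by positivity) ?_)
    rw [div_le_one (by positivity)]
    linarith [(Nat.cast_nonneg k : (0 : ℝ) ≤ k)]
  · refine le_of_tendsto (hql x) ?_
    filter_upwards [eventually_ge_atTop 1] with k hk
    obtain ⟨j, rfl⟩ := Nat.exists_eq_add_of_le' hk
    rw [Function.iterate_succ_apply']
    exact hF.mono (hF.iterate_posSemidef j) hQ (hle j) x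

end IsMonotoneRayAffine

/-- A stochastic approximation path for the operator `F`: step sizes `α`, noise `M` whose weighted
partial sums converge. -/
structure IsApproximationPath (F : Matrix ι ι ℝ → Matrix ι ι ℝ) (α : ℕ → ℝ)
    (M Q : ℕ → Matrix ι ι ℝ) : Prop where
  mem : ∀ t, α t ∈ Set.Icc (0 : ℝ) 1
  sum : Tendsto (fun T => ∑ t ∈ Finset.range T, α t) atTop atTop
  posSemidef : ∀ t, (Q t).PosSemidef
  step : ∀ t, Q (t + 1) = Q t + α t • (F (Q t) - Q t + M t)
  noise : ∃ X, Tendsto (fun T => ∑ t ∈ Finset.range T, α t • M t) atTop (𝓝 X)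

namespace IsApproximationPath

variable {F : Matrix ι ι ℝ → Matrix ι ι ℝ} {C : Matrix ι ι ℝ} {α : ℕ → ℝ}
  {M Q : ℕ → Matrix ι ι ℝ}

/-- `E` is the partial sum of the noise series minus its limit, hence vanishing. Subtracting it from
`Q` leaves an averaging recursion in which the noise occurs only through `E`. -/
theorem exists_decomposition (h : IsApproximationPath F α M Q) :
    ∃ R E : ℕ → Matrix ι ι ℝ, (∀ t, Q t = R t + E t) ∧ Tendsto E atTop (𝓝 0) ∧
      ∀ t, R (t + 1) = (1 - α t) • R t + α t • (F (Q t) - E t) := by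
  obtain ⟨X, hX⟩ := h.noise
  refine ⟨fun t => Q t - (∑ s ∈ Finset.range t, α s • M s - X),
    fun t => ∑ s ∈ Finset.range t, α s • M s - X, fun t => by simp, by simpa using hX.sub_const X,
    fun t => ?_⟩
  simp only
  rw [h.step, Finset.sum_range_succ]
  module

theorem eventually_le (h : IsApproximationPath F α M Q) {P U : Matrix ι ι ℝ} (hP : P.PosDef)
    (hU : ∀ᶠ t in atTop, ∀ x, qf (F (Q t)) x ≤ qf U x) {ε : ℝ} (hε : 0 < ε) :
    ∀ᶠ t in atTop, ∀ x, qf (Q t) x ≤ qf U x + ε * qf P x := by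
  obtain ⟨R, E, hQ, hE, hR⟩ := h.exists_decomposition
  simp only [hQ] at hR hU ⊢
  exact eventually_qf_le_of_averaging hP h.mem h.sum hE hR hU hε

theorem eventually_ge (h : IsApproximationPath F α M Q) {P U : Matrix ι ι ℝ} (hP : P.PosDef)
    (hU : ∀ᶠ t in atTop, ∀ x, qf U x ≤ qf (F (Q t)) x) {ε : ℝ} (hε : 0 < ε) :
    ∀ᶠ t in atTop, ∀ x, qf U x - ε * qf P x ≤ qf (Q t) x := by
  obtain ⟨R, E, hQ, hE, hR⟩ := h.exists_decomposition
  simp only [hQ] at hR hU ⊢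
  exact eventually_le_qf_of_averaging hP h.mem h.sum hE hR hU hε

/-- Induction on `k`: a lower bound for the path passes through `F` by monotonicity, and the
averaging then pulls the path above the image. Each round costs an arbitrarily small fraction, hence
the factor `c < 1`. -/
theorem eventually_iterate_le (h : IsApproximationPath F α M Q) (hF : IsMonotoneRayAffine F C)
    (k : ℕ) {c : ℝ} (hc : 0 ≤ c) (hc1 : c < 1) :
    ∀ᶠ t in atTop, ∀ x, c * qf (F^[k] 0) x ≤ qf (Q t) x := by
  induction k generalizing c with
  | zero =>
    refine Eventually.of_forall fun t x => ?_
    simpa using qf_nonneg (h.posSemidef t) x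
  | succ k ih =>
    -- The induction hypothesis is used at the midpoint of `c` and `1`; the gap `(1 - c) / 2` pays
    -- for the averaging error.
    have hd0 : 0 ≤ (c + 1) / 2 := by linarith
    have hd1 : (c + 1) / 2 < 1 := by linarith
    have hk := hF.iterate_posSemidef k
    have hU : ∀ᶠ t in atTop, ∀ x, qf (((c + 1) / 2) • F^[k + 1] 0) x ≤ qf (F (Q t)) x := by
      filter_upwards [ih hd0 hd1] with t ht x
      rw [qf_smul, Function.iterate_succ_apply']
      refine (hF.smul_le hk hd0 hd1.le x).trans
        (hF.mono (hk.smul hd0) (h.posSemidef t) (fun x => ?_) x)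
      rw [qf_smul]
      exact ht x
    have hpd : (F^[k + 1] 0).PosDef := by
      rw [Function.iterate_succ_apply']
      exact hF.apply_posDef hk
    filter_upwards [h.eventually_ge hpd hU (show 0 < (1 - c) / 2 by linarith)] with t ht x
    have := ht x
    rw [qf_smul] at this
    linarith

/-- A bounded stochastic approximation path forces the existence of a fixed point. -/
theorem exists_fixedPoint (h : IsApproximationPath F α M Q) (hF : IsMonotoneRayAffine F C) {c : ℝ}
    (hb : ∀ t, (Q t).trace ≤ c) : ∃ Q, Q.PosSemidef ∧ F Q = Q := by
  -- The factor `2` arises because the path is only known to exceed half of each iterate.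
  refine hF.exists_fixedPoint (c := 2 * c) fun k => ?_
  obtain ⟨t, ht⟩ := (h.eventually_iterate_le hF k (c := 1 / 2) (by norm_num) (by norm_num)).exists
  have h1 : ((1 / 2 : ℝ) • F^[k] 0).trace ≤ (Q t).trace := trace_mono fun x => by
    rw [qf_smul]; exact ht x
  rw [Matrix.trace_smul, smul_eq_mul] at h1
  linarith [hb t]

/-- A bounded stochastic approximation path converges to any fixed point. -/
theorem tendsto (h : IsApproximationPath F α M Q) (hF : IsMonotoneRayAffine F C) {c : ℝ}
    (hb : ∀ t, (Q t).trace ≤ c) {Q' : Matrix ι ι ℝ} (hQ' : Q'.PosSemidef) (hfix : F Q' = Q') :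
    Tendsto Q atTop (𝓝 Q') := by
  have hpd : Q'.PosDef := hfix ▸ hF.apply_posDef hQ'
  have hq0 := fun x => qf_nonneg hQ' x
  obtain ⟨κ, hκ, hκC⟩ := exists_qf_le_mul hF.posDef Q'
  have hray : ∀ (s : ℝ), -1 ≤ s → ∀ x, qf (F ((1 + s) • Q')) x = (1 + s) * qf Q' x - s * qf C x := by
    intro s hs x
    rw [hF.ray hQ' (by linarith), hfix]
    ring
  obtain ⟨a, ha⟩ : ∃ a : ℝ, 1 ≤ a ∧ ∀ t x, qf (Q t) x ≤ (1 + a) * qf Q' x := by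
    obtain ⟨lam, hl, hlam⟩ := exists_mul_dotProduct_le_qf hpd
    refine ⟨1 + |c| * lam⁻¹, by linarith [mul_nonneg (abs_nonneg c) (inv_pos.2 hl).le],
      fun t x => ?_⟩
    have h1 := qf_le_trace (h.posSemidef t) x
    have h2 : (Q t).trace * (x ⬝ᵥ x) ≤ |c| * (x ⬝ᵥ x) :=
      mul_le_mul_of_nonneg_right ((hb t).trans (le_abs_self c)) (dotProduct_self_nonneg' x)
    have h3 : x ⬝ᵥ x ≤ lam⁻¹ * qf Q' x := by
      rw [le_inv_mul_iff₀ hl]; exact hlam x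
    have h4 := mul_le_mul_of_nonneg_left h3 (abs_nonneg c)
    nlinarith [hq0 x]
  -- contraction factor of the gauge of `Q'`
  set r : ℝ := 1 - (1 + κ)⁻¹ / 2 with hr
  have hinv : 0 < (1 + κ)⁻¹ := by positivity
  have hinv1 : (1 + κ)⁻¹ ≤ 1 := inv_le_one_of_one_le₀ (by linarith)
  have hC : ∀ x, (1 + κ)⁻¹ * qf Q' x ≤ qf C x := by
    intro x
    rw [inv_mul_le_iff₀ (by positivity)]
    have := hκC x
    nlinarith [qf_nonneg hF.posDef.posSemidef x]
  -- If the path is below `(1 + s) • Q'`, its image is below `(1 + s) • Q' - s • C`, and `C`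
  -- dominates `(1 + κ)⁻¹ • Q'`. Half of this gain is given up to the averaging error, which leaves
  -- the factor `r`.
  have hupper : ∀ k : ℕ, ∀ᶠ t in atTop, ∀ x, qf (Q t) x ≤ (1 + r ^ k * a) * qf Q' x := by
    intro k
    induction k with
    | zero => exact Eventually.of_forall fun t x => by simpa using ha.2 t x
    | succ k ih =>
      have hs : 0 < r ^ k * a := mul_pos (pow_pos (by linarith) k) (by linarith)
      have hU : ∀ᶠ t in atTop, ∀ x,
          qf (F (Q t)) x ≤ qf ((1 + (1 - (1 + κ)⁻¹) * (r ^ k * a)) • Q') x := by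
        filter_upwards [ih] with t ht x
        have h1 := hF.mono (h.posSemidef t)
          (hQ'.smul (by linarith : 0 ≤ 1 + r ^ k * a)) (fun x => by rw [qf_smul]; exact ht x) x
        rw [hray _ (by linarith)] at h1
        have h2 := mul_le_mul_of_nonneg_left (hC x) hs.le
        rw [qf_smul]
        linarith
      filter_upwards [h.eventually_le hpd hU
        (show 0 < (1 + κ)⁻¹ / 2 * (r ^ k * a) by positivity)] with t ht x
      have := ht x
      rw [qf_smul] at this
      refine this.trans (le_of_eq ?_)
      rw [pow_succ, hr]
      ring
  -- The same contraction from below, starting with the trivial bound `0 ≤ Q t`.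
  have hlower : ∀ k : ℕ, ∀ᶠ t in atTop, ∀ x, (1 - r ^ k) * qf Q' x ≤ qf (Q t) x := by
    intro k
    induction k with
    | zero => exact Eventually.of_forall fun t x => by simpa using qf_nonneg (h.posSemidef t) x
    | succ k ih =>
      have hs : 0 < r ^ k := pow_pos (by linarith) k
      have hs1 : r ^ k ≤ 1 := pow_le_one₀ (by linarith) (by linarith)
      have hU : ∀ᶠ t in atTop, ∀ x,
          qf ((1 - (1 - (1 + κ)⁻¹) * r ^ k) • Q') x ≤ qf (F (Q t)) x := by
        filter_upwards [ih] with t ht x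
        have h1 := hF.mono (hQ'.smul (by linarith : 0 ≤ 1 + -(r ^ k))) (h.posSemidef t)
          (fun x => by rw [qf_smul]; exact ht x) x
        rw [hray _ (by linarith)] at h1
        have h2 := mul_le_mul_of_nonneg_left (hC x) hs.le
        rw [qf_smul]
        linarith
      filter_upwards [h.eventually_ge hpd hU
        (show 0 < (1 + κ)⁻¹ / 2 * r ^ k by positivity)] with t ht x
      have := ht x
      rw [qf_smul] at this
      refine (le_of_eq ?_).trans this
      rw [pow_succ, hr]
      ring
  have hr0 : Tendsto (fun k : ℕ => r ^ k * a) atTop (𝓝 0) := by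
    simpa using (tendsto_pow_atTop_nhds_zero_of_lt_one (by linarith : 0 ≤ r)
      (by linarith)).mul_const a
  refine tendsto_of_forall_abs_qf_le (P := Q') (transpose_eq hQ')
    (fun t => transpose_eq (h.posSemidef t)) fun ε hε => ?_
  obtain ⟨k, hk⟩ := (hr0.eventually (gt_mem_nhds hε)).exists
  have hrk : r ^ k ≤ r ^ k * a := le_mul_of_one_le_right (pow_nonneg (by linarith) k) ha.1
  filter_upwards [hupper k, hlower k] with t h1 h2 x
  rw [abs_le]
  constructor
  · nlinarith [h2 x, hq0 x]
  · nlinarith [h1 x, hq0 x]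

end IsApproximationPath

end MonotoneOperator

/-! ### Expectations of random matrices under linear functionals. -/

section Expectation

variable {Ω : Type*} [MeasurableSpace Ω] {μ : Measure Ω} {ι κ : Type*}

/-- The quadratic form at `x` as a linear functional of the matrix. -/
def qfLinear [Fintype ι] (x : ι → ℝ) : Matrix ι ι ℝ →ₗ[ℝ] ℝ where
  toFun M := qf M x
  map_add' M M' := qf_add M M' x
  map_smul' c M := qf_smul c M x

theorem linearMap_apply_eq_sum [Fintype ι] [Fintype κ] [DecidableEq ι] [DecidableEq κ]
    (l : Matrix ι κ ℝ →ₗ[ℝ] ℝ) (M : Matrix ι κ ℝ) :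
    l M = ∑ i, ∑ j, M i j * l (Matrix.single i j 1) := by
  conv_lhs => rw [Matrix.matrix_eq_sum_single M]
  simp only [map_sum]
  refine Finset.sum_congr rfl fun i _ => Finset.sum_congr rfl fun j _ => ?_
  rw [← smul_eq_mul, ← map_smul, Matrix.smul_single, smul_eq_mul, mul_one]

theorem integrable_linearMap [Fintype ι] [Fintype κ] (l : Matrix ι κ ℝ →ₗ[ℝ] ℝ)
    {M : Ω → Matrix ι κ ℝ} (hM : ∀ i j, Integrable (fun ω => M ω i j) μ) :
    Integrable (fun ω => l (M ω)) μ := by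
  classical
  rw [show (fun ω => l (M ω)) = fun ω => ∑ i, ∑ j, M ω i j * l (Matrix.single i j 1) from
    funext fun ω => linearMap_apply_eq_sum l _]
  exact integrable_finsetSum _ fun i _ => integrable_finsetSum _ fun j _ => (hM i j).mul_const _

theorem linearMap_expect [Fintype ι] [Fintype κ] (l : Matrix ι κ ℝ →ₗ[ℝ] ℝ)
    {M : Ω → Matrix ι κ ℝ} (hM : ∀ i j, Integrable (fun ω => M ω i j) μ) :
    l (expect μ M) = ∫ ω, l (M ω) ∂μ := by
  classical
  rw [show (fun ω => l (M ω)) = fun ω => ∑ i, ∑ j, M ω i j * l (Matrix.single i j 1) from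
    funext fun ω => linearMap_apply_eq_sum l _, linearMap_apply_eq_sum l]
  rw [integral_finsetSum _ fun i _ => integrable_finsetSum _ fun j _ => (hM i j).mul_const _]
  refine Finset.sum_congr rfl fun i _ => ?_
  rw [integral_finsetSum _ fun j _ => (hM i j).mul_const _]
  refine Finset.sum_congr rfl fun j _ => ?_
  rw [integral_mul_const]
  rfl

theorem qf_expect [Fintype ι] {M : Ω → Matrix ι ι ℝ}
    (hM : ∀ i j, Integrable (fun ω => M ω i j) μ) (x : ι → ℝ) :
    qf (expect μ M) x = ∫ ω, qf (M ω) x ∂μ :=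
  linearMap_expect (qfLinear x) hM

theorem expect_posSemidef [Fintype ι] {M : Ω → Matrix ι ι ℝ}
    (hM : ∀ i j, Integrable (fun ω => M ω i j) μ) (h : ∀ᵐ ω ∂μ, (M ω).PosSemidef) :
    (expect μ M).PosSemidef := by
  refine posSemidef_of_qf ?_ fun x => ?_
  · ext i j
    refine integral_congr_ae ?_
    filter_upwards [h] with ω hω
    conv_lhs => rw [← transpose_eq hω, Matrix.transpose_apply]
  · rw [qf_expect hM]
    refine integral_nonneg_of_ae ?_
    filter_upwards [h] with ω hω using qf_nonneg hω x

end Expectation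

/-! ### Moment bounds and the Bellman operator. -/

section Moments

variable {n m : ℕ} {Ω : Type*} [MeasurableSpace Ω]

/-- The moment assumptions on one pair `(𝒜, N)` of random parameters. -/
structure SquareIntegrableParams (μ : Measure Ω) (A₁ : Ω → Matrix (Fin n) (Fin n ⊕ Fin m) ℝ)
    (N₁ : Ω → Matrix (Fin n ⊕ Fin m) (Fin n ⊕ Fin m) ℝ) : Prop where
  measurable_fst : Measurable A₁
  measurable_snd : Measurable N₁
  posSemidef : ∀ᵐ ω ∂μ, (N₁ ω).PosSemidef
  memLp_fst : MemLp (fun ω => ((A₁ ω)ᵀ * A₁ ω).trace) 2 μ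
  memLp_snd : MemLp (fun ω => (N₁ ω).trace) 2 μ
  posDef : (expect μ N₁).PosDef

theorem gram_posSemidef {ι κ : Type*} [Fintype ι] (B : Matrix ι κ ℝ) [Fintype κ] :
    (Bᵀ * B).PosSemidef := by
  simpa using Matrix.posSemidef_conjTranspose_mul_self B

theorem conj_posSemidef {ι κ : Type*} [Fintype ι] [Fintype κ] {K : Matrix ι ι ℝ}
    (hK : K.PosSemidef) (B : Matrix ι κ ℝ) : (Bᵀ * K * B).PosSemidef := by
  simpa using hK.conjTranspose_mul_mul_same B

theorem abs_mul_le_trace_gram {ι κ : Type*} [Fintype ι] [Fintype κ] (B : Matrix ι κ ℝ)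
    (i k : ι) (j l : κ) : |B i j * B k l| ≤ (Bᵀ * B).trace := by
  have h : ∀ i j, B i j * B i j ≤ (Bᵀ * B).trace := by
    intro i j
    have h1 : B i j * B i j ≤ (Bᵀ * B) j j := by
      rw [Matrix.mul_apply]
      exact Finset.single_le_sum (f := fun i => Bᵀ j i * B i j) (fun k _ => mul_self_nonneg _)
        (Finset.mem_univ i)
    exact h1.trans (Finset.single_le_sum (f := fun j => (Bᵀ * B) j j)
      (fun k _ => (gram_posSemidef B).diag_nonneg) (Finset.mem_univ j))
  rw [abs_le]
  constructor <;> nlinarith [h i j, h k l, sq_nonneg (B i j + B k l), sq_nonneg (B i j - B k l)]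

variable {μ : Measure Ω} [IsProbabilityMeasure μ] {A₁ : Ω → Matrix (Fin n) (Fin n ⊕ Fin m) ℝ}
    {N₁ : Ω → Matrix (Fin n ⊕ Fin m) (Fin n ⊕ Fin m) ℝ}

theorem integrable_of_abs_le_memLp {f g : Ω → ℝ} (hf : Measurable f) (hg : MemLp g 2 μ)
    (h : ∀ᵐ ω ∂μ, |f ω| ≤ g ω) : Integrable f μ := by
  refine (hg.integrable one_le_two).mono' hf.aestronglyMeasurable ?_
  simpa using h

namespace SquareIntegrableParams

theorem integrable_snd (h : SquareIntegrableParams μ A₁ N₁) (i j : Fin n ⊕ Fin m) :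
    Integrable (fun ω => N₁ ω i j) μ := by
  refine integrable_of_abs_le_memLp (measurable_matrix_iff.1 h.measurable_snd i j) h.memLp_snd ?_
  filter_upwards [h.posSemidef] with ω hω using abs_apply_le_trace hω i j

theorem integrable_conj (h : SquareIntegrableParams μ A₁ N₁) (K : Matrix (Fin n) (Fin n) ℝ)
    (i j : Fin n ⊕ Fin m) : Integrable (fun ω => ((A₁ ω)ᵀ * K * A₁ ω) i j) μ := by
  have hm := measurable_matrix_iff.1 h.measurable_fst
  simp only [Matrix.mul_apply, Matrix.transpose_apply, Finset.sum_mul]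
  refine integrable_finsetSum _ fun k _ => integrable_finsetSum _ fun l _ => ?_
  have : Integrable (fun ω => A₁ ω l i * A₁ ω k j) μ :=
    integrable_of_abs_le_memLp ((hm _ _).mul (hm _ _)) h.memLp_fst
      (Eventually.of_forall fun ω => abs_mul_le_trace_gram _ _ _ _ _)
  refine (this.mul_const (K l k)).congr (Eventually.of_forall fun ω => ?_)
  simp only
  ring

theorem integrable_target (h : SquareIntegrableParams μ A₁ N₁) (K : Matrix (Fin n) (Fin n) ℝ)
    (i j : Fin n ⊕ Fin m) : Integrable (fun ω => (N₁ ω + (A₁ ω)ᵀ * K * A₁ ω) i j) μ :=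
  (h.integrable_snd i j).add (h.integrable_conj K i j)

/-- The linear operator `K ↦ E[𝒜ᵀ K 𝒜]`. -/
noncomputable def conjOp (h : SquareIntegrableParams μ A₁ N₁) :
    Matrix (Fin n) (Fin n) ℝ →ₗ[ℝ] Matrix (Fin n ⊕ Fin m) (Fin n ⊕ Fin m) ℝ where
  toFun K := expect μ fun ω => (A₁ ω)ᵀ * K * A₁ ω
  map_add' K K' := by
    ext i j
    rw [Matrix.add_apply]
    simp only [expect, Matrix.of_apply]
    rw [← integral_add (h.integrable_conj K i j) (h.integrable_conj K' i j)]
    simp [Matrix.mul_add, Matrix.add_mul]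
  map_smul' c K := by
    ext i j
    simp only [expect, Matrix.of_apply, RingHom.id_apply, Matrix.smul_apply, smul_eq_mul]
    rw [← integral_const_mul]
    simp

theorem conjOp_posSemidef (h : SquareIntegrableParams μ A₁ N₁) {K : Matrix (Fin n) (Fin n) ℝ}
    (hK : K.PosSemidef) : (h.conjOp K).PosSemidef :=
  expect_posSemidef (h.integrable_conj K) (Eventually.of_forall fun ω => conj_posSemidef hK (A₁ ω))

theorem qf_conjOp (h : SquareIntegrableParams μ A₁ N₁) (K : Matrix (Fin n) (Fin n) ℝ)
    (z : Fin n ⊕ Fin m → ℝ) : qf (h.conjOp K) z = ∫ ω, qf K (A₁ ω *ᵥ z) ∂μ := by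
  refine (qf_expect (h.integrable_conj K) z).trans ?_
  simp only [qf_conj]

theorem integrable_qf_conj (h : SquareIntegrableParams μ A₁ N₁) (K : Matrix (Fin n) (Fin n) ℝ)
    (z : Fin n ⊕ Fin m → ℝ) : Integrable (fun ω => qf K (A₁ ω *ᵥ z)) μ := by
  have := integrable_linearMap (qfLinear z) (h.integrable_conj K)
  refine this.congr (Eventually.of_forall fun ω => ?_)
  exact qf_conj (A₁ ω) K z

theorem meanQ_eq (h : SquareIntegrableParams μ A₁ N₁) (K : Matrix (Fin n) (Fin n) ℝ) :
    meanQ μ A₁ N₁ K = expect μ N₁ + h.conjOp K := by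
  ext i j
  exact integral_add (h.integrable_snd i j) (h.integrable_conj K i j)

theorem conjOp_mono (h : SquareIntegrableParams μ A₁ N₁) {K K' : Matrix (Fin n) (Fin n) ℝ}
    (hK : ∀ x : Fin n → ℝ, qf K x ≤ qf K' x) (z : Fin n ⊕ Fin m → ℝ) :
    qf (h.conjOp K) z ≤ qf (h.conjOp K') z := by
  rw [h.qf_conjOp, h.qf_conjOp]
  exact integral_mono (h.integrable_qf_conj K z) (h.integrable_qf_conj K' z) fun ω => hK _

theorem meanQ_posSemidef (h : SquareIntegrableParams μ A₁ N₁) {K : Matrix (Fin n) (Fin n) ℝ}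
    (hK : K.PosSemidef) : (meanQ μ A₁ N₁ K).PosSemidef := by
  rw [h.meanQ_eq]
  exact h.posDef.posSemidef.add (h.conjOp_posSemidef hK)

end SquareIntegrableParams

/-- The expected one-step update `P ↦ E[N + 𝒜ᵀ π(P) 𝒜]` of the Q-matrix. -/
noncomputable def bellman (μ : Measure Ω) (A₁ : Ω → Matrix (Fin n) (Fin n ⊕ Fin m) ℝ)
    (N₁ : Ω → Matrix (Fin n ⊕ Fin m) (Fin n ⊕ Fin m) ℝ)
    (P : Matrix (Fin n ⊕ Fin m) (Fin n ⊕ Fin m) ℝ) : Matrix (Fin n ⊕ Fin m) (Fin n ⊕ Fin m) ℝ :=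
  meanQ μ A₁ N₁ (piMap P)

theorem piMap_smul {P : Matrix (Fin n ⊕ Fin m) (Fin n ⊕ Fin m) ℝ} (hP : P.PosSemidef)
    {c : ℝ} (hc : 0 ≤ c) : piMap (c • P) = c • piMap P :=
  ext_of_qf (transpose_eq (piMap_posSemidef (hP.smul hc)))
    (transpose_eq ((piMap_posSemidef hP).smul hc))
    fun x => by rw [qf_piMap_smul hP hc, qf_smul]

theorem SquareIntegrableParams.isMonotoneRayAffine (h : SquareIntegrableParams μ A₁ N₁) :
    IsMonotoneRayAffine (bellman μ A₁ N₁) (expect μ N₁) where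
  posDef := h.posDef
  posSemidef hP := h.meanQ_posSemidef (piMap_posSemidef hP)
  mono hP hP' hPP' x := by
    simp only [bellman, h.meanQ_eq, qf_add]
    linarith [h.conjOp_mono (piMap_mono hP hP' hPP') x]
  le hP x := by
    simp only [bellman, h.meanQ_eq, qf_add]
    linarith [qf_nonneg (h.conjOp_posSemidef (piMap_posSemidef hP)) x]
  ray hP hc x := by
    simp only [bellman, h.meanQ_eq, qf_add, piMap_smul hP hc, map_smul, qf_smul]
    ring

/-- With `fixedPoint_of_solvesARE`, one half of the dictionary between Riccati solutions and fixed
points of `bellman`. -/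
theorem solvesARE_of_fixedPoint {Q : Matrix (Fin n ⊕ Fin m) (Fin n ⊕ Fin m) ℝ}
    (hQ : Q.PosSemidef) (hfix : bellman μ A₁ N₁ Q = Q) : SolvesARE μ A₁ N₁ (piMap Q) := by
  refine ⟨piMap_posSemidef hQ, ?_⟩
  conv_lhs => rw [← hfix]
  rfl

theorem SquareIntegrableParams.fixedPoint_of_solvesARE (h : SquareIntegrableParams μ A₁ N₁)
    {K : Matrix (Fin n) (Fin n) ℝ} (hK : SolvesARE μ A₁ N₁ K) :
    (meanQ μ A₁ N₁ K).PosSemidef ∧ bellman μ A₁ N₁ (meanQ μ A₁ N₁ K) = meanQ μ A₁ N₁ K := by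
  refine ⟨h.meanQ_posSemidef hK.1, ?_⟩
  rw [bellman, ← hK.2]

end Moments

/-! ### A linear Lyapunov functional for a positive linear operator. -/

section Lyapunov

variable {ι : Type*} [Fintype ι]

/-- A positive linear functional that decreases along a positive linear operator with a strict
supersolution. -/
theorem exists_lyapunov_functional {Φ : Matrix ι ι ℝ →ₗ[ℝ] Matrix ι ι ℝ} {C Q : Matrix ι ι ℝ}
    (hΦ : ∀ P, P.PosSemidef → (Φ P).PosSemidef) (hC : C.PosDef) (hQ : Q.PosDef)
    (hfix : Q = C + Φ Q) :
    ∃ (l : Matrix ι ι ℝ →ₗ[ℝ] ℝ) (c κ : ℝ), 0 < c ∧ 0 < κ ∧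
      (∀ P, P.PosSemidef → P.trace ≤ l P) ∧ (∀ P, P.PosSemidef → l P ≤ κ * P.trace) ∧
      ∀ P, P.PosSemidef → l (Φ P) ≤ l P - c * l P := by
  obtain ⟨κ₁, hκ₁, hκC⟩ := exists_qf_le_mul hC Q
  obtain ⟨lam, hlam, hlamQ⟩ := exists_mul_dotProduct_le_qf hQ
  have hinv : 0 < (1 + κ₁)⁻¹ := by positivity
  have hinv1 : (1 + κ₁)⁻¹ ≤ 1 := inv_le_one_of_one_le₀ (by linarith)
  set r := 1 - (1 + κ₁)⁻¹
  have hr0 : 0 ≤ r := by simp only [r]; linarith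
  have hr1 : r < 1 := by simp only [r]; linarith
  have hpow : ∀ (k : ℕ) (P), P.PosSemidef → ((Φ ^ k) P).PosSemidef := by
    intro k
    induction k with
    | zero => intro P hP; simpa using hP
    | succ k ih => intro P hP; rw [pow_succ]; exact ih _ (hΦ P hP)
  have hmono : ∀ (k : ℕ) (P P' : Matrix ι ι ℝ), P.PosSemidef → P'.PosSemidef →
      (∀ x, qf P x ≤ qf P' x) → ∀ x, qf ((Φ ^ k) P) x ≤ qf ((Φ ^ k) P') x := by
    intro k P P' hP hP' h x
    have : (P' - P).PosSemidef := posSemidef_of_qf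
      (by rw [Matrix.transpose_sub, transpose_eq hP, transpose_eq hP'])
      (fun x => by rw [qf_sub]; linarith [h x])
    have := qf_nonneg (hpow k _ this) x
    rw [map_sub, qf_sub] at this
    linarith
  -- As `Φ Q = Q - C` and `C` dominates a positive multiple of `Q`, the operator contracts `Q` by `r
  -- < 1`. Every positive semidefinite matrix lies below a multiple of `Q`, so the traces of its
  -- iterates decay geometrically.
  have hQr : ∀ x, qf (Φ Q) x ≤ r * qf Q x := by
    intro x
    have h1 : qf Q x = qf C x + qf (Φ Q) x := by rw [← qf_add, ← hfix]
    have h2 : (1 + κ₁)⁻¹ * qf Q x ≤ qf C x := by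
      rw [inv_mul_le_iff₀ (by positivity)]
      have := hκC x
      nlinarith [qf_nonneg hC.posSemidef x]
    simp only [r]
    linarith
  have hQk : ∀ (k : ℕ) (x), qf ((Φ ^ k) Q) x ≤ r ^ k * qf Q x := by
    intro k
    induction k with
    | zero => intro x; simp
    | succ k ih =>
      intro x
      have h1 := hmono k (Φ Q) (r • Q) (hΦ Q hQ.posSemidef) (hQ.posSemidef.smul hr0)
        (fun x => by rw [qf_smul]; exact hQr x) x
      rw [map_smul, qf_smul] at h1
      rw [pow_succ, pow_succ, Module.End.mul_apply]
      refine h1.trans ?_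
      rw [mul_comm (r ^ k), mul_assoc]
      exact mul_le_mul_of_nonneg_left (ih x) hr0
  set τ := lam⁻¹ * Q.trace with hτ
  have hτ0 : 0 ≤ τ := mul_nonneg (inv_pos.2 hlam).le hQ.posSemidef.trace_nonneg
  have htr : ∀ (k : ℕ) (P), P.PosSemidef → ((Φ ^ k) P).trace ≤ r ^ k * τ * P.trace := by
    intro k P hP
    have hP0 : 0 ≤ P.trace * lam⁻¹ := mul_nonneg hP.trace_nonneg (inv_pos.2 hlam).le
    have h1 : ∀ x, qf P x ≤ qf ((P.trace * lam⁻¹) • Q) x := by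
      intro x
      rw [qf_smul, mul_assoc]
      refine (qf_le_trace hP x).trans (mul_le_mul_of_nonneg_left ?_ hP.trace_nonneg)
      rw [le_inv_mul_iff₀ hlam]
      exact hlamQ x
    have h2 : ∀ x, qf ((Φ ^ k) P) x ≤ qf ((P.trace * lam⁻¹ * r ^ k) • Q) x := by
      intro x
      have := hmono k _ _ hP (hQ.posSemidef.smul hP0) h1 x
      rw [map_smul, qf_smul] at this
      rw [qf_smul, mul_assoc]
      exact this.trans (mul_le_mul_of_nonneg_left (hQk k x) hP0)
    refine (trace_mono h2).trans (le_of_eq ?_)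
    rw [Matrix.trace_smul, smul_eq_mul, hτ]
    ring
  obtain ⟨K, hK⟩ : ∃ K : ℕ, r ^ (K + 1) * τ ≤ 1 / 2 := by
    have h1 : Tendsto (fun k : ℕ => r ^ (k + 1) * τ) atTop (𝓝 0) := by
      simpa using ((tendsto_pow_atTop_nhds_zero_of_lt_one hr0 hr1).comp
        (tendsto_add_atTop_nat 1)).mul_const τ
    obtain ⟨K, hK⟩ := (h1.eventually (gt_mem_nhds (show (0 : ℝ) < 1 / 2 by norm_num))).exists
    exact ⟨K, hK.le⟩
  -- A truncated Neumann series of traces. Applying `Φ` shifts the sum: it loses `P.trace` and gains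
  -- the trace of `Φ ^ (K + 1)`, at most half of it by the choice of `K`. The net loss is at least a
  -- fixed fraction of `l P`.
  set l : Matrix ι ι ℝ →ₗ[ℝ] ℝ :=
    ∑ k ∈ Finset.range (K + 1), (Matrix.traceLinearMap ι ℝ ℝ).comp (Φ ^ k) with hl
  have hlP : ∀ P, l P = ∑ k ∈ Finset.range (K + 1), ((Φ ^ k) P).trace := by
    intro P
    simp [hl]
  set κ := (K + 1) * τ + 1
  have hκ : 0 < κ := by positivity
  have hup : ∀ P, P.PosSemidef → l P ≤ κ * P.trace := by
    intro P hP
    have h1 : l P ≤ ∑ k ∈ Finset.range (K + 1), τ * P.trace := by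
      rw [hlP]
      refine Finset.sum_le_sum fun k _ => (htr k P hP).trans ?_
      refine mul_le_mul_of_nonneg_right ?_ hP.trace_nonneg
      exact mul_le_of_le_one_left hτ0 (pow_le_one₀ hr0 hr1.le)
    rw [Finset.sum_const, Finset.card_range, nsmul_eq_mul, Nat.cast_add, Nat.cast_one] at h1
    simp only [κ]
    linarith [hP.trace_nonneg]
  refine ⟨l, 1 / (2 * κ), κ, by positivity, hκ, fun P hP => ?_, hup, fun P hP => ?_⟩
  · rw [hlP, Finset.sum_range_succ']
    simp only [pow_zero, Module.End.one_apply, le_add_iff_nonneg_left]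
    exact Finset.sum_nonneg fun k _ => (hpow _ P hP).trace_nonneg
  · have h1 : l (Φ P) + P.trace = l P + ((Φ ^ (K + 1)) P).trace := by
      have e1 := Finset.sum_range_succ (fun k => ((Φ ^ k) P).trace) (K + 1)
      have e2 := Finset.sum_range_succ' (fun k => ((Φ ^ k) P).trace) (K + 1)
      simp only [pow_succ, Module.End.mul_apply, pow_zero, Module.End.one_apply] at e1 e2
      rw [hlP, hlP, pow_succ, Module.End.mul_apply, ← e2, e1]
    have h2 : ((Φ ^ (K + 1)) P).trace ≤ 1 / 2 * P.trace :=
      (htr _ P hP).trans (mul_le_mul_of_nonneg_right hK hP.trace_nonneg)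
    have h3 : 1 / (2 * κ) * l P ≤ 1 / 2 * P.trace := by
      rw [div_mul_eq_mul_div, one_mul, div_le_iff₀ (by positivity)]
      linarith [hup P hP]
    linarith

end Lyapunov

/-! ### The Lyapunov functional for the nonlinear Bellman operator. -/

section BellmanLyapunov

variable {n m : ℕ} {Ω : Type*} [MeasurableSpace Ω] {μ : Measure Ω} [IsProbabilityMeasure μ]
    {A₁ : Ω → Matrix (Fin n) (Fin n ⊕ Fin m) ℝ}
    {N₁ : Ω → Matrix (Fin n ⊕ Fin m) (Fin n ⊕ Fin m) ℝ}

/-- The matrix of the feedback map `x ↦ [x; Γ x]`. -/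
def feedbackMatrix (G : Matrix (Fin m) (Fin n) ℝ) : Matrix (Fin n ⊕ Fin m) (Fin n) ℝ :=
  Matrix.fromRows 1 G

theorem feedbackMatrix_mulVec (G : Matrix (Fin m) (Fin n) ℝ) (x : Fin n → ℝ) :
    feedbackMatrix G *ᵥ x = Sum.elim x (G *ᵥ x) := by
  simp [feedbackMatrix, Matrix.fromRows_mulVec]

/-- If the Bellman operator has a fixed point, then it admits a linear Lyapunov functional. -/
theorem SquareIntegrableParams.exists_lyapunov (h : SquareIntegrableParams μ A₁ N₁)
    {Q : Matrix (Fin n ⊕ Fin m) (Fin n ⊕ Fin m) ℝ} (hQ : Q.PosSemidef)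
    (hfix : bellman μ A₁ N₁ Q = Q) :
    ∃ (l : Matrix (Fin n ⊕ Fin m) (Fin n ⊕ Fin m) ℝ →ₗ[ℝ] ℝ) (b c κ : ℝ), 0 < c ∧ 0 < κ ∧
      (∀ P, P.PosSemidef → P.trace ≤ l P) ∧ (∀ P, P.PosSemidef → l P ≤ κ * P.trace) ∧
      ∀ P, P.PosSemidef → l (bellman μ A₁ N₁ P) ≤ b + l P - c * l P := by
  -- Freezing the feedback of `Q` gives `π(P) ≤ Hᵀ P H`, with equality at `P = Q`. The resulting
  -- affine map dominates `bellman` and still fixes `Q`.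
  set H := feedbackMatrix (gammaMap Q)
  set Φ : Matrix (Fin n ⊕ Fin m) (Fin n ⊕ Fin m) ℝ →ₗ[ℝ] Matrix (Fin n ⊕ Fin m) (Fin n ⊕ Fin m) ℝ :=
    h.conjOp ∘ₗ { toFun := fun X => Hᵀ * X * H
                  map_add' := fun X Y => by rw [Matrix.mul_add, Matrix.add_mul]
                  map_smul' := fun c X => by simp }
  have hΦ : ∀ P, P.PosSemidef → (Φ P).PosSemidef := fun P hP =>
    h.conjOp_posSemidef (conj_posSemidef hP H)
  have hpi : piMap Q = Hᵀ * Q * H := by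
    refine ext_of_qf (transpose_eq (piMap_posSemidef hQ)) (transpose_eq (conj_posSemidef hQ H))
      fun x => ?_
    rw [qf_conj, feedbackMatrix_mulVec, qf_piMap_eq hQ]
  have hfix' : Q = expect μ N₁ + Φ Q := by
    conv_lhs => rw [← hfix, bellman, h.meanQ_eq, hpi]
    rfl
  have hQpd : Q.PosDef := hfix ▸ h.isMonotoneRayAffine.apply_posDef hQ
  obtain ⟨l, c, κ, hc, hκ, h1, h2, h3⟩ := exists_lyapunov_functional hΦ h.posDef hQpd hfix'
  refine ⟨l, l (expect μ N₁), c, κ, hc, hκ, h1, h2, fun P hP => ?_⟩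
  have hle : ∀ z, qf (bellman μ A₁ N₁ P) z ≤ qf (expect μ N₁ + Φ P) z := by
    intro z
    rw [bellman, h.meanQ_eq, qf_add, qf_add]
    refine add_le_add_right (h.conjOp_mono (fun x => ?_) z) _
    change _ ≤ qf (Hᵀ * P * H) x
    rw [qf_conj, feedbackMatrix_mulVec]
    exact qf_piMap_le hP _ _
  have hF := h.isMonotoneRayAffine.posSemidef hP
  have hpsd : (expect μ N₁ + Φ P - bellman μ A₁ N₁ P).PosSemidef := by
    refine posSemidef_of_qf ?_ fun z => by rw [qf_sub]; linarith [hle z]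
    rw [Matrix.transpose_sub, transpose_eq (h.posDef.posSemidef.add (hΦ P hP)), transpose_eq hF]
  have h4 : 0 ≤ l (expect μ N₁ + Φ P - bellman μ A₁ N₁ P) :=
    hpsd.trace_nonneg.trans (h1 _ hpsd)
  rw [map_sub, map_add] at h4
  linarith [h3 P hP]

end BellmanLyapunov

/-! ### The filtration of the observed parameters. -/

section Information

variable {n m : ℕ} {Ω : Type*}

theorem info_mono (A : ℕ → Ω → Matrix (Fin n) (Fin n ⊕ Fin m) ℝ)
    (N : ℕ → Ω → Matrix (Fin n ⊕ Fin m) (Fin n ⊕ Fin m) ℝ) : Monotone (info A N) := by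
  intro s t hst
  refine iSup₂_le fun k hk => ?_
  exact le_iSup₂_of_le k ⟨hk.1, hk.2.trans hst⟩ le_rfl

theorem measurable_pair_info (A : ℕ → Ω → Matrix (Fin n) (Fin n ⊕ Fin m) ℝ)
    (N : ℕ → Ω → Matrix (Fin n ⊕ Fin m) (Fin n ⊕ Fin m) ℝ) (t : ℕ) :
    Measurable[info A N (t + 1)] fun ω => (A (t + 1) ω, N (t + 1) ω) := by
  refine measurable_iff_comap_le.2 ?_
  exact le_iSup₂_of_le (f := fun s (_ : s ∈ Set.Icc 1 (t + 1)) =>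
    MeasurableSpace.comap (fun ω => (A s ω, N s ω)) inferInstance) (t + 1) ⟨by omega, le_rfl⟩ le_rfl

theorem measurable_fst_info (A : ℕ → Ω → Matrix (Fin n) (Fin n ⊕ Fin m) ℝ)
    (N : ℕ → Ω → Matrix (Fin n ⊕ Fin m) (Fin n ⊕ Fin m) ℝ) (t : ℕ) :
    Measurable[info A N (t + 1)] (A (t + 1)) :=
  measurable_fst.comp (measurable_pair_info A N t)

end Information

/-! ### Independence of the next sample from the past, and freezing. -/

section Independence

variable {n m : ℕ} {Ω : Type*} [MeasurableSpace Ω]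

/-- The parameters `(𝒜_t, N_t)`, `t ≥ 1`, are i.i.d. with the required moments. -/
structure IIDParams (μ : Measure Ω) (A : ℕ → Ω → Matrix (Fin n) (Fin n ⊕ Fin m) ℝ)
    (N : ℕ → Ω → Matrix (Fin n ⊕ Fin m) (Fin n ⊕ Fin m) ℝ) : Prop where
  meas_fst : ∀ t, Measurable (A (t + 1))
  meas_snd : ∀ t, Measurable (N (t + 1))
  indep : iIndepFun (fun (t : ℕ) (ω : Ω) => (A (t + 1) ω, N (t + 1) ω)) μ
  ident : ∀ t : ℕ, IdentDistrib (fun ω => (A (t + 1) ω, N (t + 1) ω))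
    (fun ω => (A 1 ω, N 1 ω)) μ μ
  posSemidef : ∀ t, ∀ᵐ ω ∂μ, (N (t + 1) ω).PosSemidef
  params : SquareIntegrableParams μ (A 1) (N 1)

namespace IIDParams

variable {μ : Measure Ω} {A : ℕ → Ω → Matrix (Fin n) (Fin n ⊕ Fin m) ℝ}
  {N : ℕ → Ω → Matrix (Fin n ⊕ Fin m) (Fin n ⊕ Fin m) ℝ}

theorem measurable_pair (h : IIDParams μ A N) (t : ℕ) :
    Measurable fun ω => (A (t + 1) ω, N (t + 1) ω) :=
  (h.meas_fst t).prodMk (h.meas_snd t)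

theorem info_le (h : IIDParams μ A N) (t : ℕ) : info A N t ≤ ‹MeasurableSpace Ω› := by
  refine iSup₂_le fun s hs => ?_
  obtain ⟨k, rfl⟩ := Nat.exists_eq_add_of_le' hs.1
  exact (h.measurable_pair k).comap_le

/-- The filtration generated by the parameters. -/
def filtration (h : IIDParams μ A N) : Filtration ℕ ‹MeasurableSpace Ω› :=
  ⟨info A N, info_mono A N, h.info_le⟩

theorem indepFun (h : IIDParams μ A N) {S : Type*} [mS : MeasurableSpace S] {t : ℕ} {X : Ω → S}
    (hX : Measurable[info A N t] X) : IndepFun X (fun ω => (A (t + 1) ω, N (t + 1) ω)) μ := by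
  rw [IndepFun_iff_Indep]
  -- The family is indexed by `s` for the time `s + 1`: the past up to `t` is `s < t`, and the next
  -- sample has index `t`.
  have h1 := indep_iSup_of_disjoint (fun s => (h.measurable_pair s).comap_le)
    ((iIndepFun_iff_iIndep _ _ _).1 h.indep) (S := {s | s < t}) (T := {t})
    (by simp)
  refine indep_of_indep_of_le_left (indep_of_indep_of_le_right h1 ?_) (hX.comap_le.trans ?_)
  · simp
  · refine iSup₂_le fun s hs => ?_
    obtain ⟨k, rfl⟩ := Nat.exists_eq_add_of_le' hs.1
    exact le_iSup₂_of_le (f := fun s (_ : s ∈ {s | s < t}) =>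
      MeasurableSpace.comap (fun ω => (A (s + 1) ω, N (s + 1) ω)) inferInstance) k
      (Nat.lt_of_succ_le hs.2) le_rfl

variable [IsProbabilityMeasure μ]

theorem map_prodMk (h : IIDParams μ A N) {S : Type*} [mS : MeasurableSpace S] {t : ℕ} {X : Ω → S}
    (hX : Measurable[info A N t] X) :
    μ.map (fun ω => (X ω, (A (t + 1) ω, N (t + 1) ω))) =
      (μ.map X).prod (μ.map fun ω => (A 1 ω, N 1 ω)) := by
  have hX' : Measurable X := hX.mono (h.info_le t) le_rfl
  rw [← (h.ident t).map_eq]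
  exact (indepFun_iff_map_prod_eq_prod_map_map hX'.aemeasurable
    (h.measurable_pair t).aemeasurable).1 (h.indepFun hX)

/-- Freezing the information up to time `t`, for nonnegative functions. -/
theorem lintegral_freeze (h : IIDParams μ A N) {S : Type*} [mS : MeasurableSpace S] {t : ℕ}
    {X : Ω → S} (hX : Measurable[info A N t] X)
    {f : S × (Matrix (Fin n) (Fin n ⊕ Fin m) ℝ × Matrix (Fin n ⊕ Fin m) (Fin n ⊕ Fin m) ℝ) → ℝ≥0∞}
    (hf : Measurable f) :
    ∫⁻ ω, f (X ω, (A (t + 1) ω, N (t + 1) ω)) ∂μ = ∫⁻ ω, ∫⁻ ω', f (X ω, (A 1 ω', N 1 ω')) ∂μ ∂μ := by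
  have hX' : Measurable X := hX.mono (h.info_le t) le_rfl
  rw [← lintegral_map hf (hX'.prodMk (h.measurable_pair t)), h.map_prodMk hX,
    lintegral_prod _ hf.aemeasurable, lintegral_map hf.lintegral_prod_right' hX']
  refine lintegral_congr fun ω => ?_
  exact lintegral_map (hf.comp measurable_prodMk_left) (h.measurable_pair 0)

/-- Freezing the information up to time `t`, for integrable functions. -/
theorem integral_freeze (h : IIDParams μ A N) {S : Type*} [mS : MeasurableSpace S] {t : ℕ}
    {X : Ω → S} (hX : Measurable[info A N t] X)
    {f : S × (Matrix (Fin n) (Fin n ⊕ Fin m) ℝ × Matrix (Fin n ⊕ Fin m) (Fin n ⊕ Fin m) ℝ) → ℝ}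
    (hf : Measurable f) (hint : Integrable (fun ω => f (X ω, (A (t + 1) ω, N (t + 1) ω))) μ) :
    Integrable (fun ω => ∫ ω', f (X ω, (A 1 ω', N 1 ω')) ∂μ) μ ∧
    ∫ ω, f (X ω, (A (t + 1) ω, N (t + 1) ω)) ∂μ = ∫ ω, ∫ ω', f (X ω, (A 1 ω', N 1 ω')) ∂μ ∂μ := by
  have hX' : Measurable X := hX.mono (h.info_le t) le_rfl
  have hpair : Measurable fun ω => (X ω, (A (t + 1) ω, N (t + 1) ω)) :=
    hX'.prodMk (h.measurable_pair t)
  have : IsProbabilityMeasure (μ.map X) := Measure.isProbabilityMeasure_map hX'.aemeasurable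
  have : IsProbabilityMeasure (μ.map fun ω => (A 1 ω, N 1 ω)) :=
    Measure.isProbabilityMeasure_map (h.measurable_pair 0).aemeasurable
  have hint' : Integrable f ((μ.map X).prod (μ.map fun ω => (A 1 ω, N 1 ω))) := by
    rw [← h.map_prodMk hX]
    exact (integrable_map_measure hf.aestronglyMeasurable hpair.aemeasurable).2 hint
  have hinner : ∀ x, ∫ y, f (x, y) ∂(μ.map fun ω => (A 1 ω, N 1 ω)) =
      ∫ ω', f (x, (A 1 ω', N 1 ω')) ∂μ := fun x =>
    integral_map (h.measurable_pair 0).aemeasurable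
      (hf.comp measurable_prodMk_left).aestronglyMeasurable
  have hmeas : StronglyMeasurable fun x => ∫ y, f (x, y) ∂(μ.map fun ω => (A 1 ω, N 1 ω)) :=
    hf.stronglyMeasurable.integral_prod_right'
  constructor
  · have := hint'.integral_prod_left
    rw [integrable_map_measure hmeas.aestronglyMeasurable hX'.aemeasurable] at this
    refine this.congr (Eventually.of_forall fun ω => ?_)
    exact hinner _
  · rw [← integral_map (φ := fun ω => (X ω, (A (t + 1) ω, N (t + 1) ω))) hpair.aemeasurable
      hf.aestronglyMeasurable, h.map_prodMk hX, integral_prod _ hint',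
      integral_map hX'.aemeasurable hmeas.aestronglyMeasurable]
    simp only [hinner]

end IIDParams

end Independence

/-! ### Linear feedback. -/

section ClosedLoop

variable {n m : ℕ} {Ω : Type*}

/-- The state process under the linear feedback `G`. -/
def closedLoop (A : ℕ → Ω → Matrix (Fin n) (Fin n ⊕ Fin m) ℝ) (G : Matrix (Fin m) (Fin n) ℝ)
    (x : Fin n → ℝ) : ℕ → Ω → Fin n → ℝ
  | 0, _ => x
  | t + 1, ω => A (t + 1) ω *ᵥ Sum.elim (closedLoop A G x t ω) (G *ᵥ closedLoop A G x t ω)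

/-- A feedback control refers to the state that it generates. Defining the closed-loop state first
removes the circularity, and this lemma identifies the two. -/
theorem state_closedLoop (A : ℕ → Ω → Matrix (Fin n) (Fin n ⊕ Fin m) ℝ)
    (G : Matrix (Fin m) (Fin n) ℝ) (x : Fin n → ℝ) (t : ℕ) (ω : Ω) :
    state A x (fun t ω => G *ᵥ closedLoop A G x t ω) t ω = closedLoop A G x t ω := by
  induction t with
  | zero => rfl
  | succ t ih => rw [state, closedLoop, ih]

theorem admissible_closedLoop (A : ℕ → Ω → Matrix (Fin n) (Fin n ⊕ Fin m) ℝ)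
    (N : ℕ → Ω → Matrix (Fin n ⊕ Fin m) (Fin n ⊕ Fin m) ℝ) (G : Matrix (Fin m) (Fin n) ℝ)
    (x : Fin n → ℝ) : Admissible A N fun t ω => G *ᵥ closedLoop A G x t ω := by
  have h : ∀ t, Measurable[info A N t] (closedLoop A G x t) := by
    intro t
    induction t with
    | zero => exact measurable_const
    | succ t ih =>
      exact measurable_mulVec (measurable_fst_info A N t)
        ((measurable_sumElim ih (measurable_mulVec measurable_const ih)).mono
          (info_mono A N (Nat.le_succ t)) le_rfl)
  exact fun t => measurable_mulVec measurable_const (h t)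

end ClosedLoop

/-! ### Dynamic programming and verification for the control problem. -/

section LinearQuadratic

variable {n m : ℕ} {Ω : Type*} [MeasurableSpace Ω] {μ : Measure Ω} [IsProbabilityMeasure μ]
  {A : ℕ → Ω → Matrix (Fin n) (Fin n ⊕ Fin m) ℝ}
  {N : ℕ → Ω → Matrix (Fin n ⊕ Fin m) (Fin n ⊕ Fin m) ℝ}

theorem measurable_state {u : ℕ → Ω → Fin m → ℝ} (hu : Admissible A N u) (x : Fin n → ℝ) (t : ℕ) :
    Measurable[info A N t] (state A x u t) := by
  induction t with
  | zero => exact measurable_const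
  | succ t ih =>
    exact measurable_mulVec (measurable_fst_info A N t)
      ((measurable_sumElim ih (hu t)).mono (info_mono A N (Nat.le_succ t)) le_rfl)

theorem measurable_stateControl {u : ℕ → Ω → Fin m → ℝ} (hu : Admissible A N u) (x : Fin n → ℝ)
    (t : ℕ) : Measurable[info A N t] (stateControl A x u t) :=
  measurable_sumElim (measurable_state hu x t) (hu t)

/-- The expected cost incurred at time `t`. -/
noncomputable def stageCost (μ : Measure Ω) (A : ℕ → Ω → Matrix (Fin n) (Fin n ⊕ Fin m) ℝ)
    (N : ℕ → Ω → Matrix (Fin n ⊕ Fin m) (Fin n ⊕ Fin m) ℝ) (x : Fin n → ℝ)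
    (u : ℕ → Ω → Fin m → ℝ) (t : ℕ) : ℝ≥0∞ :=
  ∫⁻ ω, ENNReal.ofReal (qf (N (t + 1) ω) (stateControl A x u t ω)) ∂μ

/-- The expected terminal cost at time `t` for the terminal cost matrix `K`. -/
noncomputable def terminalCost (μ : Measure Ω) (A : ℕ → Ω → Matrix (Fin n) (Fin n ⊕ Fin m) ℝ)
    (K : Matrix (Fin n) (Fin n) ℝ) (x : Fin n → ℝ) (u : ℕ → Ω → Fin m → ℝ) (t : ℕ) : ℝ≥0∞ :=
  ∫⁻ ω, ENNReal.ofReal (qf K (state A x u t ω)) ∂μ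

theorem terminalCost_initial (K : Matrix (Fin n) (Fin n) ℝ) (x : Fin n → ℝ)
    (u : ℕ → Ω → Fin m → ℝ) : terminalCost μ A K x u 0 = ENNReal.ofReal (qf K x) := by
  simp [terminalCost, state]

namespace IIDParams

theorem expectedCost_eq_tsum (h : IIDParams μ A N) {u : ℕ → Ω → Fin m → ℝ}
    (hu : Admissible A N u) (x : Fin n → ℝ) :
    expectedCost μ A N x u = ∑' t, stageCost μ A N x u t := by
  refine lintegral_tsum fun t => ?_
  exact (ENNReal.measurable_ofReal.comp (measurable_qf (h.meas_snd t)
    ((measurable_stateControl hu x t).mono (h.info_le t) le_rfl))).aemeasurable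

/-- One step of dynamic programming. -/
theorem stageCost_add_terminalCost (h : IIDParams μ A N) {u : ℕ → Ω → Fin m → ℝ}
    (hu : Admissible A N u) (x : Fin n → ℝ) {K : Matrix (Fin n) (Fin n) ℝ} (hK : K.PosSemidef)
    (t : ℕ) :
    stageCost μ A N x u t + terminalCost μ A K x u (t + 1) =
      ∫⁻ ω, ENNReal.ofReal (qf (meanQ μ (A 1) (N 1) K) (stateControl A x u t ω)) ∂μ := by
  have hz := measurable_stateControl hu x t
  have hp := h.params
  let f : (Fin n ⊕ Fin m → ℝ) × (Matrix (Fin n) (Fin n ⊕ Fin m) ℝ ×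
      Matrix (Fin n ⊕ Fin m) (Fin n ⊕ Fin m) ℝ) → ℝ≥0∞ := fun p =>
    ENNReal.ofReal (qf p.2.2 p.1) + ENNReal.ofReal (qf K (p.2.1 *ᵥ p.1))
  have hf : Measurable f := by
    refine (ENNReal.measurable_ofReal.comp ?_).add (ENNReal.measurable_ofReal.comp ?_)
    · exact measurable_qf measurable_snd.snd measurable_fst
    · exact measurable_qf measurable_const (measurable_mulVec measurable_snd.fst measurable_fst)
  have h1 : stageCost μ A N x u t + terminalCost μ A K x u (t + 1) =
      ∫⁻ ω, f (stateControl A x u t ω, (A (t + 1) ω, N (t + 1) ω)) ∂μ := by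
    refine (lintegral_add_left ?_ _).symm
    exact ENNReal.measurable_ofReal.comp (measurable_qf (h.meas_snd t)
      (hz.mono (h.info_le t) le_rfl))
  rw [h1, h.lintegral_freeze hz hf]
  refine lintegral_congr fun ω => ?_
  set z := stateControl A x u t ω
  have hN : Integrable (fun ω' => qf (N 1 ω') z) μ := integrable_linearMap (qfLinear z) hp.integrable_snd
  simp only [f]
  have hNm : Measurable fun ω' => ENNReal.ofReal (qf (N 1 ω') z) :=
    ENNReal.measurable_ofReal.comp (measurable_qf hp.measurable_snd measurable_const)
  rw [lintegral_add_left hNm,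
    ← ofReal_integral_eq_lintegral_ofReal hN ?_,
    ← ofReal_integral_eq_lintegral_ofReal (hp.integrable_qf_conj K z)
      (Eventually.of_forall fun _ => qf_nonneg hK _),
    ← qf_expect hp.integrable_snd, ← hp.qf_conjOp, hp.meanQ_eq, qf_add,
    ENNReal.ofReal_add (qf_nonneg hp.posDef.posSemidef z) (qf_nonneg (hp.conjOp_posSemidef hK) z)]
  filter_upwards [hp.posSemidef] with ω' hω' using qf_nonneg hω' z

theorem terminalCost_le (h : IIDParams μ A N) {u : ℕ → Ω → Fin m → ℝ}
    (hu : Admissible A N u) (x : Fin n → ℝ) {K : Matrix (Fin n) (Fin n) ℝ} (hK : K.PosSemidef)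
    (t : ℕ) :
    terminalCost μ A (piMap (meanQ μ (A 1) (N 1) K)) x u t ≤
      stageCost μ A N x u t + terminalCost μ A K x u (t + 1) := by
  rw [h.stageCost_add_terminalCost hu x hK]
  exact lintegral_mono fun ω => ENNReal.ofReal_le_ofReal
    (qf_piMap_le (h.params.meanQ_posSemidef hK) _ _)

/-- Finite-horizon dynamic programming with zero terminal cost: the `s`-th step of value iteration
bounds from below the expected cost of the `s` stages following time `t`. -/
theorem terminalCost_iterate_le (h : IIDParams μ A N) {u : ℕ → Ω → Fin m → ℝ}
    (hu : Admissible A N u) (x : Fin n → ℝ) (s t : ℕ) :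
    terminalCost μ A (piMap ((bellman μ (A 1) (N 1))^[s] 0)) x u t ≤
      ∑ k ∈ Finset.range s, stageCost μ A N x u (t + k) := by
  induction s generalizing t with
  | zero => simp [terminalCost, piMap_zero]
  | succ s ih =>
    rw [Function.iterate_succ_apply', Finset.sum_range_succ']
    have h1 := h.terminalCost_le hu x
      (piMap_posSemidef (h.params.isMonotoneRayAffine.iterate_posSemidef s)) t
    refine h1.trans ?_
    rw [add_comm, add_zero]
    refine add_le_add_left ((ih (t + 1)).trans (le_of_eq ?_)) _
    refine Finset.sum_congr rfl fun k _ => ?_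
    congr 1
    omega

/-- If the problem is well-posed, the Bellman operator has a fixed point. -/
theorem exists_fixedPoint_of_wellPosed (h : IIDParams μ A N) (hw : WellPosed μ A N) :
    ∃ Q, Q.PosSemidef ∧ bellman μ (A 1) (N 1) Q = Q := by
  have hF := h.params.isMonotoneRayAffine
  have h1 : ∀ (s : ℕ) (x : Fin n → ℝ),
      qf (piMap ((bellman μ (A 1) (N 1))^[s] 0)) x ≤ (value μ A N x).toReal := by
    intro s x
    rw [← ENNReal.ofReal_le_iff_le_toReal (hw x).ne]
    refine le_iInf₂ fun u hu => ?_
    rw [h.expectedCost_eq_tsum hu]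
    have := h.terminalCost_iterate_le hu x s 0
    rw [terminalCost_initial] at this
    simp only [zero_add] at this
    exact this.trans (ENNReal.sum_le_tsum _)
  set v : ℝ := ∑ i, (value μ A N (Pi.single i 1)).toReal with hv
  have h2 : ∀ (s : ℕ) (x : Fin n → ℝ),
      qf (piMap ((bellman μ (A 1) (N 1))^[s] 0)) x ≤ qf (v • (1 : Matrix (Fin n) (Fin n) ℝ)) x := by
    intro s x
    refine (qf_le_trace (piMap_posSemidef (hF.iterate_posSemidef s)) x).trans ?_
    rw [qf_smul, qf_one]
    refine mul_le_mul_of_nonneg_right ?_ (dotProduct_self_nonneg' x)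
    refine Finset.sum_le_sum fun i _ => ?_
    have := h1 s (Pi.single i 1)
    rwa [qf_single] at this
  -- So far only the Schur complements of the iterates are bounded, by `v • 1`. The iterates
  -- themselves follow because each lies below its successor, which is `meanQ` of such a complement.
  refine hF.exists_fixedPoint (c := (meanQ μ (A 1) (N 1) (v • 1)).trace) fun k => ?_
  refine trace_mono fun z => (hF.iterate_mono k z).trans ?_
  rw [Function.iterate_succ_apply', bellman, h.params.meanQ_eq, h.params.meanQ_eq, qf_add, qf_add]
  linarith [h.params.conjOp_mono (h2 k) z]

/-- A solution of the Riccati equation is a lower bound of the cost. -/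
theorem le_expectedCost (h : IIDParams μ A N) {K : Matrix (Fin n) (Fin n) ℝ}
    (hK : SolvesARE μ (A 1) (N 1) K) {u : ℕ → Ω → Fin m → ℝ} (hu : Admissible A N u)
    (x : Fin n → ℝ) : ENNReal.ofReal (qf K x) ≤ expectedCost μ A N x u := by
  rw [h.expectedCost_eq_tsum hu]
  by_cases htop : ∑' t, stageCost μ A N x u t = ⊤
  · rw [htop]; exact le_top
  have hQ := h.params.meanQ_posSemidef hK.1
  have hsum : ∀ T : ℕ, ENNReal.ofReal (qf K x) ≤
      ∑ t ∈ Finset.range T, stageCost μ A N x u t + terminalCost μ A K x u T := by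
    intro T
    induction T with
    | zero => simp [terminalCost_initial]
    | succ T ih =>
      rw [Finset.sum_range_succ, add_assoc]
      have := h.terminalCost_le hu x hK.1 T
      rw [← hK.2] at this
      exact ih.trans (add_le_add_right this _)
  obtain ⟨κ, hκ, hκQ⟩ := exists_qf_le_mul h.params.posDef (meanQ μ (A 1) (N 1) K)
  -- Transversality: the terminal cost is controlled by the stage cost because `E[N]` is positive
  -- definite. A finite total cost therefore forces it to zero.
  have hterm : ∀ T, terminalCost μ A K x u T ≤ ENNReal.ofReal κ * stageCost μ A N x u T := by
    intro T
    -- With zero terminal matrix the dynamic programming identity expresses the stage cost through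
    -- `E[N]` alone.
    have h0 := h.stageCost_add_terminalCost hu x (Matrix.PosSemidef.zero) T
    simp only [terminalCost, qf_zero, ENNReal.ofReal_zero, lintegral_zero, add_zero] at h0
    have hmean : meanQ μ (A 1) (N 1) (0 : Matrix (Fin n) (Fin n) ℝ) = expect μ (N 1) := by
      rw [h.params.meanQ_eq, map_zero, add_zero]
    rw [hmean] at h0
    rw [h0, ← lintegral_const_mul' _ _ ENNReal.ofReal_ne_top]
    refine lintegral_mono fun ω => ?_
    rw [← ENNReal.ofReal_mul hκ]
    refine ENNReal.ofReal_le_ofReal (le_trans ?_ (hκQ _))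
    conv_lhs => rw [hK.2]
    exact qf_piMap_le hQ _ _
  have hlim : Tendsto (fun T => ∑ t ∈ Finset.range T, stageCost μ A N x u t +
      ENNReal.ofReal κ * stageCost μ A N x u T) atTop
      (𝓝 (∑' t, stageCost μ A N x u t + ENNReal.ofReal κ * 0)) :=
    (ENNReal.tendsto_nat_tsum _).add (ENNReal.Tendsto.const_mul
      (ENNReal.tendsto_atTop_zero_of_tsum_ne_top htop) (Or.inr ENNReal.ofReal_ne_top))
  rw [mul_zero, add_zero] at hlim
  exact ge_of_tendsto' hlim fun T => (hsum T).trans (add_le_add_right (hterm T) _)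

/-- At the minimising feedback the dynamic programming inequality is an equality; it telescopes, and
the nonnegative terminal term is dropped. -/
theorem expectedCost_closedLoop_le (h : IIDParams μ A N) {K : Matrix (Fin n) (Fin n) ℝ}
    (hK : SolvesARE μ (A 1) (N 1) K) (x : Fin n → ℝ) :
    expectedCost μ A N x (fun t ω => gammaMap (meanQ μ (A 1) (N 1) K) *ᵥ
      closedLoop A (gammaMap (meanQ μ (A 1) (N 1) K)) x t ω) ≤ ENNReal.ofReal (qf K x) := by
  set G := gammaMap (meanQ μ (A 1) (N 1) K)
  set u : ℕ → Ω → Fin m → ℝ := fun t ω => G *ᵥ closedLoop A G x t ω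
  have hu : Admissible A N u := admissible_closedLoop A N G x
  have hQ := h.params.meanQ_posSemidef hK.1
  have hstep : ∀ t, stageCost μ A N x u t + terminalCost μ A K x u (t + 1) =
      terminalCost μ A K x u t := by
    intro t
    rw [h.stageCost_add_terminalCost hu x hK.1]
    refine lintegral_congr fun ω => ?_
    congr 1
    conv_rhs => rw [hK.2, qf_piMap_eq hQ]
    simp only [stateControl, u, state_closedLoop]
    rfl
  have hsum : ∀ T : ℕ, ∑ t ∈ Finset.range T, stageCost μ A N x u t + terminalCost μ A K x u T =
      ENNReal.ofReal (qf K x) := by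
    intro T
    induction T with
    | zero => simp [terminalCost_initial]
    | succ T ih => rw [Finset.sum_range_succ, add_assoc, hstep, ih]
  rw [h.expectedCost_eq_tsum hu]
  exact le_of_tendsto' (ENNReal.tendsto_nat_tsum _) fun T => (hsum T) ▸ le_self_add

theorem value_eq (h : IIDParams μ A N) {K : Matrix (Fin n) (Fin n) ℝ}
    (hK : SolvesARE μ (A 1) (N 1) K) (x : Fin n → ℝ) :
    value μ A N x = ENNReal.ofReal (qf K x) := by
  apply le_antisymm
  · exact (iInf₂_le _ (admissible_closedLoop A N _ x)).trans (h.expectedCost_closedLoop_le hK x)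
  · exact le_iInf₂ fun u hu => h.le_expectedCost hK hu x

theorem isOptimal_closedLoop (h : IIDParams μ A N) {K : Matrix (Fin n) (Fin n) ℝ}
    (hK : SolvesARE μ (A 1) (N 1) K) (x : Fin n → ℝ) :
    IsOptimal μ A N x (fun t ω => gammaMap (meanQ μ (A 1) (N 1) K) *ᵥ
      closedLoop A (gammaMap (meanQ μ (A 1) (N 1) K)) x t ω) := by
  refine ⟨admissible_closedLoop A N _ x, ?_⟩
  rw [h.value_eq hK]
  exact le_antisymm (h.expectedCost_closedLoop_le hK x)
    (h.le_expectedCost hK (admissible_closedLoop A N _ x) x)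

theorem solvesARE_unique (h : IIDParams μ A N) {K K' : Matrix (Fin n) (Fin n) ℝ}
    (hK : SolvesARE μ (A 1) (N 1) K) (hK' : SolvesARE μ (A 1) (N 1) K') : K' = K := by
  refine ext_of_qf (transpose_eq hK'.1) (transpose_eq hK.1) fun x => ?_
  have h1 := (h.value_eq hK' x).symm.trans (h.value_eq hK x)
  exact (ENNReal.ofReal_eq_ofReal_iff (qf_nonneg hK'.1 x) (qf_nonneg hK.1 x)).1 h1

end IIDParams

end LinearQuadratic

/-! ### Martingale convergence. -/

section MartingaleConvergence

variable {Ω : Type*} [mΩ : MeasurableSpace Ω] {μ : Measure Ω} [IsProbabilityMeasure μ]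
  {ℱ : Filtration ℕ mΩ}

/-- A series of square-integrable martingale increments with summable variances converges almost
surely. -/
theorem ae_exists_tendsto_sum_of_orthogonal {ξ : ℕ → Ω → ℝ} {B : ℝ}
    (hmeas : ∀ t, Measurable[ℱ (t + 1)] (ξ t)) (hL2 : ∀ t, MemLp (ξ t) 2 μ)
    (horth : ∀ t (g : Ω → ℝ), Measurable[ℱ t] g → MemLp g 2 μ → ∫ ω, g ω * ξ t ω ∂μ = 0)
    (hB : ∀ T, ∑ t ∈ Finset.range T, ∫ ω, ξ t ω ^ 2 ∂μ ≤ B) :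
    ∀ᵐ ω ∂μ, ∃ c, Tendsto (fun T => ∑ t ∈ Finset.range T, ξ t ω) atTop (𝓝 c) := by
  set X : ℕ → Ω → ℝ := fun T ω => ∑ t ∈ Finset.range T, ξ t ω with hX
  have hXs : ∀ T, X (T + 1) = fun ω => X T ω + ξ T ω := fun T => by
    funext ω; simp [hX, Finset.sum_range_succ]
  have hXm : ∀ T, Measurable[ℱ T] (X T) := by
    intro T
    refine Finset.measurable_sum _ fun t ht => ?_
    exact (hmeas t).mono (ℱ.mono (Finset.mem_range.1 ht)) le_rfl
  have hX2 : ∀ T, MemLp (X T) 2 μ := fun T => memLp_finsetSum _ fun t _ => hL2 t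
  -- Pythagoras for orthogonal increments: the partial sums are bounded in `L²`.
  have hsq : ∀ T, ∫ ω, X T ω ^ 2 ∂μ = ∑ t ∈ Finset.range T, ∫ ω, ξ t ω ^ 2 ∂μ := by
    intro T
    induction T with
    | zero => simp [hX]
    | succ T ih =>
      have h1 : ∀ ω, X (T + 1) ω ^ 2 = X T ω ^ 2 + 2 * (X T ω * ξ T ω) + ξ T ω ^ 2 := by
        intro ω; rw [hXs]; ring
      have hi : Integrable (fun ω => 2 * (X T ω * ξ T ω)) μ :=
        ((hX2 T).integrable_mul (hL2 T)).const_mul 2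
      have hi2 : Integrable (fun ω => X T ω ^ 2 + 2 * (X T ω * ξ T ω)) μ :=
        (hX2 T).integrable_sq.add hi
      simp only [h1]
      rw [integral_add hi2 (hL2 T).integrable_sq,
        integral_add (hX2 T).integrable_sq hi, integral_const_mul,
        horth T _ (hXm T) (hX2 T), ih, Finset.sum_range_succ]
      ring
  have hmart : Martingale X ℱ μ := by
    refine martingale_of_setIntegral_eq_succ (fun T => (hXm T).stronglyMeasurable)
      (fun T => (hX2 T).integrable one_le_two) fun T s hs => ?_
    have hs' : MeasurableSet s := ℱ.le T s hs
    -- Orthogonality to indicators of past events is the martingale property.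
    have h0 := horth T (s.indicator fun _ => 1) (measurable_const.indicator hs)
      ((memLp_const 1).indicator hs')
    have h1 : ∫ ω in s, ξ T ω ∂μ = 0 := by
      rw [← integral_indicator hs', ← h0]
      refine integral_congr_ae (Eventually.of_forall fun ω => ?_)
      by_cases hω : ω ∈ s <;> simp [hω]
    rw [hXs]
    rw [integral_add ((hX2 T).integrable one_le_two).integrableOn
      ((hL2 T).integrable one_le_two).integrableOn, h1, add_zero]
  refine hmart.submartingale.exists_ae_tendsto_of_bdd (R := (1 + B).toNNReal) fun T => ?_
  have hint : Integrable (X T) μ := (hX2 T).integrable one_le_two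
  rw [eLpNorm_one_eq_lintegral_enorm, ← ofReal_integral_norm_eq_lintegral_enorm hint]
  refine ENNReal.ofReal_le_ofReal ?_
  calc ∫ ω, ‖X T ω‖ ∂μ ≤ ∫ ω, (1 + X T ω ^ 2) ∂μ := by
        refine integral_mono hint.norm ((integrable_const 1).add (hX2 T).integrable_sq) fun ω => ?_
        simp only [Real.norm_eq_abs]
        nlinarith [sq_abs (X T ω), sq_nonneg (|X T ω| - 1), abs_nonneg (X T ω)]
    _ ≤ 1 + B := by
        rw [integral_add (integrable_const 1) (hX2 T).integrable_sq, hsq]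
        simpa using hB T

/-- For a nonnegative supermartingale `E|W t| = E[W t] ≤ E[W 0]`, so `-W` is an `L¹`-bounded
submartingale and converges almost surely. -/
theorem ae_bddAbove_of_supermartingale {W : ℕ → Ω → ℝ} (hW : Supermartingale W ℱ μ)
    (h0 : ∀ t, 0 ≤ᵐ[μ] W t) : ∀ᵐ ω ∂μ, ∃ B, ∀ t, W t ω ≤ B := by
  have hconv := hW.neg.exists_ae_tendsto_of_bdd (R := (∫ ω, W 0 ω ∂μ).toNNReal) fun t => by
    have hint := hW.integrable t
    rw [show (-W) t = -(W t) from rfl, eLpNorm_neg, eLpNorm_one_eq_lintegral_enorm, ← ofReal_integral_norm_eq_lintegral_enorm hint]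
    refine ENNReal.ofReal_le_ofReal ?_
    have h1 : ∫ ω, ‖W t ω‖ ∂μ = ∫ ω, W t ω ∂μ := by
      refine integral_congr_ae ?_
      filter_upwards [h0 t] with ω hω
      exact Real.norm_of_nonneg hω
    rw [h1]
    have := hW.setIntegral_le (Nat.zero_le t) (MeasurableSet.univ)
    simpa using this
  filter_upwards [hconv] with ω hω
  obtain ⟨c, hc⟩ := hω
  obtain ⟨B, hB⟩ := hc.neg.bddAbove_range
  exact ⟨B, fun t => by simpa using hB ⟨t, rfl⟩⟩

end MartingaleConvergence

/-! ### Q-learning as stochastic approximation: moments and noise. -/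

section Learning

variable {n m : ℕ}

/-- The sampled one-step target `N + 𝒜ᵀ π(q) 𝒜`. -/
noncomputable def target (q : Matrix (Fin n ⊕ Fin m) (Fin n ⊕ Fin m) ℝ)
    (p : Matrix (Fin n) (Fin n ⊕ Fin m) ℝ × Matrix (Fin n ⊕ Fin m) (Fin n ⊕ Fin m) ℝ) :
    Matrix (Fin n ⊕ Fin m) (Fin n ⊕ Fin m) ℝ :=
  p.2 + p.1ᵀ * piMap q * p.1

/-- The size of a sample of the parameters. -/
def gain (p : Matrix (Fin n) (Fin n ⊕ Fin m) ℝ × Matrix (Fin n ⊕ Fin m) (Fin n ⊕ Fin m) ℝ) : ℝ :=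
  p.2.trace + (p.1ᵀ * p.1).trace

theorem measurable_target {S : Type*} {mS : MeasurableSpace S}
    {f : S → Matrix (Fin n ⊕ Fin m) (Fin n ⊕ Fin m) ℝ}
    {g : S → Matrix (Fin n) (Fin n ⊕ Fin m) ℝ × Matrix (Fin n ⊕ Fin m) (Fin n ⊕ Fin m) ℝ}
    (hf : Measurable f) (hg : Measurable g) : Measurable fun s => target (f s) (g s) :=
  measurable_matrix_add hg.snd (measurable_matrix_mul (measurable_matrix_mul
    (measurable_matrix_transpose hg.fst) (measurable_piMap hf)) hg.fst)

theorem measurable_gain : Measurable (gain (n := n) (m := m)) :=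
  (measurable_trace measurable_snd).add (measurable_trace (measurable_matrix_mul
    (measurable_matrix_transpose measurable_fst) measurable_fst))

theorem gain_nonneg {p : Matrix (Fin n) (Fin n ⊕ Fin m) ℝ × Matrix (Fin n ⊕ Fin m) (Fin n ⊕ Fin m) ℝ}
    (hp : p.2.PosSemidef) : 0 ≤ gain p :=
  add_nonneg hp.trace_nonneg (gram_posSemidef p.1).trace_nonneg

theorem target_posSemidef {q : Matrix (Fin n ⊕ Fin m) (Fin n ⊕ Fin m) ℝ} (hq : q.PosSemidef)
    {p : Matrix (Fin n) (Fin n ⊕ Fin m) ℝ × Matrix (Fin n ⊕ Fin m) (Fin n ⊕ Fin m) ℝ}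
    (hp : p.2.PosSemidef) : (target q p).PosSemidef :=
  hp.add (conj_posSemidef (piMap_posSemidef hq) p.1)

/-- Linear growth in `q`, with a square-integrable factor depending on the sample alone. The
second-moment bounds for the noise and for the drift rest on this. -/
theorem trace_target_le {q : Matrix (Fin n ⊕ Fin m) (Fin n ⊕ Fin m) ℝ} (hq : q.PosSemidef)
    {p : Matrix (Fin n) (Fin n ⊕ Fin m) ℝ × Matrix (Fin n ⊕ Fin m) (Fin n ⊕ Fin m) ℝ}
    (hp : p.2.PosSemidef) : (target q p).trace ≤ gain p * (1 + q.trace) := by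
  have h1 := trace_conj_le (piMap_posSemidef hq) p.1
  have h2 := trace_piMap_le hq
  have h3 := (gram_posSemidef p.1).trace_nonneg
  have h4 := hp.trace_nonneg
  have h5 := hq.trace_nonneg
  rw [target, Matrix.trace_add, gain]
  nlinarith

variable {Ω : Type*}

theorem qLearning_succ (A : ℕ → Ω → Matrix (Fin n) (Fin n ⊕ Fin m) ℝ)
    (N : ℕ → Ω → Matrix (Fin n ⊕ Fin m) (Fin n ⊕ Fin m) ℝ) (α : ℕ → Ω → ℝ)
    (Q₀ : Matrix (Fin n ⊕ Fin m) (Fin n ⊕ Fin m) ℝ) (t : ℕ) (ω : Ω) :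
    qLearning A N α Q₀ (t + 1) ω = qLearning A N α Q₀ t ω +
      α t ω • (target (qLearning A N α Q₀ t ω) (A (t + 1) ω, N (t + 1) ω)
        - qLearning A N α Q₀ t ω) := rfl

/-- Adapted learning rates with the Robbins-Monro conditions. -/
structure LearningRates [MeasurableSpace Ω] (μ : Measure Ω)
    (A : ℕ → Ω → Matrix (Fin n) (Fin n ⊕ Fin m) ℝ)
    (N : ℕ → Ω → Matrix (Fin n ⊕ Fin m) (Fin n ⊕ Fin m) ℝ) (α : ℕ → Ω → ℝ) : Prop where
  meas : ∀ t, Measurable[info A N t] (α t)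
  mem : ∀ t, ∀ᵐ ω ∂μ, α t ω ∈ Set.Icc (0 : ℝ) 1
  sum : ∀ᵐ ω ∂μ, Tendsto (fun T => ∑ t ∈ Finset.range T, α t ω) atTop atTop
  sq : ∀ᵐ ω ∂μ, Summable (fun t => α t ω ^ 2)

variable [MeasurableSpace Ω] {μ : Measure Ω} [IsProbabilityMeasure μ]
  {A : ℕ → Ω → Matrix (Fin n) (Fin n ⊕ Fin m) ℝ}
  {N : ℕ → Ω → Matrix (Fin n ⊕ Fin m) (Fin n ⊕ Fin m) ℝ} {α : ℕ → Ω → ℝ}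
  {Q₀ : Matrix (Fin n ⊕ Fin m) (Fin n ⊕ Fin m) ℝ}

theorem measurable_qLearning (hα : LearningRates μ A N α)
    (Q₀ : Matrix (Fin n ⊕ Fin m) (Fin n ⊕ Fin m) ℝ) (t : ℕ) :
    Measurable[info A N t] (qLearning A N α Q₀ t) := by
  induction t with
  | zero => exact measurable_const
  | succ t ih =>
    have ih' := ih.mono (info_mono A N (Nat.le_succ t)) le_rfl
    exact measurable_matrix_add ih' (measurable_matrix_smul
      ((hα.meas t).mono (info_mono A N (Nat.le_succ t)) le_rfl)
      (measurable_matrix_sub (measurable_target ih' (measurable_pair_info A N t)) ih'))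

namespace IIDParams

theorem qLearning_posSemidef (h : IIDParams μ A N) (hα : LearningRates μ A N α)
    (hQ₀ : Q₀.PosSemidef) : ∀ᵐ ω ∂μ, ∀ t, (qLearning A N α Q₀ t ω).PosSemidef := by
  filter_upwards [ae_all_iff.2 h.posSemidef, ae_all_iff.2 hα.mem] with ω hN hm t
  induction t with
  | zero => exact hQ₀
  | succ t ih =>
    rw [qLearning_succ]
    have : qLearning A N α Q₀ t ω + α t ω • (target (qLearning A N α Q₀ t ω)
        (A (t + 1) ω, N (t + 1) ω) - qLearning A N α Q₀ t ω) =
        (1 - α t ω) • qLearning A N α Q₀ t ω + α t ω • target (qLearning A N α Q₀ t ω)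
        (A (t + 1) ω, N (t + 1) ω) := by module
    rw [this]
    exact (ih.smul (by linarith [(hm t).2])).add ((target_posSemidef ih (hN t)).smul (hm t).1)

theorem memLp_gain (h : IIDParams μ A N) (t : ℕ) :
    MemLp (fun ω => gain (A (t + 1) ω, N (t + 1) ω)) 2 μ := by
  have h1 : MemLp (fun ω => gain (A 1 ω, N 1 ω)) 2 μ := h.params.memLp_snd.add h.params.memLp_fst
  exact ((h.ident t).comp measurable_gain).memLp_iff.2 h1

theorem integral_comp_pair (h : IIDParams μ A N) (t : ℕ)
    {f : Matrix (Fin n) (Fin n ⊕ Fin m) ℝ × Matrix (Fin n ⊕ Fin m) (Fin n ⊕ Fin m) ℝ → ℝ}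
    (hf : Measurable f) :
    ∫ ω, f (A (t + 1) ω, N (t + 1) ω) ∂μ = ∫ ω, f (A 1 ω, N 1 ω) ∂μ :=
  ((h.ident t).comp hf).integral_eq

/-- The product of a square-integrable function of the past with one of the next sample is
square-integrable. -/
theorem memLp_mul_of_past (h : IIDParams μ A N) {t : ℕ} {g : Ω → ℝ}
    (hg : Measurable[info A N t] g) (hg2 : MemLp g 2 μ)
    {f : Matrix (Fin n) (Fin n ⊕ Fin m) ℝ × Matrix (Fin n ⊕ Fin m) (Fin n ⊕ Fin m) ℝ → ℝ}
    (hf : Measurable f) (hf2 : MemLp (fun ω => f (A (t + 1) ω, N (t + 1) ω)) 2 μ) :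
    MemLp (fun ω => g ω * f (A (t + 1) ω, N (t + 1) ω)) 2 μ ∧
    ∫ ω, (g ω * f (A (t + 1) ω, N (t + 1) ω)) ^ 2 ∂μ =
      (∫ ω, g ω ^ 2 ∂μ) * ∫ ω, f (A 1 ω, N 1 ω) ^ 2 ∂μ := by
  have hind : IndepFun (fun ω => g ω ^ 2) (fun ω => f (A (t + 1) ω, N (t + 1) ω) ^ 2) μ :=
    (h.indepFun (hg.pow_const 2)).comp measurable_id (hf.pow_const 2)
  have hm : AEStronglyMeasurable (fun ω => g ω * f (A (t + 1) ω, N (t + 1) ω)) μ :=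
    hg2.1.mul hf2.1
  constructor
  · rw [memLp_two_iff_integrable_sq hm]
    simp only [mul_pow]
    exact hind.integrable_mul hg2.integrable_sq hf2.integrable_sq
  · simp only [mul_pow]
    rw [← h.integral_comp_pair t (hf.pow_const 2)]
    exact hind.integral_mul_eq_mul_integral (hg2.1.pow 2) (hf2.1.pow 2)

/-- Without uniformity in `t`; it serves the integrability of the supermartingale in
`ae_bounded_of_fixedPoint`. -/
theorem memLp_trace_qLearning (h : IIDParams μ A N) (hα : LearningRates μ A N α)
    (hQ₀ : Q₀.PosSemidef) (t : ℕ) : MemLp (fun ω => (qLearning A N α Q₀ t ω).trace) 2 μ := by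
  induction t with
  | zero => exact memLp_const (μ := μ) Q₀.trace
  | succ t ih =>
    have hm := measurable_trace (measurable_qLearning hα Q₀ t)
    have hg : MemLp (fun ω => 1 + (qLearning A N α Q₀ t ω).trace) 2 μ := (memLp_const (1 : ℝ)).add ih
    have hf : MemLp (fun ω => 1 + gain (A (t + 1) ω, N (t + 1) ω)) 2 μ :=
      (memLp_const (1 : ℝ)).add (h.memLp_gain t)
    have h1 := (h.memLp_mul_of_past (hm.const_add 1) hg (measurable_gain.const_add 1) hf).1
    refine h1.mono' ((measurable_trace (measurable_qLearning hα Q₀ (t + 1))).mono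
      (h.info_le _) le_rfl).aestronglyMeasurable ?_
    filter_upwards [h.qLearning_posSemidef hα hQ₀, h.posSemidef t, hα.mem t] with ω hq hN ha
    rw [Real.norm_of_nonneg (hq (t + 1)).trace_nonneg, qLearning_succ, Matrix.trace_add,
      Matrix.trace_smul, Matrix.trace_sub, smul_eq_mul]
    have h2 := trace_target_le (hq t) (p := (A (t + 1) ω, N (t + 1) ω)) hN
    have h3 := (target_posSemidef (hq t) (p := (A (t + 1) ω, N (t + 1) ω)) hN).trace_nonneg
    have h4 := (hq t).trace_nonneg
    nlinarith [ha.1, ha.2]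

theorem integral_linearMap_target (h : IIDParams μ A N)
    (l : Matrix (Fin n ⊕ Fin m) (Fin n ⊕ Fin m) ℝ →ₗ[ℝ] ℝ)
    (q : Matrix (Fin n ⊕ Fin m) (Fin n ⊕ Fin m) ℝ) :
    Integrable (fun ω => l (target q (A 1 ω, N 1 ω))) μ ∧
    ∫ ω, l (target q (A 1 ω, N 1 ω)) ∂μ = l (bellman μ (A 1) (N 1) q) :=
  ⟨integrable_linearMap l (h.params.integrable_target _),
    (linearMap_expect l (h.params.integrable_target _)).symm⟩

theorem trace_bellman_le (h : IIDParams μ A N) {q : Matrix (Fin n ⊕ Fin m) (Fin n ⊕ Fin m) ℝ}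
    (hq : q.PosSemidef) :
    (bellman μ (A 1) (N 1) q).trace ≤ (∫ ω, gain (A 1 ω, N 1 ω) ∂μ) * (1 + q.trace) := by
  have h1 := h.integral_linearMap_target (Matrix.traceLinearMap _ ℝ ℝ) q
  simp only [Matrix.traceLinearMap_apply] at h1
  rw [← h1.2, ← integral_mul_const]
  refine integral_mono_ae h1.1 (((h.memLp_gain 0).integrable one_le_two).mul_const _) ?_
  filter_upwards [h.posSemidef 0] with ω hω
  exact trace_target_le hq hω

theorem measurable_linearMap (l : Matrix (Fin n ⊕ Fin m) (Fin n ⊕ Fin m) ℝ →ₗ[ℝ] ℝ)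
    {S : Type*} {mS : MeasurableSpace S} {f : S → Matrix (Fin n ⊕ Fin m) (Fin n ⊕ Fin m) ℝ}
    (hf : Measurable f) : Measurable fun s => l (f s) := by
  rw [show (fun s => l (f s)) = fun s => ∑ i, ∑ j, f s i j * l (Matrix.single i j 1) from
    funext fun s => linearMap_apply_eq_sum l _]
  exact Finset.measurable_sum _ fun i _ => Finset.measurable_sum _ fun j _ =>
    (measurable_matrix_iff.1 hf i j).mul_const _

theorem measurable_bellman (h : IIDParams μ A N) {S : Type*} {mS : MeasurableSpace S}
    {f : S → Matrix (Fin n ⊕ Fin m) (Fin n ⊕ Fin m) ℝ} (hf : Measurable f) :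
    Measurable fun s => bellman μ (A 1) (N 1) (f s) := by
  rw [measurable_matrix_iff]
  intro i j
  simp only [bellman, h.params.meanQ_eq, Matrix.add_apply]
  refine measurable_const.add ?_
  have h1 : ∀ s, h.params.conjOp (piMap (f s)) i j =
      ∑ k, ∑ l, piMap (f s) k l * h.params.conjOp (Matrix.single k l 1) i j := fun s =>
    linearMap_apply_eq_sum ((Matrix.entryLinearMap ℝ ℝ i j) ∘ₗ h.params.conjOp) _
  simp only [h1]
  exact Finset.measurable_sum _ fun k _ => Finset.measurable_sum _ fun l _ =>
    (measurable_matrix_iff.1 (measurable_piMap hf) k l).mul_const _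

end IIDParams

/-- The noise of the Q-learning iteration. -/
noncomputable def noise (μ : Measure Ω) (A : ℕ → Ω → Matrix (Fin n) (Fin n ⊕ Fin m) ℝ)
    (N : ℕ → Ω → Matrix (Fin n ⊕ Fin m) (Fin n ⊕ Fin m) ℝ) (α : ℕ → Ω → ℝ)
    (Q₀ : Matrix (Fin n ⊕ Fin m) (Fin n ⊕ Fin m) ℝ) (t : ℕ) (ω : Ω) :
    Matrix (Fin n ⊕ Fin m) (Fin n ⊕ Fin m) ℝ :=
  target (qLearning A N α Q₀ t ω) (A (t + 1) ω, N (t + 1) ω)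
    - bellman μ (A 1) (N 1) (qLearning A N α Q₀ t ω)

/-- The running sum is nondecreasing, so the cutoff retains exactly the terms before it first
exceeds `L`. The induction also carries the comparison with the uncut sum, which gives the bound
when a term is retained. -/
theorem sum_cutoff_sq_le (a : ℕ → ℝ) (L : ℝ) (hL : 0 ≤ L) (T : ℕ) :
    ∑ t ∈ Finset.range T,
      (if ∑ s ∈ Finset.range (t + 1), a s ^ 2 ≤ L then a t else 0) ^ 2 ≤ L := by
  have h : ∑ t ∈ Finset.range T,
      (if ∑ s ∈ Finset.range (t + 1), a s ^ 2 ≤ L then a t else 0) ^ 2 ≤ L ∧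
      ∑ t ∈ Finset.range T,
      (if ∑ s ∈ Finset.range (t + 1), a s ^ 2 ≤ L then a t else 0) ^ 2 ≤
        ∑ s ∈ Finset.range T, a s ^ 2 := by
    induction T with
    | zero => simpa using hL
    | succ T ih =>
      rw [Finset.sum_range_succ]
      split_ifs with hc
      · rw [Finset.sum_range_succ] at hc ⊢
        constructor <;> linarith [ih.2]
      · rw [Finset.sum_range_succ (fun s => a s ^ 2)]
        constructor
        · simpa using ih.1
        · nlinarith [ih.2, sq_nonneg (a T)]
  exact h.1

namespace IIDParams

/-- The bounds on the iterates and on `∑ α²` are random, so both are localised by deterministic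
levels `C` and `L`. The cutoffs depend only on the past, which preserves orthogonality, and they
make the variances summable. -/
theorem ae_noise_entry_tendsto (h : IIDParams μ A N) (hα : LearningRates μ A N α)
    (hQ₀ : Q₀.PosSemidef) (C L : ℕ) (i j : Fin n ⊕ Fin m) :
    ∀ᵐ ω ∂μ, ∃ c, Tendsto (fun T => ∑ t ∈ Finset.range T,
      (if (qLearning A N α Q₀ t ω).trace ≤ C then
        (if ∑ s ∈ Finset.range (t + 1), α s ω ^ 2 ≤ L then α t ω else 0) else 0)
        * noise μ A N α Q₀ t ω i j) atTop (𝓝 c) := by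
  set β₀ : ℕ → Ω → ℝ := fun t ω => if ∑ s ∈ Finset.range (t + 1), α s ω ^ 2 ≤ L then α t ω else 0
    with hβ₀
  set β : ℕ → Ω → ℝ := fun t ω => if (qLearning A N α Q₀ t ω).trace ≤ C then β₀ t ω else 0 with hβ
  have hQm := measurable_qLearning hα Q₀
  have hβ₀m : ∀ t, Measurable[info A N t] (β₀ t) := by
    intro t
    refine Measurable.ite (measurableSet_le ?_ measurable_const) (hα.meas t) measurable_const
    refine Finset.measurable_sum _ fun s hs => ?_
    exact ((hα.meas s).mono (info_mono A N (Nat.lt_succ_iff.1 (Finset.mem_range.1 hs)))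
      le_rfl).pow_const 2
  have hβm : ∀ t, Measurable[info A N t] (β t) := fun t =>
    Measurable.ite (measurableSet_le (measurable_trace (hQm t)) measurable_const)
      (hβ₀m t) measurable_const
  have hβ₀b : ∀ t, ∀ᵐ ω ∂μ, |β₀ t ω| ≤ 1 := by
    intro t
    filter_upwards [hα.mem t] with ω ha
    simp only [hβ₀]
    split_ifs
    · rw [abs_of_nonneg ha.1]; exact ha.2
    · simp
  have hβ₀2 : ∀ t, MemLp (β₀ t) 2 μ := fun t =>
    MemLp.of_bound ((hβ₀m t).mono (h.info_le t) le_rfl).aestronglyMeasurable 1 (by simpa using hβ₀b t)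
  -- `r` controls the Bellman part of the noise as `gain` controls the sampled part; where the trace
  -- is at most `C`, entries of the noise are at most `(1 + C) * (gain + r)`.
  set r := ∫ ω, gain (A 1 ω, N 1 ω) ∂μ
  have hr : 0 ≤ r := integral_nonneg_of_ae (by
    filter_upwards [h.posSemidef 0] with ω hω using gain_nonneg hω)
  have hfm : Measurable fun p : Matrix (Fin n) (Fin n ⊕ Fin m) ℝ ×
      Matrix (Fin n ⊕ Fin m) (Fin n ⊕ Fin m) ℝ => (1 + C) * (gain p + r) :=
    (measurable_gain.add_const r).const_mul _
  have hdom := fun t => h.memLp_mul_of_past (hβ₀m t) (hβ₀2 t) hfm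
    (((h.memLp_gain t).add (memLp_const r)).const_mul (1 + (C : ℝ)))
  have hMm : ∀ t, Measurable[info A N (t + 1)] fun ω => noise μ A N α Q₀ t ω i j := by
    intro t
    have hq := (hQm t).mono (info_mono A N (Nat.le_succ t)) le_rfl
    exact measurable_matrix_iff.1 (measurable_matrix_sub
      (measurable_target hq (measurable_pair_info A N t)) (h.measurable_bellman hq)) i j
  have hξm : ∀ t, Measurable[info A N (t + 1)] fun ω => β t ω * noise μ A N α Q₀ t ω i j :=
    fun t => ((hβm t).mono (info_mono A N (Nat.le_succ t)) le_rfl).mul (hMm t)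
  have hξb : ∀ t, ∀ᵐ ω ∂μ, |β t ω * noise μ A N α Q₀ t ω i j| ≤
      |β₀ t ω * ((1 + C) * (gain (A (t + 1) ω, N (t + 1) ω) + r))| := by
    intro t
    filter_upwards [h.qLearning_posSemidef hα hQ₀, h.posSemidef t] with ω hq hN
    simp only [hβ]
    split_ifs with hc
    · rw [abs_mul, abs_mul]
      refine mul_le_mul_of_nonneg_left ?_ (abs_nonneg _)
      have hg : 0 ≤ gain (A (t + 1) ω, N (t + 1) ω) := gain_nonneg hN
      have h1 := abs_apply_le_trace
        (target_posSemidef (hq t) (p := (A (t + 1) ω, N (t + 1) ω)) hN) i j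
      have h2 := abs_apply_le_trace (h.params.isMonotoneRayAffine.posSemidef (hq t)) i j
      have h3 := trace_target_le (hq t) (p := (A (t + 1) ω, N (t + 1) ω)) hN
      have h4 := h.trace_bellman_le (hq t)
      have h5 := (hq t).trace_nonneg
      rw [abs_of_nonneg (by positivity : 0 ≤ (1 + (C : ℝ)) * (gain (A (t + 1) ω, N (t + 1) ω) + r))]
      rw [noise, Matrix.sub_apply]
      refine (abs_sub _ _).trans ?_
      have h6 := mul_le_mul_of_nonneg_left (by linarith :
        1 + (qLearning A N α Q₀ t ω).trace ≤ 1 + C) (add_nonneg hg hr)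
      linarith
    · rw [zero_mul, abs_zero]
      exact abs_nonneg _
  have hξ2 : ∀ t, MemLp (fun ω => β t ω * noise μ A N α Q₀ t ω i j) 2 μ := fun t =>
    (hdom t).1.mono ((hξm t).mono (h.info_le _) le_rfl).aestronglyMeasurable (by simpa using hξb t)
  refine ae_exists_tendsto_sum_of_orthogonal (ℱ := h.filtration)
    (B := L * ∫ ω, ((1 + (C : ℝ)) * (gain (A 1 ω, N 1 ω) + r)) ^ 2 ∂μ)
    hξm hξ2 (fun t g hg hg2 => ?_) fun T => ?_
  · have hg' : Measurable[info A N t] g := hg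
    have hint : Integrable (fun ω => g ω * (β t ω * noise μ A N α Q₀ t ω i j)) μ :=
      hg2.integrable_mul (hξ2 t)
    -- Given these past quantities, the next sample averages `target` to `bellman`, so the frozen
    -- integral vanishes.
    have hX : Measurable[info A N t] fun ω => (g ω * β t ω, qLearning A N α Q₀ t ω) :=
      (hg'.mul (hβm t)).prodMk (hQm t)
    let f : (ℝ × Matrix (Fin n ⊕ Fin m) (Fin n ⊕ Fin m) ℝ) × (Matrix (Fin n) (Fin n ⊕ Fin m) ℝ ×
        Matrix (Fin n ⊕ Fin m) (Fin n ⊕ Fin m) ℝ) → ℝ := fun p =>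
      p.1.1 * (target p.1.2 p.2 - bellman μ (A 1) (N 1) p.1.2) i j
    have hf : Measurable f := measurable_fst.fst.mul (measurable_matrix_iff.1
      (measurable_matrix_sub (measurable_target measurable_fst.snd measurable_snd)
        (h.measurable_bellman measurable_fst.snd)) i j)
    have heq : ∀ ω, g ω * (β t ω * noise μ A N α Q₀ t ω i j) =
        f ((g ω * β t ω, qLearning A N α Q₀ t ω), (A (t + 1) ω, N (t + 1) ω)) := by
      intro ω
      simp only [f, noise, mul_assoc]
    refine (integral_congr_ae (Eventually.of_forall heq)).trans ?_
    rw [(h.integral_freeze hX hf (hint.congr (Eventually.of_forall heq))).2]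
    refine integral_eq_zero_of_ae (Eventually.of_forall fun ω => ?_)
    have h1 := h.integral_linearMap_target (Matrix.entryLinearMap ℝ ℝ i j)
      (qLearning A N α Q₀ t ω)
    simp only [Matrix.entryLinearMap_apply] at h1
    simp only [f, Matrix.sub_apply, Pi.zero_apply]
    rw [integral_const_mul, integral_sub h1.1 (integrable_const _), h1.2]
    simp
  · set B₁ := ∫ ω, ((1 + (C : ℝ)) * (gain (A 1 ω, N 1 ω) + r)) ^ 2 ∂μ
    have hB₁ : 0 ≤ B₁ := integral_nonneg fun ω => sq_nonneg _
    calc ∑ t ∈ Finset.range T, ∫ ω, (β t ω * noise μ A N α Q₀ t ω i j) ^ 2 ∂μ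
        ≤ ∑ t ∈ Finset.range T, (∫ ω, β₀ t ω ^ 2 ∂μ) * B₁ := by
          refine Finset.sum_le_sum fun t _ => ?_
          rw [← (hdom t).2]
          refine integral_mono_ae (hξ2 t).integrable_sq (hdom t).1.integrable_sq ?_
          filter_upwards [hξb t] with ω hω
          exact sq_le_sq.2 hω
      _ = (∫ ω, ∑ t ∈ Finset.range T, β₀ t ω ^ 2 ∂μ) * B₁ := by
          rw [integral_finsetSum _ fun t _ => (hβ₀2 t).integrable_sq, Finset.sum_mul]
      _ ≤ L * B₁ := by
          refine mul_le_mul_of_nonneg_right ?_ hB₁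
          calc ∫ ω, ∑ t ∈ Finset.range T, β₀ t ω ^ 2 ∂μ ≤ ∫ _, (L : ℝ) ∂μ := by
                refine integral_mono (integrable_finsetSum _ fun t _ => (hβ₀2 t).integrable_sq)
                  (integrable_const _) fun ω => ?_
                exact sum_cutoff_sq_le (fun t => α t ω) L (Nat.cast_nonneg L) T
            _ = L := by simp

/-- Almost surely, the weighted noise is summable wherever the iterates stay bounded. -/
theorem ae_noise_tendsto (h : IIDParams μ A N) (hα : LearningRates μ A N α)
    (hQ₀ : Q₀.PosSemidef) :
    ∀ᵐ ω ∂μ, (∃ C : ℝ, ∀ t, (qLearning A N α Q₀ t ω).trace ≤ C) →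
      ∃ X, Tendsto (fun T => ∑ t ∈ Finset.range T, α t ω • noise μ A N α Q₀ t ω) atTop (𝓝 X) := by
  have hall := ae_all_iff.2 fun C : ℕ => ae_all_iff.2 fun L : ℕ => ae_all_iff.2 fun i =>
    ae_all_iff.2 fun j => h.ae_noise_entry_tendsto hα hQ₀ C L i j
  filter_upwards [hall, hα.sq] with ω hω hsq hb
  obtain ⟨C, hC⟩ := hb
  obtain ⟨C', hC'⟩ := exists_nat_ge C
  obtain ⟨L, hL⟩ := exists_nat_ge (∑' t, α t ω ^ 2)
  have hL' : ∀ T, ∑ s ∈ Finset.range T, α s ω ^ 2 ≤ L := fun T =>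
    (hsq.sum_le_tsum _ fun _ _ => sq_nonneg _).trans hL
  have hent : ∀ i j, ∃ c, Tendsto (fun T => ∑ t ∈ Finset.range T,
      α t ω * noise μ A N α Q₀ t ω i j) atTop (𝓝 c) := by
    intro i j
    obtain ⟨c, hc⟩ := hω C' L i j
    refine ⟨c, hc.congr fun T => Finset.sum_congr rfl fun t _ => ?_⟩
    -- On this path neither cutoff is active.
    rw [if_pos ((hC t).trans hC'), if_pos (hL' _)]
  choose c hc using hent
  refine ⟨Matrix.of c, tendsto_pi_nhds.2 fun i => tendsto_pi_nhds.2 fun j => ?_⟩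
  refine (hc i j).congr fun T => ?_
  rw [Matrix.sum_apply]
  simp

theorem ae_isApproximationPath (h : IIDParams μ A N) (hα : LearningRates μ A N α)
    (hQ₀ : Q₀.PosSemidef) :
    ∀ᵐ ω ∂μ, (∃ C : ℝ, ∀ t, (qLearning A N α Q₀ t ω).trace ≤ C) →
      IsApproximationPath (bellman μ (A 1) (N 1)) (fun t => α t ω)
        (fun t => noise μ A N α Q₀ t ω) (fun t => qLearning A N α Q₀ t ω) := by
  filter_upwards [h.ae_noise_tendsto hα hQ₀, h.qLearning_posSemidef hα hQ₀,
    ae_all_iff.2 hα.mem, hα.sum] with ω hn hq hm hs hb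
  refine ⟨hm, hs, hq, fun t => ?_, hn hb⟩
  rw [qLearning_succ, noise]
  congr 2
  abel

end IIDParams

end Learning

/-! ### Almost sure boundedness and convergence of Q-learning. -/

section Boundedness

variable {n m : ℕ} {Ω : Type*} [MeasurableSpace Ω] {μ : Measure Ω} [IsProbabilityMeasure μ]
  {A : ℕ → Ω → Matrix (Fin n) (Fin n ⊕ Fin m) ℝ}
  {N : ℕ → Ω → Matrix (Fin n ⊕ Fin m) (Fin n ⊕ Fin m) ℝ} {α : ℕ → Ω → ℝ}
  {Q₀ : Matrix (Fin n ⊕ Fin m) (Fin n ⊕ Fin m) ℝ}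

/-- Second-order Taylor bound for `y ↦ max y 0 ^ 2`, whose derivative is `2`-Lipschitz. -/
theorem max_add_sq_le (y h : ℝ) : max (y + h) 0 ^ 2 ≤ max y 0 ^ 2 + 2 * max y 0 * h + h ^ 2 := by
  rcases le_total 0 y with hy | hy <;> rcases le_total 0 (y + h) with hyh | hyh
  · rw [max_eq_left hy, max_eq_left hyh]; linarith [sq_nonneg (y + h), add_sq y h]
  · rw [max_eq_left hy, max_eq_right hyh]; linarith [sq_nonneg (y + h), add_sq y h]
  · rw [max_eq_right hy, max_eq_left hyh]; nlinarith
  · rw [max_eq_right hy, max_eq_right hyh]; nlinarith [sq_nonneg h]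

namespace IIDParams

/-- Drift of the truncated quadratic Lyapunov function in one step of Q-learning. -/
theorem exists_drift_bound (h : IIDParams μ A N)
    {l : Matrix (Fin n ⊕ Fin m) (Fin n ⊕ Fin m) ℝ →ₗ[ℝ] ℝ} {b c κ : ℝ} (hc : 0 < c) (hκ : 0 < κ)
    (hlow : ∀ P, P.PosSemidef → P.trace ≤ l P) (hup : ∀ P, P.PosSemidef → l P ≤ κ * P.trace)
    (hdrift : ∀ P, P.PosSemidef → l (bellman μ (A 1) (N 1) P) ≤ b + l P - c * l P) :
    ∃ C, 0 ≤ C ∧ ∀ (q : Matrix (Fin n ⊕ Fin m) (Fin n ⊕ Fin m) ℝ) (a : ℝ), q.PosSemidef → 0 ≤ a →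
      Integrable (fun ω => max (l (q + a • (target q (A 1 ω, N 1 ω) - q)) - b / c) 0 ^ 2) μ ∧
      ∫ ω, max (l (q + a • (target q (A 1 ω, N 1 ω) - q)) - b / c) 0 ^ 2 ∂μ ≤
        max (l q - b / c) 0 ^ 2 + C * a ^ 2 * (1 + max (l q - b / c) 0 ^ 2) := by
  set R := ∫ ω, (1 + gain (A 1 ω, N 1 ω)) ^ 2 ∂μ
  have hR : 0 ≤ R := integral_nonneg fun ω => sq_nonneg _
  set y₀ := b / c with hy₀
  -- The constant combines the bounds `hdS` for the second moment of the increment and `htr` for `1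
  -- + q.trace` in terms of `Y`.
  refine ⟨2 * κ ^ 2 * R * (1 + |y₀|) ^ 2, by positivity, fun q a hq ha => ?_⟩
  set Y := max (l q - y₀) 0 with hY
  have hY0 : 0 ≤ Y := le_max_right _ _
  set d : Ω → ℝ := fun ω => l (target q (A 1 ω, N 1 ω)) - l q with hd
  have hlt := h.integral_linearMap_target l q
  have hlq0 : 0 ≤ l q := hq.trace_nonneg.trans (hlow q hq)
  have hdb : ∀ᵐ ω ∂μ, |d ω| ≤ κ * (1 + q.trace) * (1 + gain (A 1 ω, N 1 ω)) := by
    filter_upwards [h.posSemidef 0] with ω hω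
    have hG := target_posSemidef hq (p := (A 1 ω, N 1 ω)) hω
    have h1 := hup _ hG
    have h2 := mul_le_mul_of_nonneg_left (trace_target_le hq (p := (A 1 ω, N 1 ω)) hω) hκ.le
    have h3 := hG.trace_nonneg.trans (hlow _ hG)
    have h4 := hup _ hq
    have h5 := mul_nonneg hκ.le hq.trace_nonneg
    have h6 := mul_nonneg (mul_nonneg hκ.le (by linarith [hq.trace_nonneg] : 0 ≤ 1 + q.trace))
      (gain_nonneg (p := (A 1 ω, N 1 ω)) hω)
    simp only [hd]
    rw [abs_le]
    constructor <;> nlinarith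
  have hgain2 : MemLp (fun ω => 1 + gain (A 1 ω, N 1 ω)) 2 μ :=
    (memLp_const (1 : ℝ)).add (h.memLp_gain 0)
  have hdint : Integrable d μ := hlt.1.sub (integrable_const _)
  have hd2 : MemLp d 2 μ := by
    refine (hgain2.const_mul (κ * (1 + q.trace))).mono' hdint.1 ?_
    simpa using hdb
  have hdI : ∫ ω, d ω ∂μ ≤ c * (y₀ - l q) := by
    simp only [hd]
    rw [integral_sub hlt.1 (integrable_const _), hlt.2]
    have h1 := hdrift q hq
    have h2 : c * y₀ = b := by rw [hy₀]; field_simp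
    simp
    linarith
  have hdS : ∫ ω, d ω ^ 2 ∂μ ≤ κ ^ 2 * (1 + q.trace) ^ 2 * R := by
    rw [← integral_const_mul]
    refine integral_mono_ae hd2.integrable_sq (hgain2.integrable_sq.const_mul _) ?_
    filter_upwards [hdb] with ω hω
    have := pow_le_pow_left₀ (abs_nonneg _) hω 2
    rw [sq_abs] at this
    refine this.trans (le_of_eq (by ring))
  have hpt : ∀ ω, max (l (q + a • (target q (A 1 ω, N 1 ω) - q)) - y₀) 0 ^ 2 ≤
      Y ^ 2 + (2 * Y * a) * d ω + a ^ 2 * d ω ^ 2 := by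
    intro ω
    have h1 : l (q + a • (target q (A 1 ω, N 1 ω) - q)) - y₀ = (l q - y₀) + a * d ω := by
      simp only [map_add, map_smul, map_sub, smul_eq_mul, hd]; ring
    rw [h1]
    refine (max_add_sq_le _ _).trans (le_of_eq ?_)
    rw [← hY]; ring
  have hi1 : Integrable (fun ω => Y ^ 2 + (2 * Y * a) * d ω) μ :=
    (integrable_const _).add (hdint.const_mul _)
  have hi2 : Integrable (fun ω => a ^ 2 * d ω ^ 2) μ := hd2.integrable_sq.const_mul _
  -- Above the level `b / c` the mean drift is nonpositive; below it `Y = 0`. The truncation thus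
  -- removes the first-order term.
  have hYd : (2 * Y * a) * ∫ ω, d ω ∂μ ≤ 0 := by
    have h1 := mul_le_mul_of_nonneg_left hdI (by positivity : 0 ≤ 2 * Y * a)
    have h2 : Y * (y₀ - l q) ≤ 0 := by
      rcases le_total 0 (l q - y₀) with hle | hle
      · exact mul_nonpos_of_nonneg_of_nonpos hY0 (by linarith)
      · rw [hY, max_eq_right hle, zero_mul]
    nlinarith [mul_nonneg ha hc.le]
  have htr : (1 + q.trace) ^ 2 ≤ 2 * (1 + |y₀|) ^ 2 * (1 + Y ^ 2) := by
    have h1 : 1 + q.trace ≤ (1 + |y₀|) * (1 + Y) := by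
      have := hlow q hq
      have := le_max_left (l q - y₀) 0
      nlinarith [le_abs_self y₀, abs_nonneg y₀, mul_nonneg (abs_nonneg y₀) hY0]
    calc (1 + q.trace) ^ 2 ≤ ((1 + |y₀|) * (1 + Y)) ^ 2 :=
          pow_le_pow_left₀ (by linarith [hq.trace_nonneg]) h1 2
      _ = (1 + |y₀|) ^ 2 * (1 + Y) ^ 2 := by ring
      _ ≤ (1 + |y₀|) ^ 2 * (2 * (1 + Y ^ 2)) :=
          mul_le_mul_of_nonneg_left (by nlinarith [sq_nonneg (Y - 1)]) (by positivity)
      _ = _ := by ring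
  have hmeas : Measurable fun ω => max (l (q + a • (target q (A 1 ω, N 1 ω) - q)) - y₀) 0 ^ 2 :=
    (((measurable_linearMap l (measurable_matrix_add measurable_const (measurable_matrix_smul
      measurable_const (measurable_matrix_sub (measurable_target measurable_const
        (h.measurable_pair 0)) measurable_const)))).sub_const y₀).max measurable_const).pow_const 2
  refine ⟨(hi1.add hi2).mono' hmeas.aestronglyMeasurable (Eventually.of_forall fun ω => ?_), ?_⟩
  · rw [Real.norm_of_nonneg (sq_nonneg _)]
    exact hpt ω
  calc ∫ ω, max (l (q + a • (target q (A 1 ω, N 1 ω) - q)) - y₀) 0 ^ 2 ∂μ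
      ≤ ∫ ω, (Y ^ 2 + (2 * Y * a) * d ω + a ^ 2 * d ω ^ 2) ∂μ :=
        integral_mono_of_nonneg (Eventually.of_forall fun ω => sq_nonneg _) (hi1.add hi2)
          (Eventually.of_forall hpt)
    _ = Y ^ 2 + (2 * Y * a) * ∫ ω, d ω ∂μ + a ^ 2 * ∫ ω, d ω ^ 2 ∂μ := by
        rw [integral_add hi1 hi2, integral_add (integrable_const _) (hdint.const_mul _),
          integral_const_mul, integral_const_mul]
        simp
    _ ≤ Y ^ 2 + a ^ 2 * (κ ^ 2 * (1 + q.trace) ^ 2 * R) := by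
        have := mul_le_mul_of_nonneg_left hdS (sq_nonneg a)
        linarith
    _ ≤ _ := by
        have := mul_le_mul_of_nonneg_left htr (by positivity : 0 ≤ a ^ 2 * κ ^ 2 * R)
        nlinarith

/-- If the Bellman operator has a fixed point, then the Q-learning iterates are almost surely
bounded. -/
theorem ae_bounded_of_fixedPoint (h : IIDParams μ A N) (hα : LearningRates μ A N α)
    (hQ₀ : Q₀.PosSemidef) {Q : Matrix (Fin n ⊕ Fin m) (Fin n ⊕ Fin m) ℝ} (hQ : Q.PosSemidef)
    (hfix : bellman μ (A 1) (N 1) Q = Q) :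
    ∀ᵐ ω ∂μ, ∃ C : ℝ, ∀ t, (qLearning A N α Q₀ t ω).trace ≤ C := by
  obtain ⟨l, b, c, κ, hc, hκ, hlow, hup, hdrift⟩ := h.params.exists_lyapunov hQ hfix
  obtain ⟨C, hC, hbound⟩ := h.exists_drift_bound hc hκ hlow hup hdrift
  set y₀ := b / c
  set q := qLearning A N α Q₀ with hq
  set Z : ℕ → Ω → ℝ := fun t ω => max (l (q t ω) - y₀) 0 ^ 2 with hZ
  set p : ℕ → Ω → ℝ := fun t ω => ∏ s ∈ Finset.range t, (1 + C * α s ω ^ 2) with hp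
  -- One step multiplies `1 + Z` in conditional mean by at most `1 + C α²`; dividing by the product
  -- yields a supermartingale. The product at `t + 1` involves rates only up to time `t`, so it is
  -- known at time `t`.
  set W : ℕ → Ω → ℝ := fun t ω => (p t ω)⁻¹ * (1 + Z t ω) with hW
  have hqm := measurable_qLearning hα Q₀
  have hpsd := h.qLearning_posSemidef hα hQ₀
  have hZ0 : ∀ t ω, 0 ≤ Z t ω := fun t ω => sq_nonneg _
  have hp1 : ∀ t ω, 1 ≤ p t ω := by
    intro t ω
    simp only [hp]
    induction t with
    | zero => simp
    | succ t ih =>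
      rw [Finset.prod_range_succ]
      exact one_le_mul_of_one_le_of_one_le ih
        (by linarith [mul_nonneg hC (sq_nonneg (α t ω))])
  have hpinv0 : ∀ t ω, 0 ≤ (p t ω)⁻¹ := fun t ω => inv_nonneg.2 (by linarith [hp1 t ω])
  have hW0 : ∀ t ω, 0 ≤ W t ω := fun t ω => mul_nonneg (hpinv0 t ω) (by linarith [hZ0 t ω])
  have hZm : ∀ t, Measurable[info A N t] (Z t) := fun t =>
    (((measurable_linearMap l (hqm t)).sub_const y₀).max measurable_const).pow_const 2
  have hpm : ∀ t k, t ≤ k + 1 → Measurable[info A N k] (p t) := fun t k htk =>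
    Finset.measurable_prod _ fun s hs => ((((hα.meas s).mono (info_mono A N
      (by have := Finset.mem_range.1 hs; omega)) le_rfl).pow_const 2).const_mul C).const_add 1
  have hWm : ∀ t, Measurable[info A N t] (W t) := fun t =>
    (hpm t t (Nat.le_succ t)).inv.mul ((hZm t).const_add 1)
  have hZint : ∀ t, Integrable (Z t) μ := by
    intro t
    have h1 : MemLp (fun ω => κ * (q t ω).trace + |y₀|) 2 μ :=
      ((h.memLp_trace_qLearning hα hQ₀ t).const_mul κ).add (memLp_const _)
    refine h1.integrable_sq.mono' ((hZm t).mono (h.info_le t) le_rfl).aestronglyMeasurable ?_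
    filter_upwards [hpsd] with ω hω
    rw [Real.norm_of_nonneg (hZ0 t ω)]
    have h2 := hup _ (hω t)
    have h3 := mul_nonneg hκ.le (hω t).trace_nonneg
    refine pow_le_pow_left₀ (le_max_right _ _) (max_le ?_ ?_) 2
    · linarith [neg_abs_le y₀]
    · positivity
  have hWint : ∀ t, Integrable (W t) μ := by
    intro t
    refine ((integrable_const (1 : ℝ)).add (hZint t)).mono'
      ((hWm t).mono (h.info_le t) le_rfl).aestronglyMeasurable (Eventually.of_forall fun ω => ?_)
    rw [Real.norm_of_nonneg (hW0 t ω)]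
    exact mul_le_of_le_one_left (by linarith [hZ0 t ω]) (inv_le_one_of_one_le₀ (hp1 t ω))
  have hsuper : Supermartingale W h.filtration μ := by
    refine supermartingale_of_setIntegral_succ_le (fun t => (hWm t).stronglyMeasurable) hWint
      fun t s hs => ?_
    have hs' : MeasurableSet s := h.info_le t s hs
    rw [← integral_indicator hs', ← integral_indicator hs']
    set w : Ω → ℝ := s.indicator fun ω => (p (t + 1) ω)⁻¹ with hw
    have hwm : Measurable[info A N t] w := (hpm (t + 1) t le_rfl).inv.indicator hs
    let f : (ℝ × ℝ × Matrix (Fin n ⊕ Fin m) (Fin n ⊕ Fin m) ℝ) ×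
        (Matrix (Fin n) (Fin n ⊕ Fin m) ℝ × Matrix (Fin n ⊕ Fin m) (Fin n ⊕ Fin m) ℝ) → ℝ :=
      fun z => z.1.1 * (1 + max (l (z.1.2.2 + z.1.2.1 • (target z.1.2.2 z.2 - z.1.2.2)) - y₀) 0 ^ 2)
    have hf : Measurable f := by
      have hq' : Measurable fun z : (ℝ × ℝ × Matrix (Fin n ⊕ Fin m) (Fin n ⊕ Fin m) ℝ) ×
        (Matrix (Fin n) (Fin n ⊕ Fin m) ℝ × Matrix (Fin n ⊕ Fin m) (Fin n ⊕ Fin m) ℝ) => z.1.2.2 :=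
        measurable_fst.snd.snd
      refine measurable_fst.fst.mul (Measurable.const_add ?_ 1)
      refine (((measurable_linearMap l (measurable_matrix_add hq' (measurable_matrix_smul
        measurable_fst.snd.fst (measurable_matrix_sub (measurable_target hq' measurable_snd)
          hq')))).sub_const y₀).max measurable_const).pow_const 2
    have hX : Measurable[info A N t] fun ω => (w ω, α t ω, q t ω) :=
      hwm.prodMk ((hα.meas t).prodMk (hqm t))
    have heq : ∀ ω, s.indicator (W (t + 1)) ω =
        f ((w ω, α t ω, q t ω), (A (t + 1) ω, N (t + 1) ω)) := by
      intro ω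
      by_cases hω : ω ∈ s
      · simp only [hw, Set.indicator_of_mem hω, f]
        rfl
      · simp [hw, f, hω]
    have hint := ((hWint (t + 1)).indicator hs').congr (Eventually.of_forall heq)
    have hfr := h.integral_freeze hX hf hint
    rw [integral_congr_ae (Eventually.of_forall heq), hfr.2]
    refine integral_mono_ae hfr.1 ((hWint t).indicator hs') ?_
    filter_upwards [hpsd, hα.mem t] with ω hω ha
    simp only [f]
    rw [integral_const_mul]
    have hZω := hbound (q t ω) (α t ω) (hω t) ha.1
    have h1 : ∫ ω', (1 + max (l (q t ω + α t ω • (target (q t ω) (A 1 ω', N 1 ω') - q t ω)) - y₀) 0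
        ^ 2) ∂μ ≤ (1 + C * α t ω ^ 2) * (1 + Z t ω) := by
      rw [integral_add (integrable_const _) hZω.1]
      simp only [integral_const, probReal_univ, smul_eq_mul, mul_one, hZ]
      linarith [hZω.2]
    by_cases hωs : ω ∈ s
    · simp only [hw, Set.indicator_of_mem hωs, hW]
      refine (mul_le_mul_of_nonneg_left h1 (hpinv0 _ ω)).trans (le_of_eq ?_)
      have hpos : 0 < 1 + C * α t ω ^ 2 := by nlinarith [mul_nonneg hC (sq_nonneg (α t ω))]
      have hpt : 0 < p t ω := by linarith [hp1 t ω]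
      have hps : p (t + 1) ω = p t ω * (1 + C * α t ω ^ 2) := Finset.prod_range_succ _ _
      rw [hps]
      field_simp
    · simp [hw, hωs]
  filter_upwards [ae_bddAbove_of_supermartingale hsuper
    (fun t => Eventually.of_forall (hW0 t)), hα.sq, hpsd] with ω hB hsq hω
  obtain ⟨B, hB⟩ := hB
  set S := ∑' t, α t ω ^ 2
  -- Summability of `α²` bounds the discount product along the path, so a bound on `W` transfers to
  -- `Z`.
  have hpS : ∀ t, p t ω ≤ Real.exp (C * S) := by
    intro t
    calc p t ω ≤ ∏ s ∈ Finset.range t, Real.exp (C * α s ω ^ 2) := by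
          refine Finset.prod_le_prod (fun s _ => by positivity) fun s _ => ?_
          linarith [Real.add_one_le_exp (C * α s ω ^ 2)]
      _ = Real.exp (C * ∑ s ∈ Finset.range t, α s ω ^ 2) := by
          rw [← Real.exp_sum, Finset.mul_sum]
      _ ≤ _ := Real.exp_le_exp.2 (mul_le_mul_of_nonneg_left
          (hsq.sum_le_tsum _ fun _ _ => sq_nonneg _) hC)
  refine ⟨y₀ + 1 + B * Real.exp (C * S), fun t => ?_⟩
  have hpt : 0 < p t ω := by linarith [hp1 t ω]
  have h1 : 1 + Z t ω ≤ B * Real.exp (C * S) := by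
    have h2 : 1 + Z t ω = W t ω * p t ω := by simp only [hW]; field_simp
    rw [h2]
    exact mul_le_mul (hB t) (hpS t) hpt.le ((hW0 t ω).trans (hB t))
  have h3 := hlow _ (hω t)
  have h4 : l (q t ω) - y₀ ≤ max (l (q t ω) - y₀) 0 := le_max_left _ _
  have h5 : max (l (q t ω) - y₀) 0 ≤ 1 + Z t ω := by
    simp only [hZ]
    nlinarith [sq_nonneg (max (l (q t ω) - y₀) 0 - 1)]
  linarith

/-- Almost sure convergence of Q-learning to any fixed point of the Bellman operator. -/
theorem ae_tendsto_qLearning (h : IIDParams μ A N) (hα : LearningRates μ A N α)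
    (hQ₀ : Q₀.PosSemidef) {Q : Matrix (Fin n ⊕ Fin m) (Fin n ⊕ Fin m) ℝ} (hQ : Q.PosSemidef)
    (hfix : bellman μ (A 1) (N 1) Q = Q) :
    ∀ᵐ ω ∂μ, Tendsto (fun t => qLearning A N α Q₀ t ω) atTop (𝓝 Q) := by
  filter_upwards [h.ae_bounded_of_fixedPoint hα hQ₀ hQ hfix,
    h.ae_isApproximationPath hα hQ₀] with ω hb hpath
  obtain ⟨C, hC⟩ := hb
  exact (hpath ⟨C, hC⟩).tendsto h.params.isMonotoneRayAffine hC hQ hfix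

end IIDParams

end Boundedness

/-! ### From the spectral norm to the trace. -/

section SpectralNorm

variable {ι : Type*} [Fintype ι] [DecidableEq ι]

theorem abs_apply_le_norm2 (M : Matrix ι ι ℝ) (i j : ι) : |M i j| ≤ norm2 M := by
  have h1 := (Matrix.toEuclideanCLM (n := ι) (𝕜 := ℝ) M).le_opNorm (EuclideanSpace.single j 1)
  have h2 := PiLp.norm_apply_le (Matrix.toEuclideanCLM (n := ι) (𝕜 := ℝ) M
    (EuclideanSpace.single j 1)) i
  have h3 : (Matrix.toEuclideanCLM (n := ι) (𝕜 := ℝ) M (EuclideanSpace.single j 1)) i = M i j := by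
    simp
  rw [h3, Real.norm_eq_abs] at h2
  simp only [PiLp.norm_single, norm_one, mul_one] at h1
  exact h2.trans h1

theorem abs_trace_le_norm2 (M : Matrix ι ι ℝ) : |M.trace| ≤ Fintype.card ι * norm2 M := by
  refine (Finset.abs_sum_le_sum_abs _ _).trans ?_
  refine (Finset.sum_le_sum fun i _ => abs_apply_le_norm2 M i i).trans ?_
  simp

theorem continuous_norm2 : Continuous (norm2 (ι := ι)) := by
  let f : Matrix ι ι ℝ →ₗ[ℝ] EuclideanSpace ℝ ι →L[ℝ] EuclideanSpace ℝ ι :=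
    { toFun := fun M => Matrix.toEuclideanCLM (n := ι) (𝕜 := ℝ) M
      map_add' := map_add _
      map_smul' := map_smul _ }
  exact f.continuous_of_finiteDimensional.norm

theorem memLp_trace_of_norm2 {Ω : Type*} [MeasurableSpace Ω] {μ : Measure Ω} {M : Ω → Matrix ι ι ℝ}
    (hM : Measurable M) {g : Ω → ℝ} (hg : Integrable g μ) (h : ∀ ω, norm2 (M ω) ^ 2 ≤ g ω) :
    MemLp (fun ω => (M ω).trace) 2 μ := by
  have hm := (measurable_trace hM).aestronglyMeasurable (μ := μ)
  rw [memLp_two_iff_integrable_sq hm]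
  refine (hg.const_mul ((Fintype.card ι : ℝ) ^ 2)).mono' (hm.pow 2) (Eventually.of_forall fun ω => ?_)
  rw [Real.norm_of_nonneg (sq_nonneg _)]
  have h1 := pow_le_pow_left₀ (abs_nonneg _) (abs_trace_le_norm2 (M ω)) 2
  rw [sq_abs, mul_pow] at h1
  exact h1.trans (mul_le_mul_of_nonneg_left (h ω) (sq_nonneg _))

end SpectralNorm

end RandomLQ

/-! ### Assembly of the equivalences and their consequences. -/

theorem theorem1 {n m : ℕ} {Ω : Type*} [MeasurableSpace Ω] (μ : Measure Ω)
    [IsProbabilityMeasure μ]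
    (A : ℕ → Ω → Matrix (Fin n) (Fin n ⊕ Fin m) ℝ)
    (N : ℕ → Ω → Matrix (Fin n ⊕ Fin m) (Fin n ⊕ Fin m) ℝ)
    (α : ℕ → Ω → ℝ)
    (Q₀ : Matrix (Fin n ⊕ Fin m) (Fin n ⊕ Fin m) ℝ)
    -- the random parameters `(𝒜_t, N_t)`, `t = 1, 2, …` (index `0` is not used)
    (hA_meas : ∀ t, Measurable (A (t + 1)))
    (hN_meas : ∀ t, Measurable (N (t + 1)))
    (h_indep : iIndepFun (fun (t : ℕ) (ω : Ω) => (A (t + 1) ω, N (t + 1) ω)) μ)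
    (h_ident : ∀ t : ℕ, IdentDistrib (fun ω => (A (t + 1) ω, N (t + 1) ω))
      (fun ω => (A 1 ω, N 1 ω)) μ μ)
    (hN_psd : ∀ t, ∀ᵐ ω ∂μ, (N (t + 1) ω).PosSemidef)
    -- the learning rates
    (hα_meas : ∀ t, Measurable[RandomLQ.info A N t] (α t))
    (hα_mem : ∀ t, ∀ᵐ ω ∂μ, α t ω ∈ Set.Icc (0 : ℝ) 1)
    (hα_sum : ∀ᵐ ω ∂μ, Tendsto (fun T => ∑ t ∈ Finset.range T, α t ω) atTop atTop)
    (hα_sq : ∀ᵐ ω ∂μ, Summable (fun t => α t ω ^ 2))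
    -- the initial matrix
    (hQ₀ : Q₀.PosSemidef)
    -- the assumptions on the common law of the parameters
    (h_mom : Integrable (fun ω =>
      RandomLQ.norm2 (N 1 ω) ^ 2 + RandomLQ.norm2 ((A 1 ω)ᵀ * A 1 ω) ^ 2) μ)
    (hEN : (RandomLQ.expect μ (N 1)).PosDef) :
    List.TFAE [
      RandomLQ.WellPosed μ A N,
      ∃ K : Matrix (Fin n) (Fin n) ℝ, RandomLQ.SolvesARE μ (A 1) (N 1) K,
      0 < μ {ω | ∃ C : ℝ, ∀ t, RandomLQ.norm2 (RandomLQ.qLearning A N α Q₀ t ω) ≤ C},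
      ∃ Q : Matrix (Fin n ⊕ Fin m) (Fin n ⊕ Fin m) ℝ, Q.PosSemidef ∧
        ∀ᵐ ω ∂μ, Tendsto (fun t => RandomLQ.qLearning A N α Q₀ t ω) atTop (𝓝 Q)] ∧
    (RandomLQ.WellPosed μ A N →
      ∃ (K : Matrix (Fin n) (Fin n) ℝ) (Q : Matrix (Fin n ⊕ Fin m) (Fin n ⊕ Fin m) ℝ),
        RandomLQ.SolvesARE μ (A 1) (N 1) K ∧
        Q.PosSemidef ∧
        (∀ᵐ ω ∂μ, Tendsto (fun t => RandomLQ.qLearning A N α Q₀ t ω) atTop (𝓝 Q)) ∧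
        (∀ x : Fin n → ℝ, RandomLQ.value μ A N x = ENNReal.ofReal (x ⬝ᵥ (K *ᵥ x))) ∧
        (∀ K' : Matrix (Fin n) (Fin n) ℝ, RandomLQ.SolvesARE μ (A 1) (N 1) K' → K' = K) ∧
        K = RandomLQ.piMap Q ∧
        (∀ x : Fin n → ℝ, ∃ u : ℕ → Ω → Fin m → ℝ, RandomLQ.IsOptimal μ A N x u ∧
          ∀ t ω, u t ω = RandomLQ.gammaMap Q *ᵥ RandomLQ.state A x u t ω) ∧
        Q = RandomLQ.meanQ μ (A 1) (N 1) (RandomLQ.piMap Q)) := by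
  have hp : RandomLQ.SquareIntegrableParams μ (A 1) (N 1) :=
    { measurable_fst := hA_meas 0
      measurable_snd := hN_meas 0
      posSemidef := hN_psd 0
      memLp_fst := RandomLQ.memLp_trace_of_norm2 (RandomLQ.measurable_matrix_mul
        (RandomLQ.measurable_matrix_transpose (hA_meas 0)) (hA_meas 0)) h_mom
        fun ω => le_add_of_nonneg_left (sq_nonneg _)
      memLp_snd := RandomLQ.memLp_trace_of_norm2 (hN_meas 0) h_mom
        fun ω => le_add_of_nonneg_right (sq_nonneg _)
      posDef := hEN }
  have h : RandomLQ.IIDParams μ A N := ⟨hA_meas, hN_meas, h_indep, h_ident, hN_psd, hp⟩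
  have hα : RandomLQ.LearningRates μ A N α := ⟨hα_meas, hα_mem, hα_sum, hα_sq⟩
  have hab : RandomLQ.WellPosed μ A N →
      ∃ K : Matrix (Fin n) (Fin n) ℝ, RandomLQ.SolvesARE μ (A 1) (N 1) K := fun hw => by
    obtain ⟨Q, hQ, hfix⟩ := h.exists_fixedPoint_of_wellPosed hw
    exact ⟨_, RandomLQ.solvesARE_of_fixedPoint hQ hfix⟩
  have hconv : ∀ K : Matrix (Fin n) (Fin n) ℝ, RandomLQ.SolvesARE μ (A 1) (N 1) K →
      ∀ᵐ ω ∂μ, Tendsto (fun t => RandomLQ.qLearning A N α Q₀ t ω) atTop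
        (𝓝 (RandomLQ.meanQ μ (A 1) (N 1) K)) := fun K hK =>
    h.ae_tendsto_qLearning hα hQ₀ (hp.fixedPoint_of_solvesARE hK).1
      (hp.fixedPoint_of_solvesARE hK).2
  refine ⟨?_, fun hw => ?_⟩
  · tfae_have 1 → 2 := hab
    tfae_have 2 → 1 := by
      rintro ⟨K, hK⟩ x
      rw [h.value_eq hK]
      exact ENNReal.ofReal_lt_top
    tfae_have 2 → 4 := by
      rintro ⟨K, hK⟩
      exact ⟨_, hp.meanQ_posSemidef hK.1, hconv K hK⟩
    tfae_have 4 → 3 := by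
      rintro ⟨Q, -, hQ⟩
      have hae : ∀ᵐ ω ∂μ, ∃ C : ℝ, ∀ t,
          RandomLQ.norm2 (RandomLQ.qLearning A N α Q₀ t ω) ≤ C := by
        filter_upwards [hQ] with ω hω
        obtain ⟨C, hC⟩ := ((RandomLQ.continuous_norm2.tendsto Q).comp hω).bddAbove_range
        exact ⟨C, fun t => hC ⟨t, rfl⟩⟩
      exact pos_iff_ne_zero.2 (frequently_ae_iff.1 hae.frequently)
    tfae_have 3 → 2 := by
      intro hpos
      have hfreq : ∃ᵐ ω ∂μ, ∃ C : ℝ, ∀ t,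
          RandomLQ.norm2 (RandomLQ.qLearning A N α Q₀ t ω) ≤ C :=
        frequently_ae_iff.2 hpos.ne'
      -- Positive probability is needed only to pick one bounded path along which the noise series
      -- converges.
      obtain ⟨ω, ⟨C, hC⟩, hpath⟩ := (hfreq.and_eventually (h.ae_isApproximationPath hα hQ₀)).exists
      have hb : ∀ t, (RandomLQ.qLearning A N α Q₀ t ω).trace ≤
          Fintype.card (Fin n ⊕ Fin m) * C := fun t =>
        (le_abs_self _).trans ((RandomLQ.abs_trace_le_norm2 _).trans
          (mul_le_mul_of_nonneg_left (hC t) (Nat.cast_nonneg _)))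
      obtain ⟨Q, hQ, hfix⟩ := (hpath ⟨_, hb⟩).exists_fixedPoint hp.isMonotoneRayAffine hb
      exact ⟨_, RandomLQ.solvesARE_of_fixedPoint hQ hfix⟩
    tfae_finish
  · obtain ⟨K, hK⟩ := hab hw
    -- The limit is `Q = E[N + 𝒜ᵀ K 𝒜]`, so the Riccati equation reads `K = π(Q)`.
    refine ⟨K, RandomLQ.meanQ μ (A 1) (N 1) K, hK, hp.meanQ_posSemidef hK.1, hconv K hK,
      h.value_eq hK, fun K' hK' => h.solvesARE_unique hK hK', hK.2, fun x => ?_, ?_⟩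
    · refine ⟨_, h.isOptimal_closedLoop hK x, fun t ω => ?_⟩
      rw [RandomLQ.state_closedLoop]
    · rw [← hK.2]
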